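/- **Conventions.** All manifolds are smooth, finite-dimensional, Hausdorff and second countable; vector bundles are smooth, real and of constant finite rank. For an open set $U\subseteq M$ and a vector bundle $V\to M$, $\Gamma_U(V)$ is the $C^\infty(U)$-module of smooth sections over $U$. A *double vector bundle* $(\mathbb E;Q,B;M)$ is a manifold $\mathbb E$ with two vector bundle structures $\pi_Q\colon\mathbb E\to Q$ and $\pi_B\colon\mathbb E\to B$ over the total spaces of vector bundles $q_Q\colon Q\to M$, $q_B\colon B\to M$, such that $q_Q\circ\pi_Q=q_B\circ\pi_B$ and such that the projection, the addition $+_B$ and the scalar multiplication of $\mathbb E\to B$ are vector bundle morphisms, with respect to $\mathbb E\to Q$, over the projection, addition and scalar multiplication of $Q\to M$. Its core is $C=\ker\pi_Q\cap\ker\pi_B$. It is a *metric* double vector bundle if $\mathbb E\to B$ carries a smooth symmetric non-degenerate fibrewise bilinear pairing $\langle\cdot,\cdot\rangle$ that is linear over $Q$: $\langle e_1+_Qe_2,f_1+_Qf_2\rangle=\langle e_1,f_1\rangle+\langle e_2,f_2\rangle$ and $\langle r\cdot_Q e,r\cdot_Q f\rangle=r\langle e,f\rangle$ whenever these expressions are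 defined. The core is then identified with $Q^*$: $\tau\in Q_m^*$ corresponds to the core element $\overline\tau$ with $\langle e,0_{\pi_B(e)}+_Q\overline\tau\rangle=\tau(\pi_Q(e))$ for all $e\in\mathbb E$ over $m$. A *linear section* of $\mathbb E\to Q$ over $U$ is a smooth section $\chi\colon Q|_U\to\mathbb E$ that is a vector bundle morphism from $Q|_U\to U$ to $\mathbb E\to B$ over some section $b\in\Gamma_U(B)$, its base section. It is *isotropic* if $\langle\chi(q),\chi(q')\rangle=0$ for all $q,q'\in Q_m$, $m\in U$. Let $\mathcal C(\mathbb E)(U)$ be the set of isotropic linear sections over $U$, a $C^\infty(U)$-module via $f\cdot\chi:=(q_Q^*f)\chi$. For $\omega\in\Omega^2(Q)(U):=\Gamma_U(Q^*\wedge Q^*)$ define $\widetilde\omega\colon Q|_U\to\mathbb E$ by $\widetilde\omega(q)=0_q+_B\overline{\omega(q,\cdot)}$. A *linear splitting* is a smooth map $\Sigma\colon Q\times_MB\to\mathbb E$ with $\pi_Q\Sigma(q,b)=q$, $\pi_B\Sigma(q,b)=b$ that is linear in $b$ for the structure over $Q$ and linear in $q$ for the structure over $B$; it is *Lagrangian*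 if $\langle\Sigma(q,b),\Sigma(q',b)\rangle=0$ for all $q,q'\in Q_m$, $b\in B_m$, $m\in M$. **Theorem.** Let $(\mathbb E;Q,B;M)$ be a metric double vector bundle. Then: 1. $U\mapsto\mathcal C(\mathbb E)(U)$, with restriction of sections, is a sheaf of $C^\infty$-modules on $M$, and it is locally free of finite rank: every $p\in M$ has an open neighbourhood $U$ with finitely many $\chi_1,\dots,\chi_n\in\mathcal C(\mathbb E)(U)$ whose restrictions to each open $W\subseteq U$ form a basis of the $C^\infty(W)$-module $\mathcal C(\mathbb E)(W)$. 2. The maps $\omega\mapsto\widetilde\omega$ and $\chi\mapsto b$ (base section) are morphisms of sheaves of $C^\infty$-modules, and $$0\longrightarrow\Omega^2(Q)\longrightarrow\mathcal C(\mathbb E)\longrightarrow\Gamma(B)\longrightarrow0$$ is a short exact sequence of sheaves of $C^\infty$-modules; it is exact over every open $U\subseteq M$. 3. Lagrangian splittings $\Sigma$ of $\mathbb E$ are in bijection with the splittings $\sigma\colon\Gamma(B)\to\mathcal C(\mathbb E)$ of this sequence (morphisms of sheaves of $C^\infty$-modules that are right inverse to $\mathcal C(\mathbb E)\to\Gamma(B)$),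 via $\sigma(b)(q)=\Sigma(q,b(m))$ for $b\in\Gamma_U(B)$, $q\in Q_m$, $m\in U$. 4. There are a vector bundle $\widehat B\to M$ and an isomorphism $\Gamma(\widehat B)\cong\mathcal C(\mathbb E)$ of sheaves of $C^\infty$-modules, and a short exact sequence of smooth vector bundles over $M$ $$0\longrightarrow Q^*\wedge Q^*\longrightarrow\widehat B\longrightarrow B\longrightarrow0$$ that under this isomorphism induces the sequence in 2 on sections. -/

import Mathlib

open Bundle Manifold ContDiff TopologicalSpace

noncomputable section

/-! ### Smooth sections of a vector bundle over the open subsets of the base -/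

section Sections

variable {EX : Type*} [NormedAddCommGroup EX] [NormedSpace ℝ EX]
  {HX : Type*} [TopologicalSpace HX] (IX : ModelWithCorners ℝ EX HX)
  {X : Type*} [TopologicalSpace X] [ChartedSpace HX X]

/-- The ring `C^∞(U)` of smooth real functions on the open set `U`. -/
abbrev SmoothFun (U : Opens X) : Type _ := C^∞⟮IX, U; 𝓘(ℝ, ℝ), ℝ⟯

/-- Restriction of smooth functions to a smaller open set. -/
abbrev SmoothFun.res {U V : Opens X} (h : V ≤ U) : SmoothFun IX U →+* SmoothFun IX V :=
  ContMDiffMap.restrictRingHom IX 𝓘(ℝ, ℝ) ℝ h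

variable (F : Type*) [NormedAddCommGroup F] [NormedSpace ℝ F]
  (V : X → Type*) [∀ x, AddCommGroup (V x)] [∀ x, Module ℝ (V x)]

/-- Set-theoretic sections over `U` form a `C^∞(U)`-module under pointwise operations. -/
instance sectionsPiModule (U : Opens X) : Module (SmoothFun IX U) (∀ x : U, V x) :=
  Module.compHom (∀ x : U, V x)
    (ContMDiffMap.coeFnRingHom : SmoothFun IX U →+* (U → ℝ))

@[simp] theorem sectionsPi_smul_apply (U : Opens X) (f : SmoothFun IX U) (s : ∀ x : U, V x)
    (x : U) : (f • s) x = f x • s x := rfl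

variable [TopologicalSpace (TotalSpace F V)] [∀ x, TopologicalSpace (V x)]
  [FiberBundle F V] [VectorBundle ℝ F V]

section Smoothness

variable {IX F V} {EN : Type*} [NormedAddCommGroup EN] [NormedSpace ℝ EN]
  {HN : Type*} [TopologicalSpace HN] {IN : ModelWithCorners ℝ EN HN}
  {N : Type*} [TopologicalSpace N] [ChartedSpace HN N] {p : N → X}

theorem contMDiff_add_along {s t : ∀ y, V (p y)}
    (hs : ContMDiff IN (IX.prod 𝓘(ℝ, F)) ∞ (fun y => (⟨p y, s y⟩ : TotalSpace F V)))
    (ht : ContMDiff IN (IX.prod 𝓘(ℝ, F)) ∞ (fun y => (⟨p y, t y⟩ : TotalSpace F V))) :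
    ContMDiff IN (IX.prod 𝓘(ℝ, F)) ∞ (fun y => (⟨p y, s y + t y⟩ : TotalSpace F V)) := by
  intro y₀
  have h1 := contMDiffAt_totalSpace.1 (hs y₀)
  have h2 := contMDiffAt_totalSpace.1 (ht y₀)
  refine contMDiffAt_totalSpace.2 ⟨h1.1, (h1.2.add h2.2).congr_of_eventuallyEq ?_⟩
  set e := trivializationAt F V (p y₀)
  have hc : ContinuousAt p y₀ := h1.1.continuousAt
  filter_upwards [hc.preimage_mem_nhds
    (e.open_baseSet.mem_nhds (mem_baseSet_trivializationAt F V (p y₀)))] with y hy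
  exact (e.linear ℝ hy).map_add _ _

theorem contMDiff_smul_along {f : N → ℝ} {s : ∀ y, V (p y)}
    (hf : ContMDiff IN 𝓘(ℝ, ℝ) ∞ f)
    (hs : ContMDiff IN (IX.prod 𝓘(ℝ, F)) ∞ (fun y => (⟨p y, s y⟩ : TotalSpace F V))) :
    ContMDiff IN (IX.prod 𝓘(ℝ, F)) ∞ (fun y => (⟨p y, f y • s y⟩ : TotalSpace F V)) := by
  intro y₀
  have h1 := contMDiffAt_totalSpace.1 (hs y₀)
  refine contMDiffAt_totalSpace.2 ⟨h1.1, ((hf y₀).smul h1.2).congr_of_eventuallyEq ?_⟩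
  set e := trivializationAt F V (p y₀)
  have hc : ContinuousAt p y₀ := h1.1.continuousAt
  filter_upwards [hc.preimage_mem_nhds
    (e.open_baseSet.mem_nhds (mem_baseSet_trivializationAt F V (p y₀)))] with y hy
  exact (e.linear ℝ hy).map_smul _ _

theorem contMDiff_zero_along (hp : ContMDiff IN IX ∞ p) :
    ContMDiff IN (IX.prod 𝓘(ℝ, F)) ∞ (fun y => (⟨p y, 0⟩ : TotalSpace F V)) := by
  intro y₀
  refine contMDiffAt_totalSpace.2 ⟨hp y₀,
    (contMDiffAt_const (c := (0 : F))).congr_of_eventuallyEq ?_⟩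
  set e := trivializationAt F V (p y₀)
  filter_upwards [(hp y₀).continuousAt.preimage_mem_nhds
    (e.open_baseSet.mem_nhds (mem_baseSet_trivializationAt F V (p y₀)))] with y hy
  exact (e.linear ℝ hy).map_zero

end Smoothness

/-- `Γ_U(V)`: the `C^∞(U)`-module of smooth sections over `U` of the vector bundle `V → X`. -/
def smoothSections (U : Opens X) : Submodule (SmoothFun IX U) (∀ x : U, V x) where
  carrier := {s | ContMDiff IX (IX.prod 𝓘(ℝ, F)) ∞ (fun x : U => (⟨x, s x⟩ : TotalSpace F V))}
  add_mem' hs ht := contMDiff_add_along hs ht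
  zero_mem' := contMDiff_zero_along contMDiff_subtype_val
  smul_mem' f _ hs := contMDiff_smul_along f.contMDiff hs

variable {V}

/-- Restriction of smooth sections to a smaller open set. -/
def smoothSections.res {U W : Opens X} (h : W ≤ U) :
    smoothSections IX F V U →ₛₗ[SmoothFun.res IX h] smoothSections IX F V W where
  toFun s := ⟨fun x => s.1 (Set.inclusion h x), s.2.comp (contMDiff_inclusion h)⟩
  map_add' _ _ := rfl
  map_smul' _ _ := rfl

end Sections

/-! ### Fibrewise operations on the total space of a vector bundle -/

section TotalSpaceOps

variable {X F : Type*} {V : X → Type*} [∀ x, AddCommGroup (V x)]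

open Classical in
/-- Fibrewise addition on the total space. It is only meaningful (and only used) for two points
in the same fibre. -/
def Bundle.TotalSpace.fadd (p q : TotalSpace F V) : TotalSpace F V :=
  if h : p.proj = q.proj then ⟨q.proj, (h ▸ p.2) + q.2⟩ else p

@[simp] theorem Bundle.TotalSpace.fadd_mk (x : X) (v w : V x) :
    (⟨x, v⟩ : TotalSpace F V).fadd ⟨x, w⟩ = ⟨x, v + w⟩ := by
  simp [Bundle.TotalSpace.fadd]

variable [∀ x, Module ℝ (V x)]

/-- Fibrewise scalar multiplication on the total space. -/
def Bundle.TotalSpace.fsmul (r : ℝ) (p : TotalSpace F V) : TotalSpace F V := ⟨p.proj, r • p.2⟩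

@[simp] theorem Bundle.TotalSpace.fsmul_mk (r : ℝ) (x : X) (v : V x) :
    (⟨x, v⟩ : TotalSpace F V).fsmul r = ⟨x, r • v⟩ := rfl

/-- The part of the total space of a vector bundle that lies over the open set `U`. -/
def opensOver [TopologicalSpace X] [TopologicalSpace F] (V : X → Type*)
    [TopologicalSpace (TotalSpace F V)]
    [∀ x, TopologicalSpace (V x)] [FiberBundle F V] (U : Opens X) : Opens (TotalSpace F V) :=
  ⟨TotalSpace.proj ⁻¹' U, U.isOpen.preimage (FiberBundle.continuous_proj F V)⟩

end TotalSpaceOps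

/-! ### Double vector bundles and metric double vector bundles -/

section DVB

variable (E : Type*) [NormedAddCommGroup E] [NormedSpace ℝ E]
  {M : Type*} [TopologicalSpace M] [ChartedSpace E M]
  (FQ : Type*) [NormedAddCommGroup FQ] [NormedSpace ℝ FQ]
  (Q : M → Type*) [∀ m, AddCommGroup (Q m)] [∀ m, Module ℝ (Q m)]
  [TopologicalSpace (TotalSpace FQ Q)] [∀ m, TopologicalSpace (Q m)]
  [FiberBundle FQ Q] [VectorBundle ℝ FQ Q]
  (FB : Type*) [NormedAddCommGroup FB] [NormedSpace ℝ FB]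
  (B : M → Type*) [∀ m, AddCommGroup (B m)] [∀ m, Module ℝ (B m)]
  [TopologicalSpace (TotalSpace FB B)] [∀ m, TopologicalSpace (B m)]
  [FiberBundle FB B] [VectorBundle ℝ FB B]
  (FDQ : Type*) [NormedAddCommGroup FDQ] [NormedSpace ℝ FDQ]
  (DQ : TotalSpace FQ Q → Type*) [∀ q, AddCommGroup (DQ q)] [∀ q, Module ℝ (DQ q)]
  [TopologicalSpace (TotalSpace FDQ DQ)] [∀ q, TopologicalSpace (DQ q)]
  [FiberBundle FDQ DQ] [VectorBundle ℝ FDQ DQ]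
  (FDB : Type*) [NormedAddCommGroup FDB] [NormedSpace ℝ FDB]
  (DB : TotalSpace FB B → Type*) [∀ b, AddCommGroup (DB b)] [∀ b, Module ℝ (DB b)]
  [TopologicalSpace (TotalSpace FDB DB)] [∀ b, TopologicalSpace (DB b)]
  [FiberBundle FDB DB] [VectorBundle ℝ FDB DB]

/-- Two vector bundle structures on one smooth manifold `D`: the vector bundle `DQ` over the total
space of `Q → M`, the vector bundle `DB` over the total space of `B → M`, and a diffeomorphism
between their total spaces, by which both are identified with `D`. We write points of `D` as
points of the total space of `DQ`. -/
structure DoubleBundleSquare where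
  /-- the identification of the two total spaces -/
  swap : Diffeomorph ((𝓘(ℝ, E).prod 𝓘(ℝ, FQ)).prod 𝓘(ℝ, FDQ))
    ((𝓘(ℝ, E).prod 𝓘(ℝ, FB)).prod 𝓘(ℝ, FDB)) (TotalSpace FDQ DQ) (TotalSpace FDB DB) ∞

namespace DoubleBundleSquare

variable {E FQ Q FB B FDQ DQ FDB DB} (S : DoubleBundleSquare E FQ Q FB B FDQ DQ FDB DB)

/-- The projection `D → Q`. -/
def projQ (_ : DoubleBundleSquare E FQ Q FB B FDQ DQ FDB DB) (d : TotalSpace FDQ DQ) :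
    TotalSpace FQ Q := d.proj

/-- The projection `D → B`. -/
def projB (d : TotalSpace FDQ DQ) : TotalSpace FB B := (S.swap d).proj

/-- The addition of the vector bundle `D → Q`. -/
def addQ (_ : DoubleBundleSquare E FQ Q FB B FDQ DQ FDB DB) (d d' : TotalSpace FDQ DQ) :
    TotalSpace FDQ DQ := d.fadd d'

/-- The scalar multiplication of the vector bundle `D → Q`. -/
def smulQ (_ : DoubleBundleSquare E FQ Q FB B FDQ DQ FDB DB) (r : ℝ) (d : TotalSpace FDQ DQ) :
    TotalSpace FDQ DQ := d.fsmul r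

/-- The zero section of the vector bundle `D → Q`. -/
def zeroQ (_ : DoubleBundleSquare E FQ Q FB B FDQ DQ FDB DB) (q : TotalSpace FQ Q) :
    TotalSpace FDQ DQ := ⟨q, 0⟩

/-- The addition of the vector bundle `D → B`. -/
def addB (d d' : TotalSpace FDQ DQ) : TotalSpace FDQ DQ := S.swap.symm ((S.swap d).fadd (S.swap d'))

/-- The scalar multiplication of the vector bundle `D → B`. -/
def smulB (r : ℝ) (d : TotalSpace FDQ DQ) : TotalSpace FDQ DQ := S.swap.symm ((S.swap d).fsmul r)

/-- The zero section of the vector bundle `D → B`. -/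
def zeroB (b : TotalSpace FB B) : TotalSpace FDQ DQ := S.swap.symm ⟨b, 0⟩

open Classical in
/-- The value of a family `g` of bilinear forms on the fibres of `D → B` on two points of `D`. It is
only meaningful (and only used) for two points over the same point of `B`. -/
def pairing (g : ∀ b : TotalSpace FB B, DB b →L[ℝ] DB b →L[ℝ] ℝ) (d d' : TotalSpace FDQ DQ) : ℝ :=
  if h : S.projB d = S.projB d' then g (S.projB d') (h ▸ (S.swap d).2) (S.swap d').2 else 0

/-- The conditions that make the square a double vector bundle `(D; Q, B; M)`: the square of
projections commutes, and the projection, the addition and the scalar multiplication of `D → B` are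
morphisms of vector bundles, from and to bundles given by `D → Q`, over the projection, the addition
and the scalar multiplication of `Q → M`. (They are smooth because `swap` is a diffeomorphism.) -/
structure IsDoubleVectorBundle : Prop where
  proj_comm : ∀ d, (S.projQ d).proj = (S.projB d).proj
  projB_addQ : ∀ d d', S.projQ d = S.projQ d' →
    S.projB (S.addQ d d') = (S.projB d).fadd (S.projB d')
  projB_smulQ : ∀ (r : ℝ) d, S.projB (S.smulQ r d) = (S.projB d).fsmul r
  projQ_addB : ∀ d d', S.projB d = S.projB d' →
    S.projQ (S.addB d d') = (S.projQ d).fadd (S.projQ d')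
  addB_addQ : ∀ d₁ d₂ d₃ d₄, S.projQ d₁ = S.projQ d₂ → S.projQ d₃ = S.projQ d₄ →
    S.projB d₁ = S.projB d₃ → S.projB d₂ = S.projB d₄ →
    S.addB (S.addQ d₁ d₂) (S.addQ d₃ d₄) = S.addQ (S.addB d₁ d₃) (S.addB d₂ d₄)
  addB_smulQ : ∀ (r : ℝ) d d', S.projB d = S.projB d' →
    S.addB (S.smulQ r d) (S.smulQ r d') = S.smulQ r (S.addB d d')
  projQ_smulB : ∀ (r : ℝ) d, S.projQ (S.smulB r d) = (S.projQ d).fsmul r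
  smulB_addQ : ∀ (r : ℝ) d d', S.projQ d = S.projQ d' →
    S.smulB r (S.addQ d d') = S.addQ (S.smulB r d) (S.smulB r d')
  smulB_smulQ : ∀ (r s : ℝ) d, S.smulB r (S.smulQ s d) = S.smulQ s (S.smulB r d)

end DoubleBundleSquare

/-- A metric double vector bundle `(D; Q, B; M)`: a double vector bundle with a smooth symmetric
non-degenerate pairing on the fibres of `D → B` that is linear over `Q`, i.e. the map from `D` to
the dual of `D → B` that it defines is linear for the vector bundle structures over `Q` and over the
dual of the core. -/
structure MetricDoubleVectorBundle extends DoubleBundleSquare E FQ Q FB B FDQ DQ FDB DB where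
  isDoubleVectorBundle : toDoubleBundleSquare.IsDoubleVectorBundle
  /-- the pairing on the fibres of `D → B` -/
  metric : ∀ b : TotalSpace FB B, DB b →L[ℝ] DB b →L[ℝ] ℝ
  metric_smooth : ContMDiff (𝓘(ℝ, E).prod 𝓘(ℝ, FB))
    ((𝓘(ℝ, E).prod 𝓘(ℝ, FB)).prod 𝓘(ℝ, FDB →L[ℝ] FDB →L[ℝ] ℝ)) ∞
    (fun b => TotalSpace.mk' (FDB →L[ℝ] FDB →L[ℝ] ℝ) b (metric b))
  metric_symm : ∀ b x y, metric b x y = metric b y x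
  metric_nondegenerate : ∀ b x, (∀ y, metric b x y = 0) → x = 0
  metric_addQ : ∀ d₁ d₂ e₁ e₂,
    toDoubleBundleSquare.projQ d₁ = toDoubleBundleSquare.projQ d₂ →
    toDoubleBundleSquare.projQ e₁ = toDoubleBundleSquare.projQ e₂ →
    toDoubleBundleSquare.projB d₁ = toDoubleBundleSquare.projB e₁ →
    toDoubleBundleSquare.projB d₂ = toDoubleBundleSquare.projB e₂ →
    toDoubleBundleSquare.pairing metric
        (toDoubleBundleSquare.addQ d₁ d₂) (toDoubleBundleSquare.addQ e₁ e₂) =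
      toDoubleBundleSquare.pairing metric d₁ e₁ + toDoubleBundleSquare.pairing metric d₂ e₂
  metric_smulQ : ∀ (r : ℝ) d e, toDoubleBundleSquare.projB d = toDoubleBundleSquare.projB e →
    toDoubleBundleSquare.pairing metric
        (toDoubleBundleSquare.smulQ r d) (toDoubleBundleSquare.smulQ r e) =
      r * toDoubleBundleSquare.pairing metric d e

variable {E FQ Q FB B FDQ DQ FDB DB}

theorem contMDiff_restrictProj (U : Opens M) :
    ContMDiff (𝓘(ℝ, E).prod 𝓘(ℝ, FQ)) 𝓘(ℝ, E) ∞
      (fun q : opensOver (F := FQ) Q U => (⟨q.1.proj, q.2⟩ : U)) := by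
  rw [← ContMDiff.subtypeVal_comp_iff]
  exact (contMDiff_proj Q).comp contMDiff_subtype_val

/-- Set-theoretic sections of `D → Q` over `Q|_U` form a `C^∞(U)`-module: a function on `U` acts by
pointwise multiplication with its pullback to `Q|_U`. -/
instance sectionsOverModule (U : Opens M) :
    Module (SmoothFun 𝓘(ℝ, E) U) (∀ q : opensOver (F := FQ) Q U, DQ q) :=
  Module.compHom (∀ q : opensOver (F := FQ) Q U, DQ q)
    ((RingHom.pi fun q : opensOver (F := FQ) Q U => Pi.evalRingHom (fun _ : U => ℝ) ⟨q.1.proj, q.2⟩).comp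
      (ContMDiffMap.coeFnRingHom : SmoothFun 𝓘(ℝ, E) U →+* (U → ℝ)))

@[simp] theorem sectionsOver_smul_apply (U : Opens M) (f : SmoothFun 𝓘(ℝ, E) U)
    (χ : ∀ q : opensOver (F := FQ) Q U, DQ q) (q : opensOver (F := FQ) Q U) :
    (f • χ) q = f ⟨q.1.proj, q.2⟩ • χ q := rfl

/-- The value in `D` of a section `χ` of `D → Q` over `Q|_U` at the point `q ∈ Q_m`. -/
def sectionValue {U : Opens M} (χ : ∀ q : opensOver (F := FQ) Q U, DQ q) (m : U) (q : Q m) :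
    TotalSpace FDQ DQ := ⟨⟨m, q⟩, χ ⟨⟨m, q⟩, m.2⟩⟩

/-- `χ : Q|_U → D` is a (fibrewise linear) bundle morphism from `Q|_U → U` to `D → B` over the
section `b` of `B` over `U`. -/
structure DoubleBundleSquare.IsLinearOver (S : DoubleBundleSquare E FQ Q FB B FDQ DQ FDB DB)
    {U : Opens M} (χ : ∀ q : opensOver (F := FQ) Q U, DQ q) (b : ∀ m : U, B m) : Prop where
  projB : ∀ (m : U) (q : Q m), S.projB (sectionValue (FDQ := FDQ) χ m q) = ⟨m, b m⟩
  map_add : ∀ (m : U) (q q' : Q m), sectionValue (FDQ := FDQ) χ m (q + q') =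
    S.addB (sectionValue χ m q) (sectionValue χ m q')
  map_smul : ∀ (m : U) (r : ℝ) (q : Q m), sectionValue (FDQ := FDQ) χ m (r • q) =
    S.smulB r (sectionValue χ m q)

namespace MetricDoubleVectorBundle

variable (𝔼 : MetricDoubleVectorBundle E FQ Q FB B FDQ DQ FDB DB)

theorem sectionValue_add {U : Opens M} (χ χ' : ∀ q : opensOver (F := FQ) Q U, DQ q)
    (m : U) (q : Q m) : sectionValue (FDQ := FDQ) (χ + χ') m q =
      𝔼.addQ (sectionValue χ m q) (sectionValue χ' m q) := by
  simp [sectionValue, DoubleBundleSquare.addQ]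

theorem sectionValue_smul {U : Opens M} (f : SmoothFun 𝓘(ℝ, E) U)
    (χ : ∀ q : opensOver (F := FQ) Q U, DQ q) (m : U) (q : Q m) :
    sectionValue (FDQ := FDQ) (f • χ) m q = 𝔼.smulQ (f m) (sectionValue χ m q) := by
  simp [sectionValue, DoubleBundleSquare.smulQ]

theorem isLinearOver_add {U : Opens M} {χ χ' : ∀ q : opensOver (F := FQ) Q U, DQ q}
    {b b' : ∀ m : U, B m} (hl : 𝔼.IsLinearOver χ b) (hl' : 𝔼.IsLinearOver χ' b') :
    𝔼.IsLinearOver (χ + χ') (b + b') := by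
  have H := 𝔼.isDoubleVectorBundle
  have key := 𝔼.sectionValue_add χ χ'
  refine ⟨?_, ?_, ?_⟩
  · intro m q
    rw [key, H.projB_addQ (sectionValue χ m q) (sectionValue χ' m q) rfl, hl.projB, hl'.projB]
    simp
  · intro m q q'
    rw [key, key, key, H.addB_addQ (sectionValue χ m q) (sectionValue χ' m q)
      (sectionValue χ m q') (sectionValue χ' m q') rfl rfl, hl.map_add, hl'.map_add]
    · rw [hl.projB, hl.projB]
    · rw [hl'.projB, hl'.projB]
  · intro m r q
    rw [key, key, H.smulB_addQ r (sectionValue χ m q) (sectionValue χ' m q) rfl, hl.map_smul, hl'.map_smul]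

theorem isLinearOver_smul {U : Opens M} (f : SmoothFun 𝓘(ℝ, E) U)
    {χ : ∀ q : opensOver (F := FQ) Q U, DQ q}
    {b : ∀ m : U, B m} (hl : 𝔼.IsLinearOver χ b) : 𝔼.IsLinearOver (f • χ) (f • b) := by
  have H := 𝔼.isDoubleVectorBundle
  have key := 𝔼.sectionValue_smul f χ
  refine ⟨?_, ?_, ?_⟩
  · intro m q
    rw [key, H.projB_smulQ, hl.projB]
    simp
  · intro m q q'
    rw [key, key, key, H.addB_smulQ, hl.map_add]
    rw [hl.projB, hl.projB]
  · intro m r q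
    rw [key, key, H.smulB_smulQ, hl.map_smul]

theorem base_unique {U : Opens M} {χ : ∀ q : opensOver (F := FQ) Q U, DQ q}
    {b b' : ∀ m : U, B m} (hl : 𝔼.IsLinearOver χ b) (hl' : 𝔼.IsLinearOver χ b') : b = b' := by
  funext m
  have h := (hl.projB m 0).symm.trans (hl'.projB m 0)
  simpa using h

/-- `Γ^ℓ_Q(𝔼)` over `U`: the smooth sections of `D → Q` over `Q|_U` that are linear over some smooth
section of `B` over `U`. -/
def linearSections (U : Opens M) :
    Submodule (SmoothFun 𝓘(ℝ, E) U) (∀ q : opensOver (F := FQ) Q U, DQ q) where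
  carrier := {χ | χ ∈ smoothSections (𝓘(ℝ, E).prod 𝓘(ℝ, FQ)) FDQ DQ (opensOver Q U) ∧
    ∃ b ∈ smoothSections 𝓘(ℝ, E) FB B U, 𝔼.toDoubleBundleSquare.IsLinearOver χ b}
  add_mem' := by
    rintro χ χ' ⟨hχ, b, hb, hl⟩ ⟨hχ', b', hb', hl'⟩
    exact ⟨add_mem hχ hχ', b + b', add_mem hb hb', 𝔼.isLinearOver_add hl hl'⟩
  zero_mem' := by
    have H := 𝔼.isDoubleVectorBundle
    have z : ∀ d : TotalSpace FDQ DQ, 𝔼.smulQ 0 d = ⟨d.proj, 0⟩ := by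
      intro d; simp [DoubleBundleSquare.smulQ, Bundle.TotalSpace.fsmul]
    have key : ∀ (m : U) (q : Q m),
        sectionValue (FDQ := FDQ) (0 : ∀ q : opensOver (F := FQ) Q U, DQ q) m q =
        𝔼.smulQ 0 ⟨⟨m, q⟩, 0⟩ := by
      intro m q
      rw [z]; rfl
    have kB : ∀ (m : U) (q : Q m), 𝔼.projB (𝔼.smulQ 0 ⟨⟨m, q⟩, 0⟩) = ⟨m, 0⟩ := by
      intro m q
      have h1 := H.proj_comm ⟨⟨m, q⟩, 0⟩
      change (m : M) = _ at h1
      rw [H.projB_smulQ]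
      revert h1
      generalize 𝔼.projB ⟨⟨m, q⟩, 0⟩ = b
      obtain ⟨n, b⟩ := b
      rintro rfl
      simp
    refine ⟨zero_mem _, 0, zero_mem _, ⟨?_, ?_, ?_⟩⟩
    · intro m q
      rw [key, kB]; rfl
    · intro m q q'
      have hp : 𝔼.projB (⟨⟨m, q⟩, 0⟩ : TotalSpace FDQ DQ) = 𝔼.projB ⟨⟨m, q'⟩, 0⟩ := by
        have h1 := kB m q
        have h2 := kB m q'
        rw [z] at h1 h2
        exact h1.trans h2.symm
      rw [key, key, key, H.addB_smulQ _ _ _ hp, z, z]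
      change _ = (⟨𝔼.projQ _, 0⟩ : TotalSpace FDQ DQ)
      rw [H.projQ_addB _ _ hp]
      change _ = (⟨(⟨m, q⟩ : TotalSpace FQ Q).fadd ⟨m, q'⟩, 0⟩ : TotalSpace FDQ DQ)
      rw [Bundle.TotalSpace.fadd_mk]
    · intro m r q
      rw [key, key, H.smulB_smulQ, z, z]
      change _ = (⟨𝔼.projQ _, 0⟩ : TotalSpace FDQ DQ)
      rw [H.projQ_smulB]
      rfl
  smul_mem' := by
    rintro f χ ⟨hχ, b, hb, hl⟩
    exact ⟨contMDiff_smul_along (f := fun q : opensOver (F := FQ) Q U => f ⟨q.1.proj, q.2⟩)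
      (f.contMDiff.comp (contMDiff_restrictProj U)) hχ,
      f • b, Submodule.smul_mem _ f hb, 𝔼.isLinearOver_smul f hl⟩

/-- `𝒞(𝔼)` over `U`: the linear sections `χ` of `D → Q` over `Q|_U` with isotropic image, i.e.
`⟨χ(q), χ(q')⟩ = 0` for all `q, q'` in the same fibre of `Q`. -/
def isotropicSections (U : Opens M) :
    Submodule (SmoothFun 𝓘(ℝ, E) U) (∀ q : opensOver (F := FQ) Q U, DQ q) where
  carrier := {χ | χ ∈ 𝔼.linearSections U ∧ ∀ (m : U) (q q' : Q m),
    𝔼.pairing 𝔼.metric (sectionValue χ m q) (sectionValue χ m q') = 0}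
  add_mem' := by
    rintro χ χ' ⟨hχ, h⟩ ⟨hχ', h'⟩
    refine ⟨add_mem hχ hχ', fun m q q' => ?_⟩
    obtain ⟨-, b, -, hl⟩ := hχ
    obtain ⟨-, b', -, hl'⟩ := hχ'
    have key : ∀ (q : Q m), sectionValue (FDQ := FDQ) (χ + χ') m q =
        𝔼.addQ (sectionValue χ m q) (sectionValue χ' m q) := by
      intro q
      simp [sectionValue, DoubleBundleSquare.addQ]
    rw [key, key, 𝔼.metric_addQ (sectionValue χ m q) (sectionValue χ' m q)
      (sectionValue χ m q') (sectionValue χ' m q') rfl rfl, h, h', add_zero]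
    · rw [hl.projB, hl.projB]
    · rw [hl'.projB, hl'.projB]
  zero_mem' := by
    refine ⟨zero_mem _, fun m q q' => ?_⟩
    obtain ⟨-, b, -, hl⟩ := (𝔼.linearSections U).zero_mem
    have key : ∀ (q : Q m),
        sectionValue (FDQ := FDQ) (0 : ∀ q : opensOver (F := FQ) Q U, DQ q) m q =
        𝔼.smulQ 0 (sectionValue (FDQ := FDQ) (0 : ∀ q : opensOver (F := FQ) Q U, DQ q) m q) := by
      intro q
      simp [DoubleBundleSquare.smulQ, sectionValue]
    rw [key q, key q', 𝔼.metric_smulQ, zero_mul]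
    rw [hl.projB, hl.projB]
  smul_mem' := by
    rintro f χ ⟨hχ, h⟩
    refine ⟨Submodule.smul_mem _ f hχ, fun m q q' => ?_⟩
    obtain ⟨-, b, -, hl⟩ := hχ
    have key : ∀ (q : Q m), sectionValue (FDQ := FDQ) (f • χ) m q =
        𝔼.smulQ (f m) (sectionValue χ m q) := by
      intro q
      simp [sectionValue, DoubleBundleSquare.smulQ]
    rw [key, key, 𝔼.metric_smulQ, h, mul_zero]
    rw [hl.projB, hl.projB]

theorem isotropicSections_le (U : Opens M) : 𝔼.isotropicSections U ≤ 𝔼.linearSections U :=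
  fun _ h => h.1

/-- The map `Γ^ℓ_Q(𝔼) → Γ(B)` over `U` that sends a linear section to its base section. -/
def baseSection (U : Opens M) :
    𝔼.linearSections U →ₗ[SmoothFun 𝓘(ℝ, E) U] smoothSections 𝓘(ℝ, E) FB B U where
  toFun χ := ⟨χ.2.2.choose, χ.2.2.choose_spec.1⟩
  map_add' χ χ' := by
    have key := 𝔼.base_unique (χ + χ').2.2.choose_spec.2
      (𝔼.isLinearOver_add χ.2.2.choose_spec.2 χ'.2.2.choose_spec.2)
    exact Subtype.ext key
  map_smul' f χ := by
    have key := 𝔼.base_unique (f • χ).2.2.choose_spec.2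
      (𝔼.isLinearOver_smul f χ.2.2.choose_spec.2)
    exact Subtype.ext key

/-- The map `𝒞(𝔼) → Γ(B)` over `U`, the restriction of `baseSection` to isotropic sections. -/
def isotropicBase (U : Opens M) :
    𝔼.isotropicSections U →ₗ[SmoothFun 𝓘(ℝ, E) U] smoothSections 𝓘(ℝ, E) FB B U :=
  𝔼.baseSection U ∘ₗ Submodule.inclusion (𝔼.isotropicSections_le U)

theorem projB_sectionValue {U : Opens M} (χ : 𝔼.isotropicSections U) (m : U) (q : Q m) :
    𝔼.projB (sectionValue χ.1 m q) = ⟨m, (𝔼.isotropicBase U χ).1 m⟩ :=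
  (𝔼.isotropicSections_le U χ.2).2.choose_spec.2.projB m q

/-- Restriction of isotropic linear sections to a smaller open set. -/
def isotropicRes {U W : Opens M} (h : W ≤ U) :
    𝔼.isotropicSections U →ₛₗ[SmoothFun.res 𝓘(ℝ, E) h] 𝔼.isotropicSections W where
  toFun χ := ⟨fun q => χ.1 ⟨q.1, h q.2⟩,
    by
      obtain ⟨χ, ⟨hs, b, hb, hl⟩, hi⟩ := χ
      have hle : opensOver (F := FQ) Q W ≤ opensOver Q U := fun _ hq => h hq
      exact ⟨⟨(smoothSections.res (𝓘(ℝ, E).prod 𝓘(ℝ, FQ)) FDQ hle ⟨χ, hs⟩).2,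
        _, (smoothSections.res 𝓘(ℝ, E) FB h ⟨b, hb⟩).2,
        ⟨fun m => hl.projB (Set.inclusion h m), fun m => hl.map_add (Set.inclusion h m),
          fun m => hl.map_smul (Set.inclusion h m)⟩⟩,
        fun m => hi (Set.inclusion h m)⟩⟩
  map_add' _ _ := rfl
  map_smul' _ _ := rfl

/-- `c` is the element `τ̄` of the core over `m` that corresponds to the covector `τ` on `Q_m` under
the identification of the core with `Q^*` given by the metric: `⟨e, τ^†(π_B e)⟩ = τ(π_Q e)`, where
`τ^†(b) = 0_b +_Q τ̄` is the core section over `B`. -/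
structure IsCoreElement (m : M) (τ : Q m → ℝ) (c : TotalSpace FDQ DQ) : Prop where
  projQ : 𝔼.projQ c = ⟨m, 0⟩
  projB : 𝔼.projB c = ⟨m, 0⟩
  pairing : ∀ (q : Q m) (e : TotalSpace FDQ DQ), 𝔼.projQ e = ⟨m, q⟩ →
    𝔼.pairing 𝔼.metric e (𝔼.addQ (𝔼.zeroB (𝔼.projB e)) c) = τ q

end MetricDoubleVectorBundle

/-- `Ω²(Q)` over `U`: smooth sections over `U` of `Q^* ∧ Q^*`, the bundle of alternating bilinear
forms on the fibres of `Q`. -/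
abbrev twoForms (E : Type*) [NormedAddCommGroup E] [NormedSpace ℝ E]
    {M : Type*} [TopologicalSpace M] [ChartedSpace E M]
    (FQ : Type*) [NormedAddCommGroup FQ] [NormedSpace ℝ FQ]
    (Q : M → Type*) [∀ m, AddCommGroup (Q m)] [∀ m, Module ℝ (Q m)]
    [TopologicalSpace (TotalSpace FQ Q)] [∀ m, TopologicalSpace (Q m)]
    [FiberBundle FQ Q] [VectorBundle ℝ FQ Q] (U : Opens M) :=
  smoothSections 𝓘(ℝ, E) (FQ [⋀^Fin 2]→L[ℝ] ℝ) (fun m => Q m [⋀^Fin 2]→L[ℝ] Bundle.Trivial M ℝ m) U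

/-- Restriction of two-forms to a smaller open set. -/
abbrev twoForms.res {U W : Opens M} (h : W ≤ U) :
    twoForms E FQ Q U →ₛₗ[SmoothFun.res 𝓘(ℝ, E) h] twoForms E FQ Q W :=
  smoothSections.res 𝓘(ℝ, E) (FQ [⋀^Fin 2]→L[ℝ] ℝ)
    (V := fun m => Q m [⋀^Fin 2]→L[ℝ] Bundle.Trivial M ℝ m) h

/-- `χ` is the core-linear section `α̃` of `D → Q` given by `α ∈ Ω²(Q)`:
`α̃(q) = 0_q +_B τ̄` with `τ = α(q, ·)`. -/
def MetricDoubleVectorBundle.IsCoreLinear (𝔼 : MetricDoubleVectorBundle E FQ Q FB B FDQ DQ FDB DB)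
    {U : Opens M} (α : twoForms E FQ Q U) (χ : ∀ q : opensOver (F := FQ) Q U, DQ q) : Prop :=
  ∀ (m : U) (q : Q m), ∃ c, 𝔼.IsCoreElement m (fun q' => α.1 m ![q, q']) c ∧
    sectionValue χ m q = 𝔼.addB (𝔼.zeroQ ⟨m, q⟩) c

/-- A linear splitting of `(D; Q, B; M)`: a morphism of double vector bundles `Q ×_M B → D` over the
identities of `Q` and `B` (hence injective). The fibre of `Q ×_M B` over `q ∈ Q_m` is `B_m`, its
fibre over `b ∈ B_m` is `Q_m`. -/
structure LinearSplitting (S : DoubleBundleSquare E FQ Q FB B FDQ DQ FDB DB) where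
  toFun : ∀ m : M, Q m → B m → TotalSpace FDQ DQ
  smooth : ContMDiff (𝓘(ℝ, E).prod 𝓘(ℝ, FQ × FB)) ((𝓘(ℝ, E).prod 𝓘(ℝ, FQ)).prod 𝓘(ℝ, FDQ)) ∞
    (fun x : TotalSpace (FQ × FB) (Q ×ᵇ B) => toFun x.proj x.2.1 x.2.2)
  projQ : ∀ m q b, S.projQ (toFun m q b) = ⟨m, q⟩
  projB : ∀ m q b, S.projB (toFun m q b) = ⟨m, b⟩
  add_right : ∀ m q b b', toFun m q (b + b') = S.addQ (toFun m q b) (toFun m q b')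
  smul_right : ∀ m (r : ℝ) q b, toFun m q (r • b) = S.smulQ r (toFun m q b)
  add_left : ∀ m q q' b, toFun m (q + q') b = S.addB (toFun m q b) (toFun m q' b)
  smul_left : ∀ m (r : ℝ) q b, toFun m (r • q) b = S.smulB r (toFun m q b)

namespace MetricDoubleVectorBundle

variable (𝔼 : MetricDoubleVectorBundle E FQ Q FB B FDQ DQ FDB DB)

/-- Linear splittings with isotropic image in `D → B`. (The image is then maximal isotropic, as its
rank is half the rank of `D → B`.) -/
def LagrangianSplitting : Type _ :=
  {σ : LinearSplitting 𝔼.toDoubleBundleSquare //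
    ∀ m q q' b, 𝔼.pairing 𝔼.metric (σ.toFun m q b) (σ.toFun m q' b) = 0}

/-- Splittings of the sequence `0 → Ω²(Q) → 𝒞(𝔼) → Γ(B) → 0` of sheaves of `C^∞`-modules, given as
right inverses of the last map. -/
structure SheafSplitting where
  toFun : ∀ U : Opens M,
    smoothSections 𝓘(ℝ, E) FB B U →ₗ[SmoothFun 𝓘(ℝ, E) U] 𝔼.isotropicSections U
  res_toFun : ∀ (U W : Opens M) (h : W ≤ U) (b : smoothSections 𝓘(ℝ, E) FB B U),
    𝔼.isotropicRes h (toFun U b) = toFun W (smoothSections.res 𝓘(ℝ, E) FB h b)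
  base_toFun : ∀ (U : Opens M) (b : smoothSections 𝓘(ℝ, E) FB B U),
    𝔼.isotropicBase U (toFun U b) = b

end MetricDoubleVectorBundle

end DVB

end

/-!
Over a point `m` of the base, the fibre of `D → B` over the zero vector contains the fibre of `Q` as
an isotropic subspace (the zero section of `D → Q`), while over any `b` the core directions, i.e. the
kernel of `D_b → Q_m`, are isotropic. Comparing dimensions in the nondegenerate fibres gives
`rk D = 2 rk Q`: the map `D_b → Q_m` is onto, its kernel is its own orthogonal complement, and the
kernel is identified with the dual of `Q_m` by the metric.

A local linear lift `f : Q_m → D_b` exists because `D_b → Q_m` is onto; subtracting from `f q` the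
core vector of `½ ⟨f q, f ·⟩` makes it isotropic. Two isotropic lifts over the same `b` differ by a
core-valued map `q ↦ ω(q, ·)` with `ω` alternating, so isotropic lifts form an affine space over the
2-forms, and a partition of unity glues local Lagrangian splittings to a global one. Such a splitting
sends a section `b` of `B` to an isotropic section over `b`, which splits the sequence over every open
set and identifies `𝒞(𝔼)` with the sections of `(Q^* ∧ Q^*) ⊕ B`. Conversely, a splitting of
the sequence of sheaves is linear over the smooth functions, hence pointwise in `b`, and is
evaluated by extending vectors of `B` with local frames.
-/

noncomputable section

/-! ### Linear algebra -/

section LinearAlgebra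

theorem two_mul_finrank_le_of_isotropic {K V : Type*} [Field K] [AddCommGroup V] [Module K V]
    [FiniteDimensional K V] {b : LinearMap.BilinForm K V} (hb : b.Nondegenerate)
    (W : Submodule K V) (hW : ∀ x ∈ W, ∀ y ∈ W, b x y = 0) :
    2 * Module.finrank K W ≤ Module.finrank K V := by
  have horth := LinearMap.BilinForm.finrank_orthogonal hb W
  have hle : W ≤ b.orthogonal W := fun x hx y hy => hW y hy x hx
  have := Submodule.finrank_mono hle
  have := Submodule.finrank_le W
  omega

/-- The isomorphism `N × P ≃ L` attached to a section `s` of a short exact sequence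
`0 → N → L → P → 0`. -/
def equivOfExactOfSection {R N L P : Type*} [Ring R] [AddCommGroup N] [AddCommGroup L]
    [AddCommGroup P] [Module R N] [Module R L] [Module R P] {f : N →ₗ[R] L} {g : L →ₗ[R] P}
    (hfg : Function.Exact f g) (hf : Function.Injective f) (s : P →ₗ[R] L)
    (hs : ∀ y, g (s y) = y) : (N × P) ≃ₗ[R] L :=
  (hfg.splitSurjectiveEquiv hf ⟨s, LinearMap.ext hs⟩).1.symm

theorem equivOfExactOfSection_apply {R N L P : Type*} [Ring R] [AddCommGroup N] [AddCommGroup L]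
    [AddCommGroup P] [Module R N] [Module R L] [Module R P] {f : N →ₗ[R] L} {g : L →ₗ[R] P}
    (hfg : Function.Exact f g) (hf : Function.Injective f) (s : P →ₗ[R] L)
    (hs : ∀ y, g (s y) = y) (x : N × P) :
    equivOfExactOfSection hfg hf s hs x = f x.1 + s x.2 := rfl

end LinearAlgebra

section AlternatingForms

section Bilinear

variable {R W A : Type*} [CommSemiring R] [AddCommMonoid W] [Module R W] [TopologicalSpace W]
  [AddCommMonoid A] [Module R A] [TopologicalSpace A]

/-- The bilinear map `(v, w) ↦ η(v, w)` of an alternating map `η` of two variables. -/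
def twoFormBilin (η : W [⋀^Fin 2]→L[R] A) : W →ₗ[R] W →ₗ[R] A :=
  (AlternatingMap.curryLeftLinearMap ∘ₗ η.toAlternatingMap.curryLeft).compr₂
    AlternatingMap.constLinearEquivOfIsEmpty.symm.toLinearMap

@[simp] theorem twoFormBilin_apply (η : W [⋀^Fin 2]→L[R] A) (v w : W) :
    twoFormBilin η v w = η ![v, w] := by
  simp [twoFormBilin]

theorem twoFormBilin_isAlt (η : W [⋀^Fin 2]→L[R] A) : (twoFormBilin η).IsAlt := fun v => by
  simpa using η.map_eq_zero_of_eq ![v, v] (i := 0) (j := 1) rfl zero_ne_one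

theorem twoFormBilin_injective :
    Function.Injective (twoFormBilin : (W [⋀^Fin 2]→L[R] A) → W →ₗ[R] W →ₗ[R] A) := by
  intro η η' h
  ext v
  have hv : v = ![v 0, v 1] := by
    ext i
    fin_cases i <;> rfl
  rw [hv]
  simpa using LinearMap.congr_fun₂ h (v 0) (v 1)

end Bilinear

variable {W F : Type*} [AddCommGroup W] [Module ℝ W] [TopologicalSpace W]
  [NormedAddCommGroup F] [NormedSpace ℝ F] [FiniteDimensional ℝ F]

theorem exists_twoFormBilin_eq (L : W ≃L[ℝ] F) {a : W →ₗ[ℝ] W →ₗ[ℝ] ℝ} (ha : a.IsAlt) :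
    ∃ η : W [⋀^Fin 2]→L[ℝ] ℝ, twoFormBilin η = a := by
  let a' : F →L[ℝ] F →L[ℝ] ℝ :=
    (a.compl₁₂ L.symm.toLinearMap L.symm.toLinearMap).toContinuousBilinearMap
  have ha' (v w : W) : a' (L v) (L w) = a v w := by simp [a']
  refine ⟨{ toFun := fun v => a (v 0) (v 1), map_update_add' := ?_, map_update_smul' := ?_,
            cont := ?_, map_eq_zero_of_eq' := ?_ }, ?_⟩
  · intro _ v i y z
    fin_cases i <;> simp
  · intro _ v i r y
    fin_cases i <;> simp
  · simp only [← ha']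
    fun_prop
  · intro v i j h hij
    have h01 : v 0 = v 1 := by
      fin_cases i <;> fin_cases j <;> simp_all
    rw [h01, ha.self_eq_zero]
  · ext v w
    exact twoFormBilin_apply _ v w

end AlternatingForms

/-! ### Smooth maps into vector bundles -/

section SmoothFamilies

variable {EN : Type*} [NormedAddCommGroup EN] [NormedSpace ℝ EN]
  {HN : Type*} [TopologicalSpace HN] {IN : ModelWithCorners ℝ EN HN}
  {N : Type*} [TopologicalSpace N] [ChartedSpace HN N] {x₀ : N}
  {F : Type*} [NormedAddCommGroup F] [NormedSpace ℝ F]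
  {G : Type*} [NormedAddCommGroup G] [NormedSpace ℝ G]

theorem contMDiffAt_clm_of_apply [FiniteDimensional ℝ F] {f : N → F →L[ℝ] G}
    (h : ∀ v, ContMDiffAt IN 𝓘(ℝ, G) ∞ (fun x => f x v) x₀) :
    ContMDiffAt IN 𝓘(ℝ, F →L[ℝ] G) ∞ f x₀ := by
  let b := Module.finBasis ℝ F
  let L i : G →L[ℝ] F →L[ℝ] G :=
    ContinuousLinearMap.smulRightL ℝ F G (b.coord i).toContinuousLinearMap
  have hf : f = fun x => ∑ i, L i (f x (b i)) := by
    ext x v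
    conv_lhs => rw [← b.sum_repr v, map_sum]
    simp [L]
  rw [hf]
  exact ContMDiffAt.sum fun i _ => (L i).contMDiff.contMDiffAt.comp x₀ (h (b i))

theorem contMDiffAt_clm_inverse [CompleteSpace F] {f : N → F →L[ℝ] G}
    (hf : ContMDiffAt IN 𝓘(ℝ, F →L[ℝ] G) ∞ f x₀) (e : F ≃L[ℝ] G) (he : f x₀ = e) :
    ContMDiffAt IN 𝓘(ℝ, G →L[ℝ] F) ∞ (fun x => (f x).inverse) x₀ := by
  have h : ContDiffAt ℝ ∞ ContinuousLinearMap.inverse (f x₀) := he ▸ contDiffAt_map_inverse e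
  exact h.contMDiffAt.comp x₀ hf

theorem contMDiffAt_of_clm_apply [CompleteSpace F] {f : N → F →L[ℝ] G} {v : N → F}
    (hf : ContMDiffAt IN 𝓘(ℝ, F →L[ℝ] G) ∞ f x₀) (e : F ≃L[ℝ] G) (he : f x₀ = e)
    (hv : ContMDiffAt IN 𝓘(ℝ, G) ∞ (fun x => f x (v x)) x₀) :
    ContMDiffAt IN 𝓘(ℝ, F) ∞ v x₀ := by
  refine ((contMDiffAt_clm_inverse hf e he).clm_apply hv).congr_of_eventuallyEq ?_
  filter_upwards [hf.continuousAt.eventually_mem (he ▸ e.nhds)] with x ⟨L, hL⟩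
  simp [← hL]

theorem exists_contMDiffAt_rightInverse [FiniteDimensional ℝ F] [FiniteDimensional ℝ G]
    {P : N → F →L[ℝ] G} (hP : ∀ᶠ x in nhds x₀, ContMDiffAt IN 𝓘(ℝ, F →L[ℝ] G) ∞ P x)
    (hs : Function.Surjective (P x₀)) :
    ∃ R : N → G →L[ℝ] F, ∀ᶠ x in nhds x₀,
      ContMDiffAt IN 𝓘(ℝ, G →L[ℝ] F) ∞ R x ∧ ∀ v, P x (R x v) = v := by
  obtain ⟨r, hr⟩ := (P x₀).toLinearMap.exists_rightInverse_of_surjective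
    (LinearMap.range_eq_top.2 hs)
  let R₀ : G →L[ℝ] F := LinearMap.toContinuousLinearMap r
  let A x : G →L[ℝ] G := P x ∘L R₀
  have hA {x} (h : ContMDiffAt IN 𝓘(ℝ, F →L[ℝ] G) ∞ P x) :
      ContMDiffAt IN 𝓘(ℝ, G →L[ℝ] G) ∞ A x := h.clm_comp contMDiffAt_const
  have hA₀ : A x₀ = ContinuousLinearEquiv.refl ℝ G := by
    ext v
    exact LinearMap.congr_fun hr v
  have hinv : ∀ᶠ x in nhds x₀, ∃ e : G ≃L[ℝ] G, e = A x :=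
    (hA hP.self_of_nhds).continuousAt.eventually_mem
      (hA₀ ▸ (ContinuousLinearEquiv.refl ℝ G).nhds)
  refine ⟨fun x => R₀ ∘L (A x).inverse, ?_⟩
  filter_upwards [hP, hinv] with x hx ⟨e, he⟩
  refine ⟨contMDiffAt_const.clm_comp (contMDiffAt_clm_inverse (hA hx) e he.symm), fun v => ?_⟩
  change A x ((A x).inverse v) = v
  simp [← he]

section Alternating

variable {ι : Type*}

/-- The values of an alternating map on the families of vectors of a basis, as a linear function of
the alternating map. -/
def alternatingCoeffs {κ : Type*} (b : Module.Basis κ ℝ F) :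
    (F [⋀^ι]→L[ℝ] G) →ₗ[ℝ] ((ι → κ) → G) where
  toFun η k := η (b ∘ k)
  map_add' _ _ := rfl
  map_smul' _ _ := rfl

theorem alternatingCoeffs_injective [Finite ι] {κ : Type*} (b : Module.Basis κ ℝ F) :
    Function.Injective (alternatingCoeffs (ι := ι) (G := G) b) := fun _ _ h =>
  ContinuousAlternatingMap.toAlternatingMap_injective
    (b.ext_alternating fun k _ => congrFun h k)

theorem contMDiffAt_alternating_apply [Fintype ι] {η : N → F [⋀^ι]→L[ℝ] G} {v : N → ι → F}
    (hη : ContMDiffAt IN 𝓘(ℝ, F [⋀^ι]→L[ℝ] G) ∞ η x₀)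
    (hv : ContMDiffAt IN 𝓘(ℝ, ι → F) ∞ v x₀) :
    ContMDiffAt IN 𝓘(ℝ, G) ∞ (fun x => η x (v x)) x₀ := by
  have h := (ContinuousAlternatingMap.toContinuousMultilinearMapCLM (E := F) (F := G) (ι := ι)
    ℝ).cpolynomialAt_uncurry_of_multilinear (x := (η x₀, v x₀))
  exact h.contDiffAt.contMDiffAt.comp x₀ (hη.prodMk_space hv)

variable [FiniteDimensional ℝ F]

instance [Finite ι] [FiniteDimensional ℝ G] : FiniteDimensional ℝ (F [⋀^ι]→L[ℝ] G) :=
  FiniteDimensional.of_injective _ (alternatingCoeffs_injective (Module.finBasis ℝ F))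

theorem contMDiffAt_alternating_of_apply [Fintype ι] [FiniteDimensional ℝ G]
    {η : N → F [⋀^ι]→L[ℝ] G} (h : ∀ v, ContMDiffAt IN 𝓘(ℝ, G) ∞ (fun x => η x v) x₀) :
    ContMDiffAt IN 𝓘(ℝ, F [⋀^ι]→L[ℝ] G) ∞ η x₀ := by
  classical
  let b := Module.finBasis ℝ F
  obtain ⟨L, hL⟩ := (alternatingCoeffs (ι := ι) (G := G) b).exists_leftInverse_of_injective
    (LinearMap.ker_eq_bot.2 (alternatingCoeffs_injective b))
  have hη : η = fun x => L.toContinuousLinearMap (alternatingCoeffs b (η x)) :=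
    funext fun x => (LinearMap.congr_fun hL (η x)).symm
  rw [hη]
  exact L.toContinuousLinearMap.contMDiff.contMDiffAt.comp x₀
    (contMDiffAt_pi_space.2 fun k => h (b ∘ k))

end Alternating

end SmoothFamilies

section ProductBundle

variable {EX : Type*} [NormedAddCommGroup EX] [NormedSpace ℝ EX]
  {HX : Type*} [TopologicalSpace HX] {IX : ModelWithCorners ℝ EX HX}
  {X : Type*} [TopologicalSpace X] [ChartedSpace HX X]
  {F₁ : Type*} [NormedAddCommGroup F₁] [NormedSpace ℝ F₁] {V₁ : X → Type*} [∀ x, Zero (V₁ x)]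
  [TopologicalSpace (TotalSpace F₁ V₁)] [∀ x, TopologicalSpace (V₁ x)] [FiberBundle F₁ V₁]
  {F₂ : Type*} [NormedAddCommGroup F₂] [NormedSpace ℝ F₂] {V₂ : X → Type*} [∀ x, Zero (V₂ x)]
  [TopologicalSpace (TotalSpace F₂ V₂)] [∀ x, TopologicalSpace (V₂ x)] [FiberBundle F₂ V₂]
  {EN : Type*} [NormedAddCommGroup EN] [NormedSpace ℝ EN]
  {HN : Type*} [TopologicalSpace HN] {IN : ModelWithCorners ℝ EN HN}
  {N : Type*} [TopologicalSpace N] [ChartedSpace HN N] {x₀ : N}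

theorem contMDiffAt_fst_along {g : N → TotalSpace (F₁ × F₂) (V₁ ×ᵇ V₂)}
    (hg : ContMDiffAt IN (IX.prod 𝓘(ℝ, F₁ × F₂)) ∞ g x₀) :
    ContMDiffAt IN (IX.prod 𝓘(ℝ, F₁)) ∞
      (fun y => (⟨(g y).proj, (g y).2.1⟩ : TotalSpace F₁ V₁)) x₀ :=
  contMDiffAt_totalSpace.2 ⟨(contMDiffAt_totalSpace.1 hg).1,
    (ContinuousLinearMap.fst ℝ F₁ F₂).contMDiff.contMDiffAt.comp x₀ (contMDiffAt_totalSpace.1 hg).2⟩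

theorem contMDiffAt_snd_along {g : N → TotalSpace (F₁ × F₂) (V₁ ×ᵇ V₂)}
    (hg : ContMDiffAt IN (IX.prod 𝓘(ℝ, F₁ × F₂)) ∞ g x₀) :
    ContMDiffAt IN (IX.prod 𝓘(ℝ, F₂)) ∞
      (fun y => (⟨(g y).proj, (g y).2.2⟩ : TotalSpace F₂ V₂)) x₀ :=
  contMDiffAt_totalSpace.2 ⟨(contMDiffAt_totalSpace.1 hg).1,
    (ContinuousLinearMap.snd ℝ F₁ F₂).contMDiff.contMDiffAt.comp x₀ (contMDiffAt_totalSpace.1 hg).2⟩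

theorem contMDiffAt_prod_along {p : N → X} {s : ∀ y, V₁ (p y)} {t : ∀ y, V₂ (p y)}
    (hs : ContMDiffAt IN (IX.prod 𝓘(ℝ, F₁)) ∞ (fun y => (⟨p y, s y⟩ : TotalSpace F₁ V₁)) x₀)
    (ht : ContMDiffAt IN (IX.prod 𝓘(ℝ, F₂)) ∞ (fun y => (⟨p y, t y⟩ : TotalSpace F₂ V₂)) x₀) :
    ContMDiffAt IN (IX.prod 𝓘(ℝ, F₁ × F₂)) ∞
      (fun y => (⟨p y, (s y, t y)⟩ : TotalSpace (F₁ × F₂) (V₁ ×ᵇ V₂))) x₀ :=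
  contMDiffAt_totalSpace.2 ⟨(contMDiffAt_totalSpace.1 hs).1,
    (contMDiffAt_totalSpace.1 hs).2.prodMk_space (contMDiffAt_totalSpace.1 ht).2⟩

end ProductBundle

section BundleSections

variable {EX : Type*} [NormedAddCommGroup EX] [NormedSpace ℝ EX]
  {HX : Type*} [TopologicalSpace HX] {IX : ModelWithCorners ℝ EX HX}
  {X : Type*} [TopologicalSpace X] [ChartedSpace HX X]
  {F : Type*} [NormedAddCommGroup F] [NormedSpace ℝ F]
  {V : X → Type*} [∀ x, AddCommGroup (V x)] [∀ x, Module ℝ (V x)]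
  [TopologicalSpace (TotalSpace F V)] [∀ x, TopologicalSpace (V x)]
  [FiberBundle F V] [VectorBundle ℝ F V]

section Along

variable {EN : Type*} [NormedAddCommGroup EN] [NormedSpace ℝ EN]
  {HN : Type*} [TopologicalSpace HN] {IN : ModelWithCorners ℝ EN HN}
  {N : Type*} [TopologicalSpace N] [ChartedSpace HN N] {p : N → X} {x₀ : N}

omit [∀ x, AddCommGroup (V x)] [∀ x, Module ℝ (V x)] [VectorBundle ℝ F V] in
theorem contMDiffAt_proj_along {s : ∀ y, V (p y)}
    (hs : ContMDiffAt IN (IX.prod 𝓘(ℝ, F)) ∞ (fun y => (⟨p y, s y⟩ : TotalSpace F V)) x₀) :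
    ContMDiffAt IN IX ∞ p x₀ :=
  (contMDiffAt_totalSpace.1 hs).1

theorem contMDiffAt_zero_along (hp : ContMDiffAt IN IX ∞ p x₀) :
    ContMDiffAt IN (IX.prod 𝓘(ℝ, F)) ∞ (fun y => (⟨p y, 0⟩ : TotalSpace F V)) x₀ :=
  (contMDiff_zeroSection ℝ V).contMDiffAt.comp x₀ hp

variable (F V) in
theorem eventually_isLinear_trivializationAt (hp : ContinuousAt p x₀) :
    ∀ᶠ y in nhds x₀, IsLinearMap ℝ fun v : V (p y) =>
      (trivializationAt F V (p x₀) ⟨p y, v⟩).2 := by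
  filter_upwards [hp.eventually_mem ((trivializationAt F V (p x₀)).open_baseSet.mem_nhds
    (mem_baseSet_trivializationAt F V (p x₀)))] with y hy
  exact (trivializationAt F V (p x₀)).linear ℝ hy

theorem contMDiffAt_add_along {s t : ∀ y, V (p y)}
    (hs : ContMDiffAt IN (IX.prod 𝓘(ℝ, F)) ∞ (fun y => (⟨p y, s y⟩ : TotalSpace F V)) x₀)
    (ht : ContMDiffAt IN (IX.prod 𝓘(ℝ, F)) ∞ (fun y => (⟨p y, t y⟩ : TotalSpace F V)) x₀) :
    ContMDiffAt IN (IX.prod 𝓘(ℝ, F)) ∞ (fun y => (⟨p y, s y + t y⟩ : TotalSpace F V)) x₀ := by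
  obtain ⟨hp, hs⟩ := contMDiffAt_totalSpace.1 hs
  refine contMDiffAt_totalSpace.2
    ⟨hp, (hs.add (contMDiffAt_totalSpace.1 ht).2).congr_of_eventuallyEq ?_⟩
  filter_upwards [eventually_isLinear_trivializationAt F V hp.continuousAt] with y hy
  exact hy.map_add _ _

theorem contMDiffAt_smul_along {f : N → ℝ} {s : ∀ y, V (p y)}
    (hf : ContMDiffAt IN 𝓘(ℝ, ℝ) ∞ f x₀)
    (hs : ContMDiffAt IN (IX.prod 𝓘(ℝ, F)) ∞ (fun y => (⟨p y, s y⟩ : TotalSpace F V)) x₀) :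
    ContMDiffAt IN (IX.prod 𝓘(ℝ, F)) ∞ (fun y => (⟨p y, f y • s y⟩ : TotalSpace F V)) x₀ := by
  obtain ⟨hp, hs⟩ := contMDiffAt_totalSpace.1 hs
  refine contMDiffAt_totalSpace.2 ⟨hp, (hf.smul hs).congr_of_eventuallyEq ?_⟩
  filter_upwards [eventually_isLinear_trivializationAt F V hp.continuousAt] with y hy
  exact hy.map_smul _ _

theorem contMDiffAt_sum_along {κ : Type*} (A : Finset κ) {s : κ → ∀ y, V (p y)}
    (hp : ContMDiffAt IN IX ∞ p x₀)
    (hs : ∀ i ∈ A,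
      ContMDiffAt IN (IX.prod 𝓘(ℝ, F)) ∞ (fun y => (⟨p y, s i y⟩ : TotalSpace F V)) x₀) :
    ContMDiffAt IN (IX.prod 𝓘(ℝ, F)) ∞ (fun y => (⟨p y, ∑ i ∈ A, s i y⟩ : TotalSpace F V)) x₀ := by
  classical
  induction A using Finset.induction_on with
  | empty => simpa only [Finset.sum_empty] using contMDiffAt_zero_along hp
  | insert a A ha ih =>
    simp only [Finset.sum_insert ha]
    exact contMDiffAt_add_along (hs a (Finset.mem_insert_self a A))
      (ih fun i hi => hs i (Finset.mem_insert_of_mem hi))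

variable [ContMDiffVectorBundle ∞ F V IX] (e : Trivialization F (π F V)) [MemTrivializationAtlas e]

theorem contMDiffAt_symm_along {v : N → F} (hp : ContMDiffAt IN IX ∞ p x₀)
    (hv : ContMDiffAt IN 𝓘(ℝ, F) ∞ v x₀) (he : p x₀ ∈ e.baseSet) :
    ContMDiffAt IN (IX.prod 𝓘(ℝ, F)) ∞
      (fun y => (⟨p y, e.symm (p y) (v y)⟩ : TotalSpace F V)) x₀ := by
  refine (e.contMDiffAt_iff (e.mem_source.2 he)).2 ⟨hp, hv.congr_of_eventuallyEq ?_⟩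
  filter_upwards [hp.continuousAt.eventually_mem (e.open_baseSet.mem_nhds he)] with y hy
  simp [e.apply_mk_symm hy]

theorem contMDiffAt_symmₗ_along {v : N → F} (hp : ContMDiffAt IN IX ∞ p x₀)
    (hv : ContMDiffAt IN 𝓘(ℝ, F) ∞ v x₀) (he : p x₀ ∈ e.baseSet) :
    ContMDiffAt IN (IX.prod 𝓘(ℝ, F)) ∞
      (fun y => (⟨p y, e.symmₗ ℝ (p y) (v y)⟩ : TotalSpace F V)) x₀ := by
  refine (contMDiffAt_symm_along e hp hv he).congr_of_eventuallyEq ?_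
  filter_upwards [hp.continuousAt.eventually_mem (e.open_baseSet.mem_nhds he)] with y hy
  rw [e.coe_symmₗ hy]

theorem contMDiffAt_coord_along {s : ∀ y, V (p y)}
    (hs : ContMDiffAt IN (IX.prod 𝓘(ℝ, F)) ∞ (fun y => (⟨p y, s y⟩ : TotalSpace F V)) x₀)
    (he : p x₀ ∈ e.baseSet) :
    ContMDiffAt IN 𝓘(ℝ, F) ∞ (fun y => (e ⟨p y, s y⟩).2) x₀ :=
  ((e.contMDiffAt_iff (f := fun y => (⟨p y, s y⟩ : TotalSpace F V)) (e.mem_source.2 he)).1 hs).2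

theorem contMDiffAt_linearMapAt_along {s : ∀ y, V (p y)}
    (hs : ContMDiffAt IN (IX.prod 𝓘(ℝ, F)) ∞ (fun y => (⟨p y, s y⟩ : TotalSpace F V)) x₀)
    (he : p x₀ ∈ e.baseSet) :
    ContMDiffAt IN 𝓘(ℝ, F) ∞ (fun y => e.linearMapAt ℝ (p y) (s y)) x₀ := by
  refine (contMDiffAt_coord_along e hs he).congr_of_eventuallyEq ?_
  filter_upwards [(contMDiffAt_proj_along hs).continuousAt.eventually_mem
    (e.open_baseSet.mem_nhds he)] with y hy
  rw [e.coe_linearMapAt_of_mem hy]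

end Along

theorem mem_smoothSections_iff_contMDiffAt {U : Opens X} {s : ∀ x, V x} :
    (fun x : U => s x) ∈ smoothSections IX F V U ↔
      ∀ x ∈ U, ContMDiffAt IX (IX.prod 𝓘(ℝ, F)) ∞ (fun x => (⟨x, s x⟩ : TotalSpace F V)) x := by
  have hsub (x : U) := contMDiffAt_subtype_iff (I := IX) (I' := IX.prod 𝓘(ℝ, F)) (n := ∞) (x := x)
    (f := fun x => (⟨x, s x⟩ : TotalSpace F V))
  exact ⟨fun hs x hx => (hsub ⟨x, hx⟩).1 (hs ⟨x, hx⟩), fun hs x => (hsub x).2 (hs x x.2)⟩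

section Frames

variable {κ : Type*} [Fintype κ] (b : Module.Basis κ ℝ F) {U W : Opens X}

variable (IX U) in
/-- The basis of the module `C^∞(U, F)` that consists of the constant functions with values in a
basis of `F`. -/
def smoothFunBasis : Module.Basis κ (SmoothFun IX U) C^∞⟮IX, U; 𝓘(ℝ, F), F⟯ :=
  haveI : FiniteDimensional ℝ F := b.finiteDimensional_of_finite
  .ofEquivFun
    { toFun v i := ⟨fun x => b.repr (v x) i,
        (b.coord i).toContinuousLinearMap.contMDiff.comp v.contMDiff⟩
      map_add' v w := by funext i; ext x; exact (b.coord i).map_add (v x) (w x)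
      map_smul' f v := by funext i; ext x; exact (b.coord i).map_smul (f x) (v x)
      invFun f := ⟨fun x => ∑ i, f i x • b i,
        contMDiff_finsetSum fun i _ => (f i).contMDiff.smul contMDiff_const⟩
      left_inv v := by ext x; exact b.sum_repr (v x)
      right_inv f := by funext i; ext x; exact congrFun (b.repr_sum_self fun i => f i x) i }

theorem smoothFunBasis_apply (i : κ) (x : U) : smoothFunBasis IX b U i x = b i := by
  classical
  simp only [smoothFunBasis, Module.Basis.coe_ofEquivFun]
  change ∑ j, (Pi.single (M := fun _ => SmoothFun IX U) i 1 j) x • b j = b i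
  rw [Finset.sum_eq_single i (fun j _ hj => by simp [hj]) (by simp)]
  simp

variable (e : Trivialization F (π F V)) [MemTrivializationAtlas e]

theorem sum_coord_smul_symmₗ {x : X} (hx : x ∈ e.baseSet) (y : V x) :
    ∑ i, b.coord i (e.linearMapAt ℝ x y) • e.symmₗ ℝ x (b i) = y := by
  simp only [← map_smul, ← map_sum, Module.Basis.coord_apply, b.sum_repr]
  exact e.symmₗ_linearMapAt hx y

variable [ContMDiffVectorBundle ∞ F V IX]

namespace smoothSections

variable (IX) in
/-- Over an open subset of the base set of a trivialization, smooth sections are the same as smooth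
functions with values in the model fibre. -/
def trivialize (hU : (U : Set X) ⊆ e.baseSet) :
    smoothSections IX F V U ≃ₗ[SmoothFun IX U] C^∞⟮IX, U; 𝓘(ℝ, F), F⟯ where
  toFun s := ⟨fun x => (e ⟨x, s.1 x⟩).2, fun x => contMDiffAt_coord_along e (s.2 x) (hU x.2)⟩
  map_add' s t := by ext x; exact (e.linear ℝ (hU x.2)).map_add (s.1 x) (t.1 x)
  map_smul' f s := by ext x; exact (e.linear ℝ (hU x.2)).map_smul (f x) (s.1 x)
  invFun v := ⟨fun x => e.symm x (v x), fun x =>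
    contMDiffAt_symm_along e contMDiff_subtype_val.contMDiffAt v.contMDiff.contMDiffAt (hU x.2)⟩
  left_inv s := Subtype.ext (funext fun x => e.symm_apply_apply_mk (hU x.2) (s.1 x))
  right_inv v := by ext x; exact congrArg Prod.snd (e.apply_mk_symm (hU x.2) (v x))

variable (IX) in
/-- The basis of the module of smooth sections over `U` given by a trivialization over `U` and a
basis of the model fibre. -/
def frame (hU : (U : Set X) ⊆ e.baseSet) :
    Module.Basis κ (SmoothFun IX U) (smoothSections IX F V U) :=
  (smoothFunBasis IX b U).map (trivialize IX e hU).symm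

theorem frame_apply (hU : (U : Set X) ⊆ e.baseSet) (i : κ) (x : U) :
    (frame IX b e hU i).1 x = e.symm x (b i) :=
  congrArg (e.symm x) (smoothFunBasis_apply b i x)

theorem res_frame (hU : (U : Set X) ⊆ e.baseSet) (h : W ≤ U) (i : κ) :
    res IX F h (frame IX b e hU i) = frame IX b e (Set.Subset.trans h hU) i :=
  Subtype.ext (funext fun x =>
    (frame_apply b e hU i (Set.inclusion h x)).trans (frame_apply b e _ i x).symm)

end smoothSections

end Frames

end BundleSections

section AlternatingBundle

variable {EX : Type*} [NormedAddCommGroup EX] [NormedSpace ℝ EX]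
  {HX : Type*} [TopologicalSpace HX] {IX : ModelWithCorners ℝ EX HX}
  {X : Type*} [TopologicalSpace X] [ChartedSpace HX X]
  {F : Type*} [NormedAddCommGroup F] [NormedSpace ℝ F]
  {V : X → Type*} [∀ x, AddCommGroup (V x)] [∀ x, Module ℝ (V x)]
  [TopologicalSpace (TotalSpace F V)] [∀ x, TopologicalSpace (V x)]
  [FiberBundle F V] [VectorBundle ℝ F V]
  {ι : Type*} [Fintype ι]

section Smooth

variable {F' : Type*} [NormedAddCommGroup F'] [NormedSpace ℝ F']
  {V' : X → Type*} [∀ x, AddCommGroup (V' x)] [∀ x, Module ℝ (V' x)]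
  [TopologicalSpace (TotalSpace F' V')] [∀ x, TopologicalSpace (V' x)]
  [FiberBundle F' V'] [VectorBundle ℝ F' V']
  [∀ x, IsTopologicalAddGroup (V' x)] [∀ x, ContinuousSMul ℝ (V' x)]
  [FiniteDimensional ℝ F] [FiniteDimensional ℝ F']
  [ContMDiffVectorBundle ∞ F V IX] [ContMDiffVectorBundle ∞ F' V' IX]

instance :
    (Bundle.ContinuousAlternatingMap.vectorPrebundle ℝ ι F V F' V').IsContMDiff IX ∞ where
  exists_contMDiffCoordChange := by
    rintro _ ⟨e₁, e₂, he₁, he₂, rfl⟩ _ ⟨e₁', e₂', he₁', he₂', rfl⟩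
    refine ⟨Pretrivialization.continuousAlternatingMapCoordChange ℝ ι e₁ e₁' e₂ e₂', ?_,
      Pretrivialization.continuousAlternatingMapCoordChange_apply⟩
    rintro x ⟨⟨h₁, h₂⟩, ⟨h₁', h₂'⟩⟩
    refine ContMDiffAt.contMDiffWithinAt (contMDiffAt_clm_of_apply fun η =>
      contMDiffAt_alternating_of_apply fun v => ?_)
    have hV := contMDiffAt_coordChangeL (n := ∞) (IB := IX) h₁' h₁
    have hV' := contMDiffAt_coordChangeL (n := ∞) (IB := IX) h₂ h₂'
    exact hV'.clm_apply (contMDiffAt_alternating_apply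
      (v := fun y i => e₁'.coordChangeL ℝ e₁ y (v i)) contMDiffAt_const
      (contMDiffAt_pi_space.2 fun i => hV.clm_apply contMDiffAt_const))

instance :
    ContMDiffVectorBundle ∞ (F [⋀^ι]→L[ℝ] F') (fun x => V x [⋀^ι]→L[ℝ] V' x) IX :=
  (Bundle.ContinuousAlternatingMap.vectorPrebundle ℝ ι F V F' V').contMDiffVectorBundle IX

end Smooth

theorem trivializationAt_form_apply {x₀ x : X} (hx : x ∈ (trivializationAt F V x₀).baseSet)
    (η : V x [⋀^ι]→L[ℝ] Bundle.Trivial X ℝ x) (v : ι → F) :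
    (trivializationAt (F [⋀^ι]→L[ℝ] ℝ) (fun x => V x [⋀^ι]→L[ℝ] Bundle.Trivial X ℝ x) x₀
      ⟨x, η⟩).2 v = η fun i => (trivializationAt F V x₀).symm x (v i) := by
  rw [FiberBundle.trivializationAt_continuousAlternatingMap_apply]
  refine (DFunLike.congr_fun (Bundle.Trivial.continuousLinearMapAt_trivialization ℝ X ℝ x) _).trans
    (congrArg η (funext fun i => Trivialization.symmL_apply _ hx (v i)))

variable {EN : Type*} [NormedAddCommGroup EN] [NormedSpace ℝ EN]
  {HN : Type*} [TopologicalSpace HN] {IN : ModelWithCorners ℝ EN HN}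
  {N : Type*} [TopologicalSpace N] [ChartedSpace HN N] {p : N → X} {y₀ : N}
  {η : ∀ y, V (p y) [⋀^ι]→L[ℝ] Bundle.Trivial X ℝ (p y)}

theorem contMDiffAt_form_of_apply [FiniteDimensional ℝ F] (hp : ContMDiffAt IN IX ∞ p y₀)
    (h : ∀ v : ι → F, ContMDiffAt IN 𝓘(ℝ, ℝ) ∞
      (fun y => (η y fun i => (trivializationAt F V (p y₀)).symm (p y) (v i) : ℝ)) y₀) :
    ContMDiffAt IN (IX.prod 𝓘(ℝ, F [⋀^ι]→L[ℝ] ℝ)) ∞ (fun y => (⟨p y, η y⟩ :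
      TotalSpace (F [⋀^ι]→L[ℝ] ℝ) (fun x => V x [⋀^ι]→L[ℝ] Bundle.Trivial X ℝ x))) y₀ := by
  refine contMDiffAt_totalSpace.2 ⟨hp, contMDiffAt_alternating_of_apply fun v =>
    (h v).congr_of_eventuallyEq ?_⟩
  filter_upwards [hp.continuousAt.eventually_mem ((trivializationAt F V _).open_baseSet.mem_nhds
    (mem_baseSet_trivializationAt F V (p y₀)))] with y hy
  exact trivializationAt_form_apply hy (η y) v

variable [ContMDiffVectorBundle ∞ F V IX]

theorem contMDiffAt_form_apply {v : ∀ y, ι → V (p y)}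
    (hη : ContMDiffAt IN (IX.prod 𝓘(ℝ, F [⋀^ι]→L[ℝ] ℝ)) ∞ (fun y => (⟨p y, η y⟩ :
      TotalSpace (F [⋀^ι]→L[ℝ] ℝ) (fun x => V x [⋀^ι]→L[ℝ] Bundle.Trivial X ℝ x))) y₀)
    (hv : ∀ i,
      ContMDiffAt IN (IX.prod 𝓘(ℝ, F)) ∞ (fun y => (⟨p y, v y i⟩ : TotalSpace F V)) y₀) :
    ContMDiffAt IN 𝓘(ℝ, ℝ) ∞ (fun y => (η y (v y) : ℝ)) y₀ := by
  obtain ⟨hp, hη⟩ := contMDiffAt_totalSpace.1 hη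
  let e := trivializationAt F V (p y₀)
  have he : p y₀ ∈ e.baseSet := mem_baseSet_trivializationAt F V (p y₀)
  refine (contMDiffAt_alternating_apply hη (contMDiffAt_pi_space.2 fun i =>
    contMDiffAt_coord_along e (hv i) he)).congr_of_eventuallyEq ?_
  filter_upwards [hp.continuousAt.eventually_mem (e.open_baseSet.mem_nhds he)] with y hy
  refine Eq.symm ((trivializationAt_form_apply hy (η y) _).trans ?_)
  exact congrArg (η y) (funext fun i => e.symm_apply_apply_mk hy (v y i))

end AlternatingBundle

section ModelBundle

variable {EX : Type*} [NormedAddCommGroup EX] [NormedSpace ℝ EX]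
  {HX : Type*} [TopologicalSpace HX] {IX : ModelWithCorners ℝ EX HX}
  {X : Type*} [TopologicalSpace X] [ChartedSpace HX X]
  (F : Type*) [NormedAddCommGroup F] [NormedSpace ℝ F]
  (V : X → Type*) [∀ x, AddCommGroup (V x)] [∀ x, Module ℝ (V x)]
  [TopologicalSpace (TotalSpace F V)] [∀ x, TopologicalSpace (V x)]
  [FiberBundle F V] [VectorBundle ℝ F V]
  {F' : Type*} [NormedAddCommGroup F'] [NormedSpace ℝ F'] (L : F ≃L[ℝ] F')

/-- The vector bundle core with fibre `F'` that is obtained from a vector bundle with fibre `F` and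
an isomorphism `F ≃ F'`. Its fibres live in the universe of `F'`. -/
def modelCore : VectorBundleCore ℝ X F' X where
  baseSet x := (trivializationAt F V x).baseSet
  isOpen_baseSet x := (trivializationAt F V x).open_baseSet
  indexAt x := x
  mem_baseSet_at x := mem_baseSet_trivializationAt F V x
  coordChange i j x := L.toContinuousLinearMap ∘L
    ((trivializationAt F V i).coordChangeL ℝ (trivializationAt F V j) x : F →L[ℝ] F) ∘L
      L.symm.toContinuousLinearMap
  coordChange_self i x hx v := by
    simp [Trivialization.coordChangeL_apply _ _ (And.intro hx hx),
      Trivialization.apply_mk_symm _ hx]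
  continuousOn_coordChange _ _ :=
    continuousOn_const.clm_comp ((continuousOn_coordChange ℝ _ _).clm_comp continuousOn_const)
  coordChange_comp _ _ _ x hx v := by
    simp [Trivialization.coordChangeL_apply _ _ (And.intro hx.1.1 hx.1.2),
      Trivialization.coordChangeL_apply _ _ (And.intro hx.1.2 hx.2),
      Trivialization.coordChangeL_apply _ _ (And.intro hx.1.1 hx.2),
      Trivialization.symm_apply_apply_mk _ hx.1.2]

instance [ContMDiffVectorBundle ∞ F V IX] : (modelCore F V L).IsContMDiff IX ∞ where
  contMDiffOn_coordChange _ _ :=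
    contMDiffOn_const.clm_comp ((contMDiffOn_coordChangeL _ _).clm_comp contMDiffOn_const)

/-- The fibrewise isomorphism of a vector bundle with its model. -/
def toModel (x : X) : V x ≃ₗ[ℝ] (modelCore F V L).Fiber x :=
  ((VectorBundle.continuousLinearEquivAt ℝ F V x).trans L).toLinearEquiv

variable {F V}

theorem coord_toModel {x₀ x : X} (hx : x ∈ (trivializationAt F V x₀).baseSet) (v : V x) :
    (trivializationAt F' (modelCore F V L).Fiber x₀ ⟨x, toModel F V L x v⟩).2 =
      L (trivializationAt F V x₀ ⟨x, v⟩).2 := by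
  change L ((trivializationAt F V x).coordChangeL ℝ (trivializationAt F V x₀) x
    (L.symm (L (trivializationAt F V x ⟨x, v⟩).2))) = _
  have hxx := mem_baseSet_trivializationAt F V x
  simp [Trivialization.coordChangeL_apply _ _ (And.intro hxx hx),
    Trivialization.symm_apply_apply_mk _ hxx]

variable {EN : Type*} [NormedAddCommGroup EN] [NormedSpace ℝ EN]
  {HN : Type*} [TopologicalSpace HN] {IN : ModelWithCorners ℝ EN HN}
  {N : Type*} [TopologicalSpace N] [ChartedSpace HN N] {p : N → X} {y₀ : N}

theorem contMDiffAt_toModel_iff {s : ∀ y, V (p y)} :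
    ContMDiffAt IN (IX.prod 𝓘(ℝ, F')) ∞
      (fun y => (⟨p y, toModel F V L (p y) (s y)⟩ : TotalSpace F' (modelCore F V L).Fiber)) y₀ ↔
    ContMDiffAt IN (IX.prod 𝓘(ℝ, F)) ∞ (fun y => (⟨p y, s y⟩ : TotalSpace F V)) y₀ := by
  let e := trivializationAt F V (p y₀)
  rw [contMDiffAt_totalSpace, contMDiffAt_totalSpace]
  refine and_congr_right fun hp => ?_
  have hcoord : (fun y => (trivializationAt F' (modelCore F V L).Fiber (p y₀)
      ⟨p y, toModel F V L (p y) (s y)⟩).2) =ᶠ[nhds y₀] fun y => L (e ⟨p y, s y⟩).2 := by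
    filter_upwards [hp.continuousAt.eventually_mem
      (e.open_baseSet.mem_nhds (mem_baseSet_trivializationAt F V (p y₀)))] with y hy
    exact coord_toModel L hy (s y)
  refine hcoord.contMDiffAt_iff.trans ⟨fun h => ?_, fun h =>
    L.toContinuousLinearMap.contMDiff.contMDiffAt.comp y₀ h⟩
  simpa [Function.comp_def] using L.symm.toContinuousLinearMap.contMDiff.contMDiffAt.comp y₀ h

end ModelBundle

section PreferredOpens

variable {X F : Type*} [TopologicalSpace X] [TopologicalSpace F] (V : X → Type*)
  [TopologicalSpace (TotalSpace F V)] [∀ x, TopologicalSpace (V x)] [FiberBundle F V]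

variable (F) in
/-- The base set of the preferred trivialization at `x`. -/
def preferredOpens (x : X) : Opens X :=
  ⟨(trivializationAt F V x).baseSet, (trivializationAt F V x).open_baseSet⟩

variable (F) in
theorem mem_preferredOpens (x : X) : x ∈ preferredOpens F V x :=
  mem_baseSet_trivializationAt F V x

end PreferredOpens

section LocallyFree

variable {EX : Type*} [NormedAddCommGroup EX] [NormedSpace ℝ EX]
  {HX : Type*} [TopologicalSpace HX] (IX : ModelWithCorners ℝ EX HX)
  {X : Type*} [TopologicalSpace X] [ChartedSpace HX X]
  (F : Type*) [NormedAddCommGroup F] [NormedSpace ℝ F] [FiniteDimensional ℝ F]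
  (V : X → Type*) [∀ x, AddCommGroup (V x)] [∀ x, Module ℝ (V x)]
  [TopologicalSpace (TotalSpace F V)] [∀ x, TopologicalSpace (V x)]
  [FiberBundle F V] [VectorBundle ℝ F V] [ContMDiffVectorBundle ∞ F V IX]

theorem smoothSections.exists_basis (x : X) :
    ∃ (U : Opens X) (_ : x ∈ U) (n : ℕ) (s : Fin n → smoothSections IX F V U),
      ∀ (W : Opens X) (h : W ≤ U),
        ∃ β : Module.Basis (Fin n) (SmoothFun IX W) (smoothSections IX F V W),
          ∀ i, β i = res IX F h (s i) :=
  ⟨preferredOpens F V x, mem_preferredOpens F V x, _,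
    frame IX (Module.finBasis ℝ F) (trivializationAt F V x) subset_rfl,
    fun _ h => ⟨frame IX (Module.finBasis ℝ F) (trivializationAt F V x) h,
      fun i => (res_frame _ _ subset_rfl h i).symm⟩⟩

end LocallyFree

section SectionEquivalences

variable {EX : Type*} [NormedAddCommGroup EX] [NormedSpace ℝ EX]
  {HX : Type*} [TopologicalSpace HX] {IX : ModelWithCorners ℝ EX HX}
  {X : Type*} [TopologicalSpace X] [ChartedSpace HX X]
  {F : Type*} [NormedAddCommGroup F] [NormedSpace ℝ F]
  {V : X → Type*} [∀ x, AddCommGroup (V x)] [∀ x, Module ℝ (V x)]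
  [TopologicalSpace (TotalSpace F V)] [∀ x, TopologicalSpace (V x)]
  [FiberBundle F V] [VectorBundle ℝ F V]
  {F' : Type*} [NormedAddCommGroup F'] [NormedSpace ℝ F']
  {V' : X → Type*} [∀ x, AddCommGroup (V' x)] [∀ x, Module ℝ (V' x)]
  [TopologicalSpace (TotalSpace F' V')] [∀ x, TopologicalSpace (V' x)]
  [FiberBundle F' V'] [VectorBundle ℝ F' V']
  {K : Type*} [NormedAddCommGroup K] [NormedSpace ℝ K]

/-- The sections of a vector bundle are those of its model. -/
def smoothSectionsModelEquiv (L : F ≃L[ℝ] K) (U : Opens X) :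
    smoothSections IX F V U ≃ₗ[SmoothFun IX U] smoothSections IX K (modelCore F V L).Fiber U where
  toFun s := ⟨fun x => toModel F V L x (s.1 x), fun x => (contMDiffAt_toModel_iff L).2 (s.2 x)⟩
  map_add' _ _ := Subtype.ext (funext fun x => (toModel F V L x).map_add _ _)
  map_smul' _ _ := Subtype.ext (funext fun x => (toModel F V L x).map_smul _ _)
  invFun t := ⟨fun x => (toModel F V L x).symm (t.1 x), fun x =>
    (contMDiffAt_toModel_iff L).1 (by simpa only [LinearEquiv.apply_symm_apply] using t.2 x)⟩
  left_inv _ := Subtype.ext (funext fun x => (toModel F V L x).symm_apply_apply _)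
  right_inv _ := Subtype.ext (funext fun x => (toModel F V L x).apply_symm_apply _)

/-- The sections of a direct sum of vector bundles are the pairs of sections. -/
def smoothSectionsProdEquiv (U : Opens X) :
    smoothSections IX (F × F') (V ×ᵇ V') U ≃ₗ[SmoothFun IX U]
      (smoothSections IX F V U × smoothSections IX F' V' U) where
  toFun s := (⟨fun x => (s.1 x).1, fun x => contMDiffAt_fst_along (s.2 x)⟩,
    ⟨fun x => (s.1 x).2, fun x => contMDiffAt_snd_along (s.2 x)⟩)
  map_add' _ _ := rfl
  map_smul' _ _ := rfl
  invFun t := ⟨fun x => (t.1.1 x, t.2.1 x), fun x => contMDiffAt_prod_along (t.1.2 x) (t.2.2 x)⟩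
  left_inv _ := rfl
  right_inv _ := rfl

section ModelSum

variable (L : (F × F') ≃L[ℝ] K)

variable (V V') in
/-- The inclusion of a vector bundle into the model of a direct sum. -/
def modelInl (x : X) : V x →ₗ[ℝ] (modelCore (F × F') (V ×ᵇ V') L).Fiber x :=
  (toModel (F × F') (V ×ᵇ V') L x).toLinearMap ∘ₗ LinearMap.inl ℝ (V x) (V' x)

variable (V V') in
/-- The projection of the model of a direct sum to the second summand. -/
def modelSnd (x : X) : (modelCore (F × F') (V ×ᵇ V') L).Fiber x →ₗ[ℝ] V' x :=
  LinearMap.snd ℝ (V x) (V' x) ∘ₗ (toModel (F × F') (V ×ᵇ V') L x).symm.toLinearMap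

theorem contMDiff_modelInl : ContMDiff (IX.prod 𝓘(ℝ, F)) (IX.prod 𝓘(ℝ, K)) ∞
    (fun v : TotalSpace F V => (⟨v.proj, modelInl V V' L v.proj v.2⟩ :
      TotalSpace K (modelCore (F × F') (V ×ᵇ V') L).Fiber)) := by
  intro v
  have hinl : ContMDiffAt (IX.prod 𝓘(ℝ, F)) (IX.prod 𝓘(ℝ, F × F')) ∞
      (fun v : TotalSpace F V => (⟨v.proj, (v.2, 0)⟩ : TotalSpace (F × F') (V ×ᵇ V'))) v :=
    contMDiffAt_prod_along (p := fun v : TotalSpace F V => v.proj) (s := fun v => v.2)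
      (t := fun v => (0 : V' v.proj)) contMDiffAt_id
      (contMDiffAt_zero_along (contMDiffAt_proj V))
  exact (contMDiffAt_toModel_iff L).2 hinl

theorem contMDiff_modelSnd : ContMDiff (IX.prod 𝓘(ℝ, K)) (IX.prod 𝓘(ℝ, F')) ∞
    (fun v : TotalSpace K (modelCore (F × F') (V ×ᵇ V') L).Fiber =>
      (⟨v.proj, modelSnd V V' L v.proj v.2⟩ : TotalSpace F' V')) := by
  intro v
  have hsymm : ContMDiffAt (IX.prod 𝓘(ℝ, K)) (IX.prod 𝓘(ℝ, F × F')) ∞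
      (fun v : TotalSpace K (modelCore (F × F') (V ×ᵇ V') L).Fiber =>
        (⟨v.proj, (toModel (F × F') (V ×ᵇ V') L v.proj).symm v.2⟩ :
          TotalSpace (F × F') (V ×ᵇ V'))) v := by
    refine (contMDiffAt_toModel_iff L).1 ?_
    simp only [LinearEquiv.apply_symm_apply]
    exact contMDiffAt_id
  exact contMDiffAt_snd_along hsymm

theorem modelInl_injective (x : X) : Function.Injective (modelInl V V' L x) :=
  (toModel (F × F') (V ×ᵇ V') L x).injective.comp LinearMap.inl_injective

theorem modelSnd_surjective (x : X) : Function.Surjective (modelSnd V V' L x) :=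
  Prod.snd_surjective.comp (toModel (F × F') (V ×ᵇ V') L x).symm.surjective

theorem exact_modelInl_modelSnd (x : X) :
    Function.Exact (modelInl V V' L x) (modelSnd V V' L x) :=
  (LinearEquiv.conj_exact_iff_exact _ _ (toModel (F × F') (V ×ᵇ V') L x)).2 .inl_snd

end ModelSum

end SectionEquivalences

/-! ### The core and the metric of a double vector bundle -/

section Glueing

theorem exists_eq_of_compatible {X κ : Type*} {V : X → Type*} [∀ x, Nonempty (V x)]
    {U : κ → Set X} {s : ∀ (i : κ) (x : U i), V x}
    (hs : ∀ i j x (hi : x ∈ U i) (hj : x ∈ U j), s i ⟨x, hi⟩ = s j ⟨x, hj⟩) :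
    ∃ t : ∀ x, V x, ∀ i (x : U i), t x = s i x := by
  classical
  refine ⟨fun x => if h : ∃ i, x ∈ U i then s h.choose ⟨x, h.choose_spec⟩ else
    Classical.arbitrary _, fun i x => ?_⟩
  have h : ∃ i, x.1 ∈ U i := ⟨i, x.2⟩
  exact (dif_pos h).trans (hs _ _ _ h.choose_spec x.2)

end Glueing

section TotalSpace

variable {X F : Type*} {V : X → Type*}

open Classical in
/-- The vector of the fibre over `x` that is given by a point `d` of the total space over `x`. The
value is zero if `d` does not lie over `x`. -/
def vectorAt [∀ x, Zero (V x)] (x : X) (d : TotalSpace F V) : V x :=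
  if h : d.proj = x then h ▸ d.2 else 0

theorem mk_vectorAt [∀ x, Zero (V x)] {x : X} {d : TotalSpace F V} (h : d.proj = x) :
    (⟨x, vectorAt x d⟩ : TotalSpace F V) = d := by
  subst h
  simp [vectorAt]

theorem exists_eq_mk_of_proj_eq {x : X} {d : TotalSpace F V} (h : d.proj = x) :
    ∃ v : V x, d = ⟨x, v⟩ := by
  subst h
  exact ⟨d.2, rfl⟩

end TotalSpace

variable {E : Type*} [NormedAddCommGroup E] [NormedSpace ℝ E]
  {M : Type*} [TopologicalSpace M] [ChartedSpace E M]
  {FQ : Type*} [NormedAddCommGroup FQ] [NormedSpace ℝ FQ]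
  {Q : M → Type*}
  [TopologicalSpace (TotalSpace FQ Q)] [∀ m, TopologicalSpace (Q m)] [FiberBundle FQ Q]
  {FB : Type*} [NormedAddCommGroup FB] [NormedSpace ℝ FB]
  {B : M → Type*}
  [TopologicalSpace (TotalSpace FB B)] [∀ m, TopologicalSpace (B m)] [FiberBundle FB B]
  {FDQ : Type*} [NormedAddCommGroup FDQ] [NormedSpace ℝ FDQ]
  {DQ : TotalSpace FQ Q → Type*}
  [TopologicalSpace (TotalSpace FDQ DQ)] [∀ q, TopologicalSpace (DQ q)] [FiberBundle FDQ DQ]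
  {FDB : Type*} [NormedAddCommGroup FDB] [NormedSpace ℝ FDB]
  {DB : TotalSpace FB B → Type*}
  [TopologicalSpace (TotalSpace FDB DB)] [∀ b, TopologicalSpace (DB b)] [FiberBundle FDB DB]

namespace DoubleBundleSquare

variable (S : DoubleBundleSquare E FQ Q FB B FDQ DQ FDB DB)

/-- The point of `D` given by a vector of the fibre of `D → B` over `b`. -/
def inB (b : TotalSpace FB B) (x : DB b) : TotalSpace FDQ DQ := S.swap.symm ⟨b, x⟩

@[simp] theorem swap_inB (b : TotalSpace FB B) (x : DB b) : S.swap (S.inB b x) = ⟨b, x⟩ :=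
  S.swap.apply_symm_apply _

@[simp] theorem projB_inB (b : TotalSpace FB B) (x : DB b) : S.projB (S.inB b x) = b := by
  simp [projB]

theorem exists_inB {d : TotalSpace FDQ DQ} {b : TotalSpace FB B} (h : S.projB d = b) :
    ∃ x : DB b, d = S.inB b x := by
  obtain ⟨x, hx⟩ := exists_eq_mk_of_proj_eq h
  exact ⟨x, S.swap.injective (hx.trans (S.swap_inB b x).symm)⟩

theorem inB_injective (b : TotalSpace FB B) : Function.Injective (S.inB b) := fun x y h => by
  simpa using congrArg S.swap h

section FibresOverB

variable [∀ b, AddCommGroup (DB b)]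

@[simp] theorem addB_inB (b : TotalSpace FB B) (x y : DB b) :
    S.addB (S.inB b x) (S.inB b y) = S.inB b (x + y) := by
  simp [addB, inB]

theorem zeroB_eq_inB (b : TotalSpace FB B) : S.zeroB b = S.inB b 0 := rfl

variable [∀ b, Module ℝ (DB b)]

@[simp] theorem smulB_inB (r : ℝ) (b : TotalSpace FB B) (x : DB b) :
    S.smulB r (S.inB b x) = S.inB b (r • x) := by
  simp [smulB, inB]

theorem smulB_zero (d : TotalSpace FDQ DQ) : S.smulB 0 d = S.zeroB (S.projB d) :=
  congrArg (fun x => S.inB (S.projB d) x) (zero_smul ℝ (S.swap d).2)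

open Classical in
@[simp] theorem pairing_inB (g : ∀ b : TotalSpace FB B, DB b →L[ℝ] DB b →L[ℝ] ℝ)
    (b : TotalSpace FB B) (x y : DB b) : S.pairing g (S.inB b x) (S.inB b y) = g b x y := by
  have h (u v : TotalSpace FDB DB) (hu : u = ⟨b, x⟩) (hv : v = ⟨b, y⟩) :
      (if h : u.proj = v.proj then g v.proj (h ▸ u.2) v.2 else 0) = g b x y := by
    subst hu hv
    simp
  exact h _ _ (S.swap_inB b x) (S.swap_inB b y)

end FibresOverB

section FibresOverQ

variable [∀ q, AddCommGroup (DQ q)]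

@[simp] theorem addQ_mk (q : TotalSpace FQ Q) (x y : DQ q) :
    S.addQ ⟨q, x⟩ ⟨q, y⟩ = ⟨q, x + y⟩ := Bundle.TotalSpace.fadd_mk q x y

theorem addQ_zeroQ {d : TotalSpace FDQ DQ} {q : TotalSpace FQ Q} (h : S.projQ d = q) :
    S.addQ d (S.zeroQ q) = d := by
  obtain ⟨x, rfl⟩ := exists_eq_mk_of_proj_eq h
  exact (S.addQ_mk q x 0).trans (congrArg _ (add_zero x))

theorem zeroQ_addQ {d : TotalSpace FDQ DQ} {q : TotalSpace FQ Q} (h : S.projQ d = q) :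
    S.addQ (S.zeroQ q) d = d := by
  obtain ⟨x, rfl⟩ := exists_eq_mk_of_proj_eq h
  exact (S.addQ_mk q 0 x).trans (congrArg _ (zero_add x))

variable [∀ q, Module ℝ (DQ q)]

@[simp] theorem smulQ_mk (r : ℝ) (q : TotalSpace FQ Q) (x : DQ q) :
    S.smulQ r ⟨q, x⟩ = ⟨q, r • x⟩ := rfl

theorem smulQ_zero (d : TotalSpace FDQ DQ) : S.smulQ 0 d = S.zeroQ (S.projQ d) :=
  congrArg (TotalSpace.mk d.proj) (zero_smul ℝ d.2)

end FibresOverQ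

end DoubleBundleSquare

variable [∀ m, AddCommGroup (Q m)] [∀ m, Module ℝ (Q m)]
  [∀ m, AddCommGroup (B m)] [∀ m, Module ℝ (B m)]
  [∀ q, AddCommGroup (DQ q)] [∀ q, Module ℝ (DQ q)]
  [∀ b, AddCommGroup (DB b)] [∀ b, Module ℝ (DB b)]

namespace DoubleBundleSquare

variable {S : DoubleBundleSquare E FQ Q FB B FDQ DQ FDB DB}

namespace IsDoubleVectorBundle

variable (H : S.IsDoubleVectorBundle)
include H

theorem projB_zeroQ (m : M) (q : Q m) : S.projB (S.zeroQ ⟨m, q⟩) = ⟨m, 0⟩ := by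
  obtain ⟨b, hb⟩ := exists_eq_mk_of_proj_eq (H.proj_comm (S.zeroQ ⟨m, q⟩)).symm
  have h := H.projB_smulQ 0 (S.zeroQ ⟨m, q⟩)
  rwa [smulQ_zero, hb, Bundle.TotalSpace.fsmul_mk, zero_smul] at h

theorem projQ_zeroB (m : M) (b : B m) : S.projQ (S.zeroB ⟨m, b⟩) = ⟨m, 0⟩ := by
  have hB : S.projB (S.zeroB ⟨m, b⟩) = ⟨m, b⟩ := S.projB_inB _ _
  have hm : (S.projQ (S.zeroB ⟨m, b⟩)).proj = m := by rw [H.proj_comm, hB]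
  obtain ⟨q, hq⟩ := exists_eq_mk_of_proj_eq hm
  have h := H.projQ_smulB 0 (S.zeroB ⟨m, b⟩)
  rwa [smulB_zero, hB, hq, Bundle.TotalSpace.fsmul_mk, zero_smul, ← hq] at h

theorem addB_zeroQ (m : M) (q q' : Q m) :
    S.addB (S.zeroQ ⟨m, q⟩) (S.zeroQ ⟨m, q'⟩) = S.zeroQ ⟨m, q + q'⟩ := by
  have hB := (H.projB_zeroQ m q).trans (H.projB_zeroQ m q').symm
  have h := H.addB_smulQ 0 _ _ hB
  rw [smulQ_zero, smulQ_zero, smulQ_zero, H.projQ_addB _ _ hB] at h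
  exact h.trans (congrArg S.zeroQ (Bundle.TotalSpace.fadd_mk m q q'))

theorem smulB_zeroQ (m : M) (r : ℝ) (q : Q m) :
    S.smulB r (S.zeroQ ⟨m, q⟩) = S.zeroQ ⟨m, r • q⟩ := by
  have h := H.smulB_smulQ r 0 (S.zeroQ ⟨m, q⟩)
  rwa [smulQ_zero, smulQ_zero, H.projQ_smulB] at h

theorem zeroQ_zero (m : M) : S.zeroQ ⟨m, 0⟩ = S.zeroB ⟨m, 0⟩ := by
  have h := H.smulB_zeroQ m 0 0
  rwa [smulB_zero, H.projB_zeroQ, smul_zero, eq_comm] at h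

/-- The Eckmann–Hilton argument: the two additions have the same zero and interchange. -/
theorem addB_eq_addQ_of_core {m : M} {c c' : TotalSpace FDQ DQ} (hc : S.projQ c = ⟨m, 0⟩)
    (hc' : S.projQ c' = ⟨m, 0⟩) (hb : S.projB c = ⟨m, 0⟩) (hb' : S.projB c' = ⟨m, 0⟩) :
    S.addB c c' = S.addQ c c' := by
  have h0 := H.projB_zeroQ m 0
  have h := H.addB_addQ c (S.zeroQ ⟨m, 0⟩) (S.zeroQ ⟨m, 0⟩) c' hc hc'.symm
    (hb.trans h0.symm) (h0.trans hb'.symm)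
  obtain ⟨x, rfl⟩ := S.exists_inB hb
  obtain ⟨x', rfl⟩ := S.exists_inB hb'
  rw [S.addQ_zeroQ hc, S.zeroQ_addQ hc', H.zeroQ_zero, zeroB_eq_inB] at h
  simpa using h

end IsDoubleVectorBundle

end DoubleBundleSquare

namespace MetricDoubleVectorBundle

variable [VectorBundle ℝ FDB DB]
  (𝔼 : MetricDoubleVectorBundle E FQ Q FB B FDQ DQ FDB DB)

theorem mk_vectorAt_projQ_inB (b : TotalSpace FB B) (x : DB b) :
    (⟨b.proj, vectorAt b.proj (𝔼.projQ (𝔼.inB b x))⟩ : TotalSpace FQ Q) =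
      𝔼.projQ (𝔼.inB b x) :=
  mk_vectorAt (by rw [𝔼.isDoubleVectorBundle.proj_comm, 𝔼.projB_inB])

/-- The projection `D → Q` on the fibre of `D → B` over `b`. -/
def fiberQ (b : TotalSpace FB B) : DB b →ₗ[ℝ] Q b.proj where
  toFun x := vectorAt b.proj (𝔼.projQ (𝔼.inB b x))
  map_add' x y := by
    refine TotalSpace.mk_injective (F := FQ) b.proj ?_
    rw [mk_vectorAt_projQ_inB, ← Bundle.TotalSpace.fadd_mk, mk_vectorAt_projQ_inB,
      mk_vectorAt_projQ_inB, ← 𝔼.addB_inB, 𝔼.isDoubleVectorBundle.projQ_addB _ _ (by simp)]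
  map_smul' r x := by
    refine TotalSpace.mk_injective (F := FQ) b.proj ?_
    rw [RingHom.id_apply, mk_vectorAt_projQ_inB, ← Bundle.TotalSpace.fsmul_mk,
      mk_vectorAt_projQ_inB, ← 𝔼.smulB_inB, 𝔼.isDoubleVectorBundle.projQ_smulB]

@[simp] theorem projQ_inB (b : TotalSpace FB B) (x : DB b) :
    𝔼.projQ (𝔼.inB b x) = ⟨b.proj, 𝔼.fiberQ b x⟩ := (𝔼.mk_vectorAt_projQ_inB b x).symm

theorem fiberQ_eq_iff {m : M} {b : B m} {x : DB ⟨m, b⟩} {q : Q m} :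
    𝔼.fiberQ ⟨m, b⟩ x = q ↔ 𝔼.projQ (𝔼.inB ⟨m, b⟩ x) = ⟨m, q⟩ := by
  simp

theorem inB_vectorAt_zeroQ (m : M) (q : Q m) :
    𝔼.inB ⟨m, 0⟩ (vectorAt ⟨m, 0⟩ (𝔼.swap (𝔼.zeroQ ⟨m, q⟩))) = 𝔼.zeroQ ⟨m, q⟩ := by
  rw [DoubleBundleSquare.inB, mk_vectorAt (𝔼.isDoubleVectorBundle.projB_zeroQ m q)]
  exact 𝔼.swap.symm_apply_apply _

/-- The zero of the fibre of `D → Q` over `q`, as a vector of the fibre of `D → B` over zero. -/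
def zeroVec (m : M) : Q m →ₗ[ℝ] DB ⟨m, 0⟩ where
  toFun q := vectorAt ⟨m, 0⟩ (𝔼.swap (𝔼.zeroQ ⟨m, q⟩))
  map_add' q q' := by
    apply 𝔼.inB_injective
    rw [← 𝔼.addB_inB, inB_vectorAt_zeroQ, inB_vectorAt_zeroQ, inB_vectorAt_zeroQ,
      𝔼.isDoubleVectorBundle.addB_zeroQ]
  map_smul' r q := by
    apply 𝔼.inB_injective
    rw [RingHom.id_apply, ← 𝔼.smulB_inB, inB_vectorAt_zeroQ, inB_vectorAt_zeroQ,
      𝔼.isDoubleVectorBundle.smulB_zeroQ]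

theorem inB_zeroVec (m : M) (q : Q m) : 𝔼.inB ⟨m, 0⟩ (𝔼.zeroVec m q) = 𝔼.zeroQ ⟨m, q⟩ :=
  𝔼.inB_vectorAt_zeroQ m q

@[simp] theorem fiberQ_zeroVec (m : M) (q : Q m) : 𝔼.fiberQ ⟨m, 0⟩ (𝔼.zeroVec m q) = q := by
  rw [fiberQ_eq_iff, inB_zeroVec]
  rfl

theorem metric_zeroVec (m : M) (q q' : Q m) :
    𝔼.metric ⟨m, 0⟩ (𝔼.zeroVec m q) (𝔼.zeroVec m q') = 0 := by
  have H := 𝔼.isDoubleVectorBundle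
  have h := 𝔼.metric_smulQ 0 (𝔼.zeroQ ⟨m, q⟩) (𝔼.zeroQ ⟨m, q'⟩)
    ((H.projB_zeroQ m q).trans (H.projB_zeroQ m q').symm)
  rw [← 𝔼.pairing_inB, inB_zeroVec, inB_zeroVec]
  simpa [DoubleBundleSquare.zeroQ] using h

theorem metric_core {m : M} {c c' : DB ⟨m, 0⟩} (hc : 𝔼.fiberQ ⟨m, 0⟩ c = 0)
    (hc' : 𝔼.fiberQ ⟨m, 0⟩ c' = 0) : 𝔼.metric ⟨m, 0⟩ c c' = 0 := by
  have inB_double {u : DB ⟨m, 0⟩} (hu : 𝔼.fiberQ ⟨m, 0⟩ u = 0) :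
      𝔼.inB ⟨m, 0⟩ (u + u) = 𝔼.addQ (𝔼.inB ⟨m, 0⟩ u) (𝔼.inB ⟨m, 0⟩ u) := by
    rw [fiberQ_eq_iff] at hu
    rw [← 𝔼.addB_inB]
    exact 𝔼.isDoubleVectorBundle.addB_eq_addQ_of_core hu hu (by simp) (by simp)
  have h : 𝔼.metric ⟨m, 0⟩ (c + c) (c' + c') =
      𝔼.metric ⟨m, 0⟩ c c' + 𝔼.metric ⟨m, 0⟩ c c' := by
    rw [← 𝔼.pairing_inB, inB_double hc, inB_double hc',
      𝔼.metric_addQ _ _ _ _ rfl rfl (by simp) (by simp), 𝔼.pairing_inB]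
  simp only [map_add, add_apply] at h
  linarith

theorem exists_core_of_fiberQ_eq_zero {m : M} {b : B m} {k : DB ⟨m, b⟩}
    (hk : 𝔼.fiberQ ⟨m, b⟩ k = 0) : ∃ c : DB ⟨m, 0⟩, 𝔼.fiberQ ⟨m, 0⟩ c = 0 ∧
      𝔼.inB ⟨m, b⟩ k = 𝔼.addQ (𝔼.zeroB ⟨m, b⟩) (𝔼.inB ⟨m, 0⟩ c) := by
  have H := 𝔼.isDoubleVectorBundle
  obtain ⟨z, hz⟩ := exists_eq_mk_of_proj_eq (H.projQ_zeroB m b)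
  obtain ⟨v, hv⟩ := exists_eq_mk_of_proj_eq (𝔼.fiberQ_eq_iff.1 hk)
  have hB : 𝔼.projB (𝔼.addQ (𝔼.inB ⟨m, b⟩ k) (𝔼.smulQ (-1) (𝔼.zeroB ⟨m, b⟩))) = ⟨m, 0⟩ := by
    have hQ : 𝔼.projQ (𝔼.inB ⟨m, b⟩ k) = 𝔼.projQ (𝔼.smulQ (-1) (𝔼.zeroB ⟨m, b⟩)) := by
      rw [hv, hz]
      rfl
    rw [H.projB_addQ _ _ hQ, H.projB_smulQ, 𝔼.zeroB_eq_inB, 𝔼.projB_inB, 𝔼.projB_inB]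
    simp
  obtain ⟨c, hc⟩ := 𝔼.exists_inB hB
  rw [hv, hz, 𝔼.smulQ_mk, 𝔼.addQ_mk] at hc
  refine ⟨c, 𝔼.fiberQ_eq_iff.2 (by rw [← hc]; rfl), ?_⟩
  rw [← hc, hv, hz, 𝔼.addQ_mk]
  simp

theorem metric_ker_fiberQ {m : M} {b : B m} {k k' : DB ⟨m, b⟩} (hk : 𝔼.fiberQ ⟨m, b⟩ k = 0)
    (hk' : 𝔼.fiberQ ⟨m, b⟩ k' = 0) : 𝔼.metric ⟨m, b⟩ k k' = 0 := by
  have H := 𝔼.isDoubleVectorBundle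
  obtain ⟨c, hc, hck⟩ := 𝔼.exists_core_of_fiberQ_eq_zero hk
  obtain ⟨c', hc', hck'⟩ := 𝔼.exists_core_of_fiberQ_eq_zero hk'
  have hQ {u : DB ⟨m, 0⟩} (hu : 𝔼.fiberQ ⟨m, 0⟩ u = 0) :
      𝔼.projQ (𝔼.zeroB ⟨m, b⟩) = 𝔼.projQ (𝔼.inB ⟨m, 0⟩ u) := by
    rw [H.projQ_zeroB, 𝔼.fiberQ_eq_iff.1 hu]
  rw [← 𝔼.pairing_inB, hck, hck', 𝔼.metric_addQ _ _ _ _ (hQ hc) (hQ hc') rfl (by simp),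
    𝔼.zeroB_eq_inB, 𝔼.pairing_inB, 𝔼.pairing_inB, 𝔼.metric_core hc hc']
  simp

/-- The metric as a bilinear form on a fibre of `D → B`. -/
def bilin (b : TotalSpace FB B) : LinearMap.BilinForm ℝ (DB b) :=
  LinearMap.mk₂ ℝ (fun x y => 𝔼.metric b x y) (by simp) (by simp) (by simp) (by simp)

theorem bilin_nondegenerate (b : TotalSpace FB B) : (𝔼.bilin b).Nondegenerate :=
  ⟨𝔼.metric_nondegenerate b, fun x h => 𝔼.metric_nondegenerate b x fun y =>
    (𝔼.metric_symm b x y).trans (h y)⟩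

end MetricDoubleVectorBundle

section CoreVectors

namespace MetricDoubleVectorBundle

variable [VectorBundle ℝ FDB DB]
  (𝔼 : MetricDoubleVectorBundle E FQ Q FB B FDQ DQ FDB DB)

variable {EN : Type*} [NormedAddCommGroup EN] [NormedSpace ℝ EN]
  {HN : Type*} [TopologicalSpace HN] {IN : ModelWithCorners ℝ EN HN}
  {N : Type*} [TopologicalSpace N] [ChartedSpace HN N] {x₀ : N} {β : N → TotalSpace FB B}

theorem contMDiffAt_inB_iff {x : ∀ y, DB (β y)} :
    ContMDiffAt IN ((𝓘(ℝ, E).prod 𝓘(ℝ, FQ)).prod 𝓘(ℝ, FDQ)) ∞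
      (fun y => 𝔼.inB (β y) (x y)) x₀ ↔
    ContMDiffAt IN ((𝓘(ℝ, E).prod 𝓘(ℝ, FB)).prod 𝓘(ℝ, FDB)) ∞
      (fun y => (⟨β y, x y⟩ : TotalSpace FDB DB)) x₀ := by
  refine ⟨fun h => ?_, fun h => 𝔼.swap.symm.contMDiff.contMDiffAt.comp x₀ h⟩
  simpa only [Function.comp_def, DoubleBundleSquare.swap_inB] using
    𝔼.swap.contMDiff.contMDiffAt.comp x₀ h

theorem contMDiffAt_fiberQ {x : ∀ y, DB (β y)}
    (hx : ContMDiffAt IN ((𝓘(ℝ, E).prod 𝓘(ℝ, FB)).prod 𝓘(ℝ, FDB)) ∞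
      (fun y => (⟨β y, x y⟩ : TotalSpace FDB DB)) x₀) :
    ContMDiffAt IN (𝓘(ℝ, E).prod 𝓘(ℝ, FQ)) ∞
      (fun y => (⟨(β y).proj, 𝔼.fiberQ (β y) (x y)⟩ : TotalSpace FQ Q)) x₀ := by
  refine ((contMDiff_proj DQ).contMDiffAt.comp x₀
    (𝔼.contMDiffAt_inB_iff.2 hx)).congr_of_eventuallyEq ?_
  exact Filter.Eventually.of_forall fun y => (𝔼.projQ_inB (β y) (x y)).symm

theorem contMDiffAt_metric {x x' : ∀ y, DB (β y)}
    (hx : ContMDiffAt IN ((𝓘(ℝ, E).prod 𝓘(ℝ, FB)).prod 𝓘(ℝ, FDB)) ∞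
      (fun y => (⟨β y, x y⟩ : TotalSpace FDB DB)) x₀)
    (hx' : ContMDiffAt IN ((𝓘(ℝ, E).prod 𝓘(ℝ, FB)).prod 𝓘(ℝ, FDB)) ∞
      (fun y => (⟨β y, x' y⟩ : TotalSpace FDB DB)) x₀) :
    ContMDiffAt IN 𝓘(ℝ, ℝ) ∞ (fun y => 𝔼.metric (β y) (x y) (x' y)) x₀ := by
  have hg := 𝔼.metric_smooth.contMDiffAt.comp x₀ (contMDiffAt_proj_along hx)
  exact (contMDiffAt_totalSpace.1 (ContMDiffAt.clm_bundle_apply₂ (F₁ := FDB) (F₂ := FDB)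
    (F₃ := ℝ) (E₃ := Bundle.Trivial (TotalSpace FB B) ℝ) hg hx hx')).2

variable [FiniteDimensional ℝ FDB]

theorem two_mul_finrank_ker_fiberQ_le (b : TotalSpace FB B) :
    2 * Module.finrank ℝ (LinearMap.ker (𝔼.fiberQ b)) ≤ Module.finrank ℝ FDB := by
  have := VectorBundle.finiteDimensional ℝ FDB DB b
  rw [← VectorBundle.finrank_eq ℝ FDB DB b]
  exact two_mul_finrank_le_of_isotropic (𝔼.bilin_nondegenerate b) _
    fun x hx y hy => 𝔼.metric_ker_fiberQ (b := b.2) hx hy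

/-- The vector of the fibre of `D → B` over `b` that represents the pullback of a linear form on the
fibre of `Q`. -/
def coreVec (b : TotalSpace FB B) : (Q b.proj →ₗ[ℝ] ℝ) →ₗ[ℝ] DB b :=
  haveI := VectorBundle.finiteDimensional ℝ FDB DB b
  ((𝔼.bilin b).toDual (𝔼.bilin_nondegenerate b)).symm.toLinearMap ∘ₗ
    LinearMap.lcomp ℝ ℝ (𝔼.fiberQ b)

@[simp] theorem metric_coreVec (b : TotalSpace FB B) (τ : Q b.proj →ₗ[ℝ] ℝ) (x : DB b) :
    𝔼.metric b (𝔼.coreVec b τ) x = τ (𝔼.fiberQ b x) := by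
  have := VectorBundle.finiteDimensional ℝ FDB DB b
  exact LinearMap.BilinForm.apply_toDual_symm_apply (hB := 𝔼.bilin_nondegenerate b) _ x

theorem eq_coreVec {b : TotalSpace FB B} {τ : Q b.proj →ₗ[ℝ] ℝ} {k : DB b}
    (h : ∀ x, 𝔼.metric b k x = τ (𝔼.fiberQ b x)) : k = 𝔼.coreVec b τ := by
  refine sub_eq_zero.1 (𝔼.metric_nondegenerate b _ fun x => ?_)
  simp [h]

section Rank

variable [VectorBundle ℝ FQ Q]

include 𝔼 in
theorem two_mul_finrank_le (m : M) : 2 * Module.finrank ℝ FQ ≤ Module.finrank ℝ FDB := by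
  have := VectorBundle.finiteDimensional ℝ FDB DB ⟨m, 0⟩
  have hinj : Function.Injective (𝔼.zeroVec m) :=
    Function.LeftInverse.injective (𝔼.fiberQ_zeroVec m)
  rw [← VectorBundle.finrank_eq ℝ FQ Q m, ← LinearMap.finrank_range_of_inj hinj,
    ← VectorBundle.finrank_eq ℝ FDB DB ⟨m, 0⟩]
  refine two_mul_finrank_le_of_isotropic (𝔼.bilin_nondegenerate ⟨m, 0⟩) _ ?_
  rintro _ ⟨q, rfl⟩ _ ⟨q', rfl⟩
  exact 𝔼.metric_zeroVec m q q'

variable [FiniteDimensional ℝ FQ]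

theorem finrank_range_fiberQ (b : TotalSpace FB B) :
    Module.finrank ℝ (LinearMap.range (𝔼.fiberQ b)) = Module.finrank ℝ FQ := by
  have := VectorBundle.finiteDimensional ℝ FDB DB b
  have := VectorBundle.finiteDimensional ℝ FQ Q b.proj
  have hrank := LinearMap.finrank_range_add_finrank_ker (𝔼.fiberQ b)
  have hrange := Submodule.finrank_le (LinearMap.range (𝔼.fiberQ b))
  have hker := 𝔼.two_mul_finrank_ker_fiberQ_le b
  have hzero := 𝔼.two_mul_finrank_le b.proj
  rw [VectorBundle.finrank_eq ℝ FDB DB] at hrank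
  rw [VectorBundle.finrank_eq ℝ FQ Q] at hrange
  omega

theorem fiberQ_surjective (b : TotalSpace FB B) : Function.Surjective (𝔼.fiberQ b) := by
  have := VectorBundle.finiteDimensional ℝ FQ Q b.proj
  refine LinearMap.range_eq_top.1 (Submodule.eq_top_of_finrank_eq ?_)
  rw [𝔼.finrank_range_fiberQ, VectorBundle.finrank_eq ℝ FQ Q]

theorem orthogonal_ker_fiberQ (b : TotalSpace FB B) :
    (𝔼.bilin b).orthogonal (LinearMap.ker (𝔼.fiberQ b)) = LinearMap.ker (𝔼.fiberQ b) := by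
  have := VectorBundle.finiteDimensional ℝ FDB DB b
  have hle : LinearMap.ker (𝔼.fiberQ b) ≤
      (𝔼.bilin b).orthogonal (LinearMap.ker (𝔼.fiberQ b)) :=
    fun x hx y hy => 𝔼.metric_ker_fiberQ (b := b.2) hy hx
  refine (Submodule.eq_of_le_of_finrank_le hle ?_).symm
  have hrank := LinearMap.finrank_range_add_finrank_ker (𝔼.fiberQ b)
  have hrange := 𝔼.finrank_range_fiberQ b
  have hzero := 𝔼.two_mul_finrank_le b.proj
  rw [VectorBundle.finrank_eq ℝ FDB DB] at hrank
  rw [LinearMap.BilinForm.finrank_orthogonal (𝔼.bilin_nondegenerate b),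
    VectorBundle.finrank_eq ℝ FDB DB]
  omega

@[simp] theorem fiberQ_coreVec (b : TotalSpace FB B) (τ : Q b.proj →ₗ[ℝ] ℝ) :
    𝔼.fiberQ b (𝔼.coreVec b τ) = 0 := by
  rw [← LinearMap.mem_ker, ← orthogonal_ker_fiberQ]
  intro y hy
  change 𝔼.metric b y _ = 0
  rw [𝔼.metric_symm, metric_coreVec, LinearMap.mem_ker.1 hy, map_zero]

end Rank

/-- The metric in a trivialization of `D → B`. -/
def metricCoord (e : Trivialization FDB (π FDB DB)) [MemTrivializationAtlas e]
    (b : TotalSpace FB B) : FDB →L[ℝ] FDB →L[ℝ] ℝ :=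
  LinearMap.toContinuousLinearMap ((LinearMap.toContinuousLinearMap (𝕜 := ℝ) (E := FDB)
    (F' := ℝ)).toLinearMap ∘ₗ (𝔼.bilin b).compl₁₂ (e.symmₗ ℝ b) (e.symmₗ ℝ b))

theorem metricCoord_apply (e : Trivialization FDB (π FDB DB)) [MemTrivializationAtlas e]
    (b : TotalSpace FB B) (v w : FDB) :
    𝔼.metricCoord e b v w = 𝔼.metric b (e.symmₗ ℝ b v) (e.symmₗ ℝ b w) := rfl

theorem exists_equiv_eq_metricCoord (e : Trivialization FDB (π FDB DB))
    [MemTrivializationAtlas e] {b : TotalSpace FB B} (hb : b ∈ e.baseSet) :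
    ∃ L : FDB ≃L[ℝ] (FDB →L[ℝ] ℝ), 𝔼.metricCoord e b = L := by
  have hinj : Function.Injective (𝔼.metricCoord e b) := by
    refine (injective_iff_map_eq_zero _).2 fun v hv => ?_
    have h0 : e.symmₗ ℝ b v = 0 := by
      refine 𝔼.metric_nondegenerate b _ fun x => ?_
      rw [← e.symmₗ_linearMapAt hb x (R := ℝ), ← metricCoord_apply, hv, zero_apply]
    rw [← e.linearMapAt_symmₗ hb v (R := ℝ), h0, map_zero]
  have hrank : Module.finrank ℝ FDB = Module.finrank ℝ (FDB →L[ℝ] ℝ) := by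
    rw [← LinearMap.toContinuousLinearMap.finrank_eq]
    exact Subspace.dual_finrank_eq.symm
  refine ⟨(LinearEquiv.ofInjectiveOfFinrankEq (𝔼.metricCoord e b).toLinearMap hinj
    hrank).toContinuousLinearEquiv, ?_⟩
  ext v w
  rfl

variable [ContMDiffVectorBundle ∞ FDB DB (𝓘(ℝ, E).prod 𝓘(ℝ, FB))]

theorem contMDiffAt_of_metric (hβ : ContMDiffAt IN (𝓘(ℝ, E).prod 𝓘(ℝ, FB)) ∞ β x₀)
    {x : ∀ y, DB (β y)}
    (hx : ∀ t : ∀ y, DB (β y), ContMDiffAt IN ((𝓘(ℝ, E).prod 𝓘(ℝ, FB)).prod 𝓘(ℝ, FDB)) ∞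
      (fun y => (⟨β y, t y⟩ : TotalSpace FDB DB)) x₀ →
      ContMDiffAt IN 𝓘(ℝ, ℝ) ∞ (fun y => 𝔼.metric (β y) (x y) (t y)) x₀) :
    ContMDiffAt IN ((𝓘(ℝ, E).prod 𝓘(ℝ, FB)).prod 𝓘(ℝ, FDB)) ∞
      (fun y => (⟨β y, x y⟩ : TotalSpace FDB DB)) x₀ := by
  let e := trivializationAt FDB DB (β x₀)
  have he : β x₀ ∈ e.baseSet := mem_baseSet_trivializationAt FDB DB (β x₀)
  have hframe (w : FDB) : ContMDiffAt IN ((𝓘(ℝ, E).prod 𝓘(ℝ, FB)).prod 𝓘(ℝ, FDB)) ∞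
      (fun y => (⟨β y, e.symmₗ ℝ (β y) w⟩ : TotalSpace FDB DB)) x₀ :=
    contMDiffAt_symmₗ_along e hβ contMDiffAt_const he
  have hmetric : ContMDiffAt IN 𝓘(ℝ, FDB →L[ℝ] FDB →L[ℝ] ℝ) ∞
      (fun y => 𝔼.metricCoord e (β y)) x₀ :=
    contMDiffAt_clm_of_apply fun v => contMDiffAt_clm_of_apply fun w =>
      𝔼.contMDiffAt_metric (hframe v) (hframe w)
  obtain ⟨L, hL⟩ := 𝔼.exists_equiv_eq_metricCoord e he
  refine contMDiffAt_totalSpace.2 ⟨hβ, contMDiffAt_of_clm_apply hmetric L hL ?_⟩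
  refine contMDiffAt_clm_of_apply fun w => (hx _ (hframe w)).congr_of_eventuallyEq ?_
  filter_upwards [hβ.continuousAt.eventually_mem (e.open_baseSet.mem_nhds he)] with y hy
  have hsymm : e.symmₗ ℝ (β y) (e ⟨β y, x y⟩).2 = x y := by
    rw [e.symmₗ_apply hy]
    exact e.symm_apply_apply_mk hy _
  rw [metricCoord_apply, hsymm]

theorem contMDiffAt_coreVec (hβ : ContMDiffAt IN (𝓘(ℝ, E).prod 𝓘(ℝ, FB)) ∞ β x₀)
    {τ : ∀ y, Q (β y).proj →ₗ[ℝ] ℝ}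
    (hτ : ∀ s : ∀ y, Q (β y).proj, ContMDiffAt IN (𝓘(ℝ, E).prod 𝓘(ℝ, FQ)) ∞
      (fun y => (⟨(β y).proj, s y⟩ : TotalSpace FQ Q)) x₀ →
      ContMDiffAt IN 𝓘(ℝ, ℝ) ∞ (fun y => τ y (s y)) x₀) :
    ContMDiffAt IN ((𝓘(ℝ, E).prod 𝓘(ℝ, FB)).prod 𝓘(ℝ, FDB)) ∞
      (fun y => (⟨β y, 𝔼.coreVec (β y) (τ y)⟩ : TotalSpace FDB DB)) x₀ :=
  𝔼.contMDiffAt_of_metric hβ fun t ht => by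
    simpa only [metric_coreVec] using hτ _ (𝔼.contMDiffAt_fiberQ ht)

end MetricDoubleVectorBundle

end CoreVectors

/-! ### Isotropic lifts and Lagrangian splittings -/

section IsotropicFibres

namespace MetricDoubleVectorBundle

section Pointwise

variable [VectorBundle ℝ FDB DB]
  (𝔼 : MetricDoubleVectorBundle E FQ Q FB B FDQ DQ FDB DB)

/-- `χ` is a fibrewise linear section of `D → Q` over the single fibre `Q m`, with base vector `b`
and isotropic image: the value at `m` of an element of `𝒞(𝔼)`. -/
structure IsIsotropicAt (m : M) (χ : ∀ q : Q m, DQ ⟨m, q⟩) (b : B m) : Prop where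
  projB : ∀ q, 𝔼.projB ⟨⟨m, q⟩, χ q⟩ = ⟨m, b⟩
  map_add : ∀ q q', (⟨⟨m, q + q'⟩, χ (q + q')⟩ : TotalSpace FDQ DQ) =
    𝔼.addB ⟨⟨m, q⟩, χ q⟩ ⟨⟨m, q'⟩, χ q'⟩
  map_smul : ∀ (r : ℝ) q, (⟨⟨m, r • q⟩, χ (r • q)⟩ : TotalSpace FDQ DQ) =
    𝔼.smulB r ⟨⟨m, q⟩, χ q⟩
  isotropic : ∀ q q', 𝔼.pairing 𝔼.metric ⟨⟨m, q⟩, χ q⟩ ⟨⟨m, q'⟩, χ q'⟩ = 0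

variable {𝔼} {m : M} {χ χ' : ∀ q : Q m, DQ ⟨m, q⟩} {b b' : B m}

theorem IsIsotropicAt.of_linear (h : Q m →ₗ[ℝ] DB ⟨m, b⟩)
    (hχ : ∀ q, (⟨⟨m, q⟩, χ q⟩ : TotalSpace FDQ DQ) = 𝔼.inB ⟨m, b⟩ (h q))
    (hi : ∀ q q', 𝔼.metric ⟨m, b⟩ (h q) (h q') = 0) : 𝔼.IsIsotropicAt m χ b where
  projB q := by rw [hχ, 𝔼.projB_inB]
  map_add q q' := by rw [hχ, hχ, hχ, 𝔼.addB_inB, _root_.map_add]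
  map_smul r q := by rw [hχ, hχ, 𝔼.smulB_inB, _root_.map_smul]
  isotropic q q' := by rw [hχ, hχ, 𝔼.pairing_inB, hi]

theorem IsIsotropicAt.exists_linear (h : 𝔼.IsIsotropicAt m χ b) :
    ∃ f : Q m →ₗ[ℝ] DB ⟨m, b⟩,
      (∀ q, (⟨⟨m, q⟩, χ q⟩ : TotalSpace FDQ DQ) = 𝔼.inB ⟨m, b⟩ (f q)) ∧
      (∀ q, 𝔼.fiberQ ⟨m, b⟩ (f q) = q) ∧ ∀ q q', 𝔼.metric ⟨m, b⟩ (f q) (f q') = 0 := by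
  choose f hf using fun q => 𝔼.exists_inB (h.projB q)
  have f_add (q q' : Q m) : f (q + q') = f q + f q' :=
    𝔼.inB_injective _ <| by rw [← hf, h.map_add, hf, hf, 𝔼.addB_inB]
  have f_smul (r : ℝ) (q : Q m) : f (r • q) = r • f q :=
    𝔼.inB_injective _ <| by rw [← hf, h.map_smul, hf, 𝔼.smulB_inB]
  refine ⟨⟨⟨f, f_add⟩, f_smul⟩, hf, fun q => ?_, fun q q' => ?_⟩
  · exact 𝔼.fiberQ_eq_iff.2 (congrArg 𝔼.projQ (hf q)).symm
  · have hi := h.isotropic q q'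
    rwa [hf, hf, 𝔼.pairing_inB] at hi

theorem isIsotropicAt_zero : 𝔼.IsIsotropicAt m 0 0 :=
  .of_linear (𝔼.zeroVec m) (fun q => (𝔼.inB_zeroVec m q).symm) (𝔼.metric_zeroVec m)

theorem IsIsotropicAt.add (h : 𝔼.IsIsotropicAt m χ b) (h' : 𝔼.IsIsotropicAt m χ' b') :
    𝔼.IsIsotropicAt m (χ + χ') (b + b') := by
  have H := 𝔼.isDoubleVectorBundle
  have hadd q : (⟨⟨m, q⟩, (χ + χ') q⟩ : TotalSpace FDQ DQ) =
      𝔼.addQ ⟨⟨m, q⟩, χ q⟩ ⟨⟨m, q⟩, χ' q⟩ := (𝔼.addQ_mk _ _ _).symm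
  have hQ q : 𝔼.projQ ⟨⟨m, q⟩, χ q⟩ = 𝔼.projQ ⟨⟨m, q⟩, χ' q⟩ := rfl
  have hp q q' := (h.projB q).trans (h.projB q').symm
  have hp' q q' := (h'.projB q).trans (h'.projB q').symm
  refine ⟨fun q => ?_, fun q q' => ?_, fun r q => ?_, fun q q' => ?_⟩
  · rw [hadd, H.projB_addQ _ _ (hQ q), h.projB, h'.projB, Bundle.TotalSpace.fadd_mk]
  · rw [hadd, hadd, hadd, H.addB_addQ _ _ _ _ (hQ q) (hQ q') (hp q q') (hp' q q'), h.map_add,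
      h'.map_add]
  · rw [hadd, hadd, H.smulB_addQ _ _ _ (hQ q), h.map_smul, h'.map_smul]
  · rw [hadd, hadd, 𝔼.metric_addQ _ _ _ _ (hQ q) (hQ q') (hp q q') (hp' q q'), h.isotropic,
      h'.isotropic, add_zero]

theorem IsIsotropicAt.smul (r : ℝ) (h : 𝔼.IsIsotropicAt m χ b) :
    𝔼.IsIsotropicAt m (r • χ) (r • b) := by
  have H := 𝔼.isDoubleVectorBundle
  have hsmul q : (⟨⟨m, q⟩, (r • χ) q⟩ : TotalSpace FDQ DQ) =
      𝔼.smulQ r ⟨⟨m, q⟩, χ q⟩ := (𝔼.smulQ_mk _ _ _).symm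
  have hp q q' := (h.projB q).trans (h.projB q').symm
  refine ⟨fun q => ?_, fun q q' => ?_, fun s q => ?_, fun q q' => ?_⟩
  · rw [hsmul, H.projB_smulQ, h.projB, Bundle.TotalSpace.fsmul_mk]
  · rw [hsmul, hsmul, hsmul, H.addB_smulQ _ _ _ (hp q q'), h.map_add]
  · rw [hsmul, hsmul, H.smulB_smulQ, h.map_smul]
  · rw [hsmul, hsmul, 𝔼.metric_smulQ _ _ _ (hp q q'), h.isotropic, mul_zero]

variable (𝔼 m) in
/-- The fibre at `m` of the bundle whose sections are `𝒞(𝔼)`, as a space of pairs of a linear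
isotropic section over `Q m` and its base vector. -/
def isotropicFiber : Submodule ℝ ((∀ q : Q m, DQ ⟨m, q⟩) × B m) where
  carrier := {x | 𝔼.IsIsotropicAt m x.1 x.2}
  add_mem' h h' := h.add h'
  zero_mem' := isIsotropicAt_zero
  smul_mem' r _ h := h.smul r

theorem IsIsotropicAt.sum {κ : Type*} (A : Finset κ) {χ : κ → ∀ q : Q m, DQ ⟨m, q⟩}
    {b : κ → B m} (h : ∀ i ∈ A, 𝔼.IsIsotropicAt m (χ i) (b i)) :
    𝔼.IsIsotropicAt m (∑ i ∈ A, χ i) (∑ i ∈ A, b i) := by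
  have hmem : ∑ i ∈ A, (χ i, b i) ∈ 𝔼.isotropicFiber m := Submodule.sum_mem _ h
  rwa [← prod_mk_sum] at hmem

end Pointwise

section Sections

variable [VectorBundle ℝ FQ Q] [VectorBundle ℝ FB B] [VectorBundle ℝ FDQ DQ]
  [VectorBundle ℝ FDB DB] {𝔼 : MetricDoubleVectorBundle E FQ Q FB B FDQ DQ FDB DB} {U : Opens M}

theorem mem_isotropicSections_iff {χ : ∀ q : opensOver (F := FQ) Q U, DQ q} :
    χ ∈ 𝔼.isotropicSections U ↔
      χ ∈ smoothSections (𝓘(ℝ, E).prod 𝓘(ℝ, FQ)) FDQ DQ (opensOver Q U) ∧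
      ∃ b : ∀ m : U, B m, ∀ m : U, 𝔼.IsIsotropicAt m (fun q => χ ⟨⟨m, q⟩, m.2⟩) (b m) := by
  constructor
  · rintro ⟨⟨hs, b, -, hl⟩, hi⟩
    exact ⟨hs, b, fun m => ⟨hl.projB m, hl.map_add m, hl.map_smul m, hi m⟩⟩
  · rintro ⟨hs, b, hb⟩
    have hzero : ContMDiff 𝓘(ℝ, E) (𝓘(ℝ, E).prod 𝓘(ℝ, FQ)) ∞
        (fun m : U => (⟨⟨m, 0⟩, m.2⟩ : opensOver (F := FQ) Q U)) := by
      rw [← ContMDiff.subtypeVal_comp_iff]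
      exact (contMDiff_zeroSection ℝ Q).comp contMDiff_subtype_val
    have hsmooth : ContMDiff 𝓘(ℝ, E) (𝓘(ℝ, E).prod 𝓘(ℝ, FB)) ∞
        (fun m : U => (⟨m, b m⟩ : TotalSpace FB B)) :=
      ((contMDiff_proj (n := ∞) DB).comp (𝔼.swap.contMDiff.comp (hs.comp hzero))).congr
        fun m => ((hb m).projB 0).symm
    exact ⟨⟨hs, b, hsmooth, fun m => (hb m).projB, fun m => (hb m).map_add,
      fun m => (hb m).map_smul⟩, fun m => (hb m).isotropic⟩

theorem isIsotropicAt_section (χ : 𝔼.isotropicSections U) (m : U) :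
    𝔼.IsIsotropicAt m (fun q => χ.1 ⟨⟨m, q⟩, m.2⟩) ((𝔼.isotropicBase U χ).1 m) := by
  obtain ⟨-, b, hb⟩ := mem_isotropicSections_iff.1 χ.2
  have hbase : b m = (𝔼.isotropicBase U χ).1 m := by
    simpa using ((hb m).projB 0).symm.trans (𝔼.projB_sectionValue χ m 0)
  exact hbase ▸ hb m

end Sections

end MetricDoubleVectorBundle

end IsotropicFibres

section LocalLift

namespace MetricDoubleVectorBundle

variable [VectorBundle ℝ FDB DB] [FiniteDimensional ℝ FDB]
  (𝔼 : MetricDoubleVectorBundle E FQ Q FB B FDQ DQ FDB DB)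

/-- A linear right inverse `f` of the projection `D → Q` on a fibre of `D → B`, corrected by core
vectors so as to have isotropic image. -/
def isotropize {m : M} {b : B m} (f : Q m →ₗ[ℝ] DB ⟨m, b⟩) : Q m →ₗ[ℝ] DB ⟨m, b⟩ :=
  f - (1 / 2 : ℝ) • (𝔼.coreVec ⟨m, b⟩ ∘ₗ (𝔼.bilin ⟨m, b⟩).compl₁₂ f f)

section Pointwise

variable {m : M} {b : B m} {f : Q m →ₗ[ℝ] DB ⟨m, b⟩}

theorem isotropize_apply (q : Q m) : 𝔼.isotropize f q =
    f q - (1 / 2 : ℝ) • 𝔼.coreVec ⟨m, b⟩ ((𝔼.bilin ⟨m, b⟩).compl₁₂ f f q) := rfl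

variable [VectorBundle ℝ FQ Q] [FiniteDimensional ℝ FQ]

theorem fiberQ_isotropize (hf : ∀ q, 𝔼.fiberQ ⟨m, b⟩ (f q) = q) (q : Q m) :
    𝔼.fiberQ ⟨m, b⟩ (𝔼.isotropize f q) = q := by
  rw [isotropize_apply, map_sub, map_smul, fiberQ_coreVec, hf, smul_zero, sub_zero]

theorem metric_isotropize (hf : ∀ q, 𝔼.fiberQ ⟨m, b⟩ (f q) = q) (q q' : Q m) :
    𝔼.metric ⟨m, b⟩ (𝔼.isotropize f q) (𝔼.isotropize f q') = 0 := by
  have hcore (q q' : Q m) : 𝔼.metric ⟨m, b⟩ (𝔼.coreVec ⟨m, b⟩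
      ((𝔼.bilin ⟨m, b⟩).compl₁₂ f f q)) (f q') = 𝔼.metric ⟨m, b⟩ (f q) (f q') := by
    rw [metric_coreVec, hf]
    rfl
  have hcore' (q q' : Q m) : 𝔼.metric ⟨m, b⟩ (f q) (𝔼.coreVec ⟨m, b⟩
      ((𝔼.bilin ⟨m, b⟩).compl₁₂ f f q')) = 𝔼.metric ⟨m, b⟩ (f q) (f q') := by
    rw [𝔼.metric_symm, hcore, 𝔼.metric_symm]
  simp only [isotropize_apply, map_sub, map_smul, sub_apply, smul_apply, hcore, hcore',
    metric_coreVec, fiberQ_coreVec, map_zero, smul_eq_mul]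
  ring

end Pointwise

section Coordinates

variable [VectorBundle ℝ FQ Q]
  (eQ : Trivialization FQ (π FQ Q)) [MemTrivializationAtlas eQ]
  (e : Trivialization FDB (π FDB DB)) [MemTrivializationAtlas e]

/-- The projection `D → Q` on the fibres of `D → B`, in trivializations of `Q` and `D → B`. -/
def fiberQCoord (b : TotalSpace FB B) : FDB →L[ℝ] FQ :=
  LinearMap.toContinuousLinearMap (eQ.linearMapAt ℝ b.proj ∘ₗ 𝔼.fiberQ b ∘ₗ e.symmₗ ℝ b)

theorem fiberQCoord_apply (b : TotalSpace FB B) (v : FDB) :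
    𝔼.fiberQCoord eQ e b v = eQ.linearMapAt ℝ b.proj (𝔼.fiberQ b (e.symmₗ ℝ b v)) := rfl

theorem fiberQCoord_surjective [FiniteDimensional ℝ FQ] {b : TotalSpace FB B}
    (hQ : b.proj ∈ eQ.baseSet) (hb : b ∈ e.baseSet) :
    Function.Surjective (𝔼.fiberQCoord eQ e b) := by
  intro v
  obtain ⟨x, hx⟩ := 𝔼.fiberQ_surjective b (eQ.symmₗ ℝ b.proj v)
  refine ⟨e.linearMapAt ℝ b x, ?_⟩
  rw [fiberQCoord_apply, e.symmₗ_linearMapAt hb, hx, eQ.linearMapAt_symmₗ hQ]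

variable [ContMDiffVectorBundle ∞ FQ Q 𝓘(ℝ, E)]
  [ContMDiffVectorBundle ∞ FDB DB (𝓘(ℝ, E).prod 𝓘(ℝ, FB))]
  {s : ∀ m, B m} {m : M}

theorem contMDiffAt_fiberQCoord
    (hs : ContMDiffAt 𝓘(ℝ, E) (𝓘(ℝ, E).prod 𝓘(ℝ, FB)) ∞
      (fun m => (⟨m, s m⟩ : TotalSpace FB B)) m)
    (hQ : m ∈ eQ.baseSet) (hb : (⟨m, s m⟩ : TotalSpace FB B) ∈ e.baseSet) :
    ContMDiffAt 𝓘(ℝ, E) 𝓘(ℝ, FDB →L[ℝ] FQ) ∞ (fun m => 𝔼.fiberQCoord eQ e ⟨m, s m⟩) m :=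
  contMDiffAt_clm_of_apply fun _ => contMDiffAt_linearMapAt_along eQ
    (𝔼.contMDiffAt_fiberQ (contMDiffAt_symmₗ_along e hs contMDiffAt_const hb)) hQ

end Coordinates

variable [ContMDiffVectorBundle ∞ FDB DB (𝓘(ℝ, E).prod 𝓘(ℝ, FB))]

theorem contMDiffAt_isotropize {s : ∀ m, B m} {f : ∀ m, Q m →ₗ[ℝ] DB ⟨m, s m⟩} {m : M}
    (hf : ∀ q : Q m, ContMDiffAt (𝓘(ℝ, E).prod 𝓘(ℝ, FQ))
      ((𝓘(ℝ, E).prod 𝓘(ℝ, FB)).prod 𝓘(ℝ, FDB)) ∞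
      (fun x : TotalSpace FQ Q =>
        (⟨⟨x.proj, s x.proj⟩, f x.proj x.2⟩ : TotalSpace FDB DB)) ⟨m, q⟩) (q : Q m) :
    ContMDiffAt (𝓘(ℝ, E).prod 𝓘(ℝ, FQ)) ((𝓘(ℝ, E).prod 𝓘(ℝ, FB)).prod 𝓘(ℝ, FDB)) ∞
      (fun x : TotalSpace FQ Q =>
        (⟨⟨x.proj, s x.proj⟩, 𝔼.isotropize (f x.proj) x.2⟩ : TotalSpace FDB DB)) ⟨m, q⟩ := by
  have hcore := 𝔼.contMDiffAt_coreVec (contMDiffAt_proj_along (hf q))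
    (τ := fun x => (𝔼.bilin ⟨x.proj, s x.proj⟩).compl₁₂ (f x.proj) (f x.proj) x.2)
    fun y hy => 𝔼.contMDiffAt_metric (hf q)
      (ContMDiffAt.comp (⟨m, q⟩ : TotalSpace FQ Q) (hf (y ⟨m, q⟩)) hy)
  simpa only [isotropize_apply, sub_eq_add_neg, ← neg_smul] using
    contMDiffAt_add_along (hf q) (contMDiffAt_smul_along
      (contMDiffAt_const (c := (-(1 / 2) : ℝ))) hcore)

variable [VectorBundle ℝ FQ Q] [FiniteDimensional ℝ FQ]
  [ContMDiffVectorBundle ∞ FQ Q 𝓘(ℝ, E)]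

theorem exists_smooth_rightInverse_fiberQ (p : M) {s : ∀ m, B m}
    (hs : ∀ᶠ m in nhds p, ContMDiffAt 𝓘(ℝ, E) (𝓘(ℝ, E).prod 𝓘(ℝ, FB)) ∞
      (fun m => (⟨m, s m⟩ : TotalSpace FB B)) m) :
    ∃ f : ∀ m, Q m →ₗ[ℝ] DB ⟨m, s m⟩, ∀ᶠ m in nhds p,
      (∀ q, 𝔼.fiberQ ⟨m, s m⟩ (f m q) = q) ∧
      ∀ q : Q m, ContMDiffAt (𝓘(ℝ, E).prod 𝓘(ℝ, FQ))
        ((𝓘(ℝ, E).prod 𝓘(ℝ, FB)).prod 𝓘(ℝ, FDB)) ∞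
        (fun x : TotalSpace FQ Q =>
          (⟨⟨x.proj, s x.proj⟩, f x.proj x.2⟩ : TotalSpace FDB DB)) ⟨m, q⟩ := by
  let eQ := trivializationAt FQ Q p
  let e := trivializationAt FDB DB ⟨p, s p⟩
  have hQp : p ∈ eQ.baseSet := mem_baseSet_trivializationAt FQ Q p
  have hbp : (⟨p, s p⟩ : TotalSpace FB B) ∈ e.baseSet := mem_baseSet_trivializationAt FDB DB _
  have hQ : ∀ᶠ m in nhds p, m ∈ eQ.baseSet := eQ.open_baseSet.mem_nhds hQp
  have hb : ∀ᶠ m in nhds p, (⟨m, s m⟩ : TotalSpace FB B) ∈ e.baseSet :=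
    hs.self_of_nhds.continuousAt.eventually_mem (e.open_baseSet.mem_nhds hbp)
  have hP : ∀ᶠ m in nhds p, ContMDiffAt 𝓘(ℝ, E) 𝓘(ℝ, FDB →L[ℝ] FQ) ∞
      (fun m => 𝔼.fiberQCoord eQ e ⟨m, s m⟩) m := by
    filter_upwards [hs, hQ, hb] with m hsm hQm hbm
    exact 𝔼.contMDiffAt_fiberQCoord eQ e hsm hQm hbm
  obtain ⟨R, hR⟩ := exists_contMDiffAt_rightInverse hP (𝔼.fiberQCoord_surjective eQ e hQp hbp)
  refine ⟨fun m => e.symmₗ ℝ ⟨m, s m⟩ ∘ₗ (R m).toLinearMap ∘ₗ eQ.linearMapAt ℝ m, ?_⟩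
  filter_upwards [hs, hQ, hb, hR] with m hsm hQm hbm hRm
  refine ⟨fun q => ?_, fun q => ?_⟩
  · have hcoord := congrArg (eQ.symmₗ ℝ m) (hRm.2 (eQ.linearMapAt ℝ m q))
    rwa [fiberQCoord_apply, eQ.symmₗ_linearMapAt hQm, eQ.symmₗ_linearMapAt hQm] at hcoord
  · have hproj : ContMDiffAt (𝓘(ℝ, E).prod 𝓘(ℝ, FQ)) 𝓘(ℝ, E) ∞
        (TotalSpace.proj : TotalSpace FQ Q → M) ⟨m, q⟩ := contMDiffAt_proj Q
    have hcoord := contMDiffAt_linearMapAt_along eQ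
      (p := (TotalSpace.proj : TotalSpace FQ Q → M)) (s := fun x => x.2) (x₀ := ⟨m, q⟩)
      (IN := 𝓘(ℝ, E).prod 𝓘(ℝ, FQ)) contMDiffAt_id hQm
    exact contMDiffAt_symmₗ_along e (ContMDiffAt.comp (⟨m, q⟩ : TotalSpace FQ Q) hsm hproj)
      ((ContMDiffAt.comp (⟨m, q⟩ : TotalSpace FQ Q) hRm.1 hproj).clm_apply hcoord) hbm

theorem exists_local_lift (p : M) {s : ∀ m, B m}
    (hs : ∀ᶠ m in nhds p, ContMDiffAt 𝓘(ℝ, E) (𝓘(ℝ, E).prod 𝓘(ℝ, FB)) ∞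
      (fun m => (⟨m, s m⟩ : TotalSpace FB B)) m) :
    ∃ χ : ∀ q : TotalSpace FQ Q, DQ q, ∀ᶠ m in nhds p,
      𝔼.IsIsotropicAt m (fun q => χ ⟨m, q⟩) (s m) ∧
      ∀ q : Q m, ContMDiffAt (𝓘(ℝ, E).prod 𝓘(ℝ, FQ)) ((𝓘(ℝ, E).prod 𝓘(ℝ, FQ)).prod 𝓘(ℝ, FDQ)) ∞
        (fun q => (⟨q, χ q⟩ : TotalSpace FDQ DQ)) ⟨m, q⟩ := by
  obtain ⟨f, hf⟩ := 𝔼.exists_smooth_rightInverse_fiberQ p hs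
  let χ (q : TotalSpace FQ Q) : DQ q :=
    vectorAt q (𝔼.inB ⟨q.proj, s q.proj⟩ (𝔼.isotropize (f q.proj) q.2))
  have hχ {m : M} (hfm : ∀ q, 𝔼.fiberQ ⟨m, s m⟩ (f m q) = q) (q : Q m) :
      (⟨⟨m, q⟩, χ ⟨m, q⟩⟩ : TotalSpace FDQ DQ) =
        𝔼.inB ⟨m, s m⟩ (𝔼.isotropize (f m) q) :=
    mk_vectorAt (𝔼.fiberQ_eq_iff.1 (𝔼.fiberQ_isotropize hfm q))
  refine ⟨χ, ?_⟩
  filter_upwards [hf.eventually_nhds] with m hm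
  obtain ⟨hfm, hsmooth⟩ := hm.self_of_nhds
  refine ⟨.of_linear _ (hχ hfm) (𝔼.metric_isotropize hfm), fun q => ?_⟩
  refine (𝔼.contMDiffAt_inB_iff.2
    (𝔼.contMDiffAt_isotropize hsmooth q)).congr_of_eventuallyEq ?_
  filter_upwards [(FiberBundle.continuous_proj FQ Q).continuousAt.eventually hm] with x hx
  exact hχ hx.1 x.2

end MetricDoubleVectorBundle

end LocalLift

section GlobalSplitting

namespace MetricDoubleVectorBundle

variable [VectorBundle ℝ FDB DB]
  (𝔼 : MetricDoubleVectorBundle E FQ Q FB B FDQ DQ FDB DB)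

/-- The family `S` of linear maps is a Lagrangian splitting over the point `m`, smooth at the points
over `m`. -/
structure IsLagrangianAt (S : ∀ (m : M) (q : Q m), B m →ₗ[ℝ] DQ ⟨m, q⟩) (m : M) : Prop where
  isotropic : ∀ b, 𝔼.IsIsotropicAt m (fun q => S m q b) b
  smooth : ∀ q b, ContMDiffAt (𝓘(ℝ, E).prod 𝓘(ℝ, FQ × FB))
    ((𝓘(ℝ, E).prod 𝓘(ℝ, FQ)).prod 𝓘(ℝ, FDQ)) ∞
    (fun x : TotalSpace (FQ × FB) (Q ×ᵇ B) =>
      (⟨⟨x.proj, x.2.1⟩, S x.proj x.2.1 x.2.2⟩ : TotalSpace FDQ DQ)) ⟨m, (q, b)⟩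

variable {𝔼} in
/-- The Lagrangian splitting given by a family of linear maps. -/
def IsLagrangianAt.splitting {S : ∀ (m : M) (q : Q m), B m →ₗ[ℝ] DQ ⟨m, q⟩}
    (h : ∀ m, 𝔼.IsLagrangianAt S m) : 𝔼.LagrangianSplitting :=
  ⟨{  toFun := fun m q b => ⟨⟨m, q⟩, S m q b⟩
      smooth := fun x => (h x.proj).smooth x.2.1 x.2.2
      projQ := fun _ _ _ => rfl
      projB := fun m q b => ((h m).isotropic b).projB q
      add_right := fun m q b b' => by rw [(S m q).map_add, 𝔼.addQ_mk]
      smul_right := fun m r q b => by rw [(S m q).map_smul, 𝔼.smulQ_mk]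
      add_left := fun m q q' b => ((h m).isotropic b).map_add q q'
      smul_left := fun m r q b => ((h m).isotropic b).map_smul r q },
    fun m q q' b => ((h m).isotropic b).isotropic q q'⟩

variable {𝔼} in
theorem IsLagrangianAt.congr_of_eventuallyEq {S S' : ∀ (m : M) (q : Q m), B m →ₗ[ℝ] DQ ⟨m, q⟩}
    {m : M} (h : 𝔼.IsLagrangianAt S m) (hS : ∀ᶠ m' in nhds m, S' m' = S m') :
    𝔼.IsLagrangianAt S' m where
  isotropic := hS.self_of_nhds ▸ h.isotropic
  smooth q b := by
    refine (h.smooth q b).congr_of_eventuallyEq ?_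
    filter_upwards [(FiberBundle.continuous_proj (FQ × FB) (Q ×ᵇ B)).continuousAt.eventually hS]
      with x hx
    rw [hx]

variable [VectorBundle ℝ FDQ DQ]

theorem IsLagrangianAt.sum_partitionOfUnity {κ : Type*} [FiniteDimensional ℝ E]
    {ρ : SmoothPartitionOfUnity κ 𝓘(ℝ, E) M} {U : κ → Set M} (hρ : ρ.IsSubordinate U)
    {S : κ → ∀ (m : M) (q : Q m), B m →ₗ[ℝ] DQ ⟨m, q⟩}
    (hS : ∀ i, ∀ m ∈ U i, 𝔼.IsLagrangianAt (S i) m) (m : M) :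
    𝔼.IsLagrangianAt (fun m q => ∑ i ∈ ρ.finsupport m, ρ i m • S i m q) m := by
  refine ⟨fun b => ?_, fun q b => ?_⟩
  · have hsum := IsIsotropicAt.sum (𝔼 := 𝔼) (ρ.finsupport m) fun i hi =>
      ((hS i m (hρ i (subset_tsupport _ ((ρ.mem_finsupport m).1 hi)))).isotropic b).smul (ρ i m)
    rw [← Finset.sum_smul, ρ.sum_finsupport m (Set.mem_univ m), one_smul] at hsum
    convert hsum using 1
    ext q
    simp
  · have hproj : ContMDiffAt (𝓘(ℝ, E).prod 𝓘(ℝ, FQ × FB)) 𝓘(ℝ, E) ∞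
        (TotalSpace.proj : TotalSpace (FQ × FB) (Q ×ᵇ B) → M) ⟨m, (q, b)⟩ := contMDiffAt_proj _
    have hsum := contMDiffAt_sum_along (ρ.fintsupport m) (contMDiffAt_fst_along
      (contMDiffAt_id (x := (⟨m, (q, b)⟩ : TotalSpace (FQ × FB) (Q ×ᵇ B)))))
      fun i hi => contMDiffAt_smul_along
        (ContMDiffAt.comp (⟨m, (q, b)⟩ : TotalSpace (FQ × FB) (Q ×ᵇ B))
          (ρ i).contMDiff.contMDiffAt hproj)
        ((hS i m (hρ i ((ρ.mem_fintsupport_iff m i).1 hi))).smooth q b)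
    refine hsum.congr_of_eventuallyEq ?_
    filter_upwards [hproj.continuousAt.eventually (ρ.eventually_finsupport_subset m)] with y hy
    simp only [LinearMap.sum_apply, LinearMap.smul_apply]
    congr 1
    refine Finset.sum_subset hy fun i _ hi => ?_
    rw [ρ.mem_finsupport, Function.notMem_support] at hi
    rw [hi, zero_smul]

section Frame

variable [VectorBundle ℝ FB B] {κ : Type*} [Fintype κ]
  {e : Trivialization FB (π FB B)} [MemTrivializationAtlas e] {v : Module.Basis κ ℝ FB}
  {χ : κ → ∀ q : TotalSpace FQ Q, DQ q}

variable (e v χ) in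
/-- The family of linear maps over the base set of a trivialization that sends the `i`-th member of
the local frame of `B` to `χ i`. -/
def ofFrame (m : M) (q : Q m) : B m →ₗ[ℝ] DQ ⟨m, q⟩ :=
  ∑ i, (v.coord i ∘ₗ e.linearMapAt ℝ m).smulRight (χ i ⟨m, q⟩)

variable {m : M}

variable {𝔼} in
theorem IsLagrangianAt.ofFrame [FiniteDimensional ℝ FB] [ContMDiffVectorBundle ∞ FB B 𝓘(ℝ, E)]
    (hm : m ∈ e.baseSet)
    (hiso : ∀ i, 𝔼.IsIsotropicAt m (fun q => χ i ⟨m, q⟩) (e.symmₗ ℝ m (v i)))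
    (hχ : ∀ i (q : Q m), ContMDiffAt (𝓘(ℝ, E).prod 𝓘(ℝ, FQ))
      ((𝓘(ℝ, E).prod 𝓘(ℝ, FQ)).prod 𝓘(ℝ, FDQ)) ∞
      (fun q : TotalSpace FQ Q => (⟨q, χ i q⟩ : TotalSpace FDQ DQ)) ⟨m, q⟩) :
    𝔼.IsLagrangianAt (ofFrame e v χ) m := by
  refine ⟨fun b => ?_, fun q b => ?_⟩
  · have hsum := IsIsotropicAt.sum (𝔼 := 𝔼) Finset.univ
      (fun i _ => (hiso i).smul (v.coord i (e.linearMapAt ℝ m b)))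
    rw [sum_coord_smul_symmₗ v e hm b] at hsum
    convert hsum using 1
    ext q
    simp [MetricDoubleVectorBundle.ofFrame]
  · have hid := contMDiffAt_id (I := 𝓘(ℝ, E).prod 𝓘(ℝ, FQ × FB)) (n := ∞)
      (x := (⟨m, (q, b)⟩ : TotalSpace (FQ × FB) (Q ×ᵇ B)))
    have hfst := contMDiffAt_fst_along hid
    have hcoord := contMDiffAt_linearMapAt_along e (contMDiffAt_snd_along hid) hm
    simp only [MetricDoubleVectorBundle.ofFrame, LinearMap.sum_apply]
    exact contMDiffAt_sum_along Finset.univ hfst fun i _ =>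
      contMDiffAt_smul_along
        ((v.coord i).toContinuousLinearMap.contMDiff.contMDiffAt.comp _ hcoord)
        (ContMDiffAt.comp (⟨m, (q, b)⟩ : TotalSpace (FQ × FB) (Q ×ᵇ B)) (hχ i q) hfst)

end Frame

variable [VectorBundle ℝ FQ Q] [VectorBundle ℝ FB B]
  [FiniteDimensional ℝ FQ] [FiniteDimensional ℝ FB] [FiniteDimensional ℝ FDB]
  [ContMDiffVectorBundle ∞ FQ Q 𝓘(ℝ, E)] [ContMDiffVectorBundle ∞ FB B 𝓘(ℝ, E)]
  [ContMDiffVectorBundle ∞ FDB DB (𝓘(ℝ, E).prod 𝓘(ℝ, FB))]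

theorem exists_isLagrangianAt_nhds (p : M) :
    ∃ S : ∀ (m : M) (q : Q m), B m →ₗ[ℝ] DQ ⟨m, q⟩, ∀ᶠ m in nhds p, 𝔼.IsLagrangianAt S m := by
  let e := trivializationAt FB B p
  have hp : p ∈ e.baseSet := mem_baseSet_trivializationAt FB B p
  let v := Module.finBasis ℝ FB
  have hframe i : ∀ᶠ m in nhds p, ContMDiffAt 𝓘(ℝ, E) (𝓘(ℝ, E).prod 𝓘(ℝ, FB)) ∞
      (fun m => (⟨m, e.symmₗ ℝ m (v i)⟩ : TotalSpace FB B)) m := by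
    filter_upwards [e.open_baseSet.mem_nhds hp] with m hm
    exact contMDiffAt_symmₗ_along e contMDiffAt_id contMDiffAt_const hm
  choose χ hχ using fun i => 𝔼.exists_local_lift p (hframe i)
  refine ⟨ofFrame e v χ, ?_⟩
  filter_upwards [e.open_baseSet.mem_nhds hp, Filter.eventually_all.2 hχ] with m hm hχm
  exact .ofFrame hm (fun i => (hχm i).1) fun i => (hχm i).2

theorem exists_isLagrangianAt [FiniteDimensional ℝ E] [T2Space M] [SecondCountableTopology M]
    [IsManifold 𝓘(ℝ, E) ∞ M] :
    ∃ S : ∀ (m : M) (q : Q m), B m →ₗ[ℝ] DQ ⟨m, q⟩, ∀ m, 𝔼.IsLagrangianAt S m := by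
  have := Manifold.locallyCompact_of_finiteDimensional 𝓘(ℝ, E) (M := M)
  choose S hS using 𝔼.exists_isLagrangianAt_nhds
  simp only [Filter.Eventually, mem_nhds_iff] at hS
  choose U hUS hUo hU using hS
  obtain ⟨ρ, hρ⟩ := SmoothPartitionOfUnity.exists_isSubordinate 𝓘(ℝ, E) isClosed_univ U hUo
    (fun p _ => Set.mem_iUnion.2 ⟨p, hU p⟩)
  exact ⟨_, IsLagrangianAt.sum_partitionOfUnity 𝔼 hρ fun p m hm => hUS p hm⟩

end MetricDoubleVectorBundle

end GlobalSplitting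

/-! ### The short exact sequence of sheaves -/

section CoreSections

namespace MetricDoubleVectorBundle

variable [VectorBundle ℝ FDB DB]
  (𝔼 : MetricDoubleVectorBundle E FQ Q FB B FDQ DQ FDB DB)

/-- The bilinear form `(q, q') ↦ ⟨χ(q), 0_{q'}⟩` on `Q_m` of a map `χ` from `Q_m` to `D`; an
isotropic `χ` over `0 ∈ B_m` is determined by it. -/
def coreForm {m : M} (χ : ∀ q : Q m, DQ ⟨m, q⟩) (q q' : Q m) : ℝ :=
  𝔼.pairing 𝔼.metric ⟨⟨m, q⟩, χ q⟩ (𝔼.zeroQ ⟨m, q'⟩)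

variable {𝔼} {m : M} {χ χ' : ∀ q : Q m, DQ ⟨m, q⟩}

theorem IsIsotropicAt.coreForm_add (h : 𝔼.IsIsotropicAt m χ 0) (h' : 𝔼.IsIsotropicAt m χ' 0)
    (q q' : Q m) : 𝔼.coreForm (χ + χ') q q' = 𝔼.coreForm χ q q' + 𝔼.coreForm χ' q q' := by
  have hB := 𝔼.isDoubleVectorBundle.projB_zeroQ m q'
  have hadd := 𝔼.metric_addQ (⟨⟨m, q⟩, χ q⟩ : TotalSpace FDQ DQ) ⟨⟨m, q⟩, χ' q⟩
    (𝔼.zeroQ ⟨m, q'⟩) (𝔼.zeroQ ⟨m, q'⟩) rfl rfl ((h.projB q).trans hB.symm)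
    ((h'.projB q).trans hB.symm)
  simpa [coreForm, DoubleBundleSquare.zeroQ] using hadd

theorem IsIsotropicAt.coreForm_smul (h : 𝔼.IsIsotropicAt m χ 0) (r : ℝ) (q q' : Q m) :
    𝔼.coreForm (r • χ) q q' = r * 𝔼.coreForm χ q q' := by
  have hB := 𝔼.isDoubleVectorBundle.projB_zeroQ m q'
  have hsmul := 𝔼.metric_smulQ r (⟨⟨m, q⟩, χ q⟩ : TotalSpace FDQ DQ) (𝔼.zeroQ ⟨m, q'⟩)
    ((h.projB q).trans hB.symm)
  simpa [coreForm, DoubleBundleSquare.zeroQ] using hsmul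

theorem coreForm_of_eq_inB {f : Q m → DB ⟨m, 0⟩}
    (hf : ∀ q, (⟨⟨m, q⟩, χ q⟩ : TotalSpace FDQ DQ) = 𝔼.inB ⟨m, 0⟩ (f q)) (q q' : Q m) :
    𝔼.coreForm χ q q' = 𝔼.metric ⟨m, 0⟩ (f q) (𝔼.zeroVec m q') := by
  rw [coreForm, hf, ← inB_zeroVec, 𝔼.pairing_inB]

variable [FiniteDimensional ℝ FDB]

variable (𝔼) in
/-- The map `q ↦ 0_q +_B τ̄` with `τ = η(q, ·)`, for a two-form `η` on `Q_m`. -/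
def coreSection (η : Q m [⋀^Fin 2]→L[ℝ] ℝ) (q : Q m) : DQ ⟨m, q⟩ :=
  vectorAt ⟨m, q⟩ (𝔼.inB ⟨m, 0⟩ (𝔼.zeroVec m q + 𝔼.coreVec ⟨m, 0⟩ (twoFormBilin η q)))

theorem metric_coreVec_zeroVec (q : Q m) (τ : Q m →ₗ[ℝ] ℝ) :
    𝔼.metric ⟨m, 0⟩ (𝔼.coreVec ⟨m, 0⟩ τ) (𝔼.zeroVec m q) = τ q := by
  rw [metric_coreVec, fiberQ_zeroVec]

variable [FiniteDimensional ℝ FQ] [VectorBundle ℝ FQ Q] {η η' : Q m [⋀^Fin 2]→L[ℝ] ℝ}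

theorem mk_coreSection (η : Q m [⋀^Fin 2]→L[ℝ] ℝ) (q : Q m) :
    (⟨⟨m, q⟩, 𝔼.coreSection η q⟩ : TotalSpace FDQ DQ) =
      𝔼.inB ⟨m, 0⟩ (𝔼.zeroVec m q + 𝔼.coreVec ⟨m, 0⟩ (twoFormBilin η q)) :=
  mk_vectorAt <| 𝔼.fiberQ_eq_iff.1 <| by rw [map_add, fiberQ_zeroVec, fiberQ_coreVec, add_zero]

theorem isIsotropicAt_coreSection (η : Q m [⋀^Fin 2]→L[ℝ] ℝ) :
    𝔼.IsIsotropicAt m (𝔼.coreSection η) 0 := by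
  refine .of_linear (𝔼.zeroVec m + 𝔼.coreVec ⟨m, 0⟩ ∘ₗ twoFormBilin η) (mk_coreSection η)
    fun q q' => ?_
  simp only [LinearMap.add_apply, LinearMap.comp_apply, map_add, add_apply]
  rw [𝔼.metric_zeroVec, 𝔼.metric_symm _ (𝔼.zeroVec m q), metric_coreVec_zeroVec,
    metric_coreVec_zeroVec, metric_coreVec, fiberQ_coreVec, map_zero, zero_add, add_zero,
    ← (twoFormBilin_isAlt η).neg q q', add_neg_cancel]

@[simp] theorem coreForm_coreSection (η : Q m [⋀^Fin 2]→L[ℝ] ℝ) (q q' : Q m) :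
    𝔼.coreForm (𝔼.coreSection η) q q' = twoFormBilin η q q' := by
  rw [coreForm_of_eq_inB (mk_coreSection η), map_add, add_apply, 𝔼.metric_zeroVec,
    metric_coreVec_zeroVec, zero_add]

theorem IsIsotropicAt.eq_coreSection (h : 𝔼.IsIsotropicAt m χ 0)
    (hη : ∀ q q', 𝔼.coreForm χ q q' = twoFormBilin η q q') : χ = 𝔼.coreSection η := by
  obtain ⟨f, hf, hfQ, -⟩ := h.exists_linear
  funext q
  have hker {q' : Q m} {x : DB ⟨m, 0⟩} (hx : 𝔼.fiberQ ⟨m, 0⟩ x = q') :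
      𝔼.fiberQ ⟨m, 0⟩ (x - 𝔼.zeroVec m q') = 0 := by
    rw [map_sub, fiberQ_zeroVec, hx, sub_self]
  have hcore : f q - 𝔼.zeroVec m q = 𝔼.coreVec ⟨m, 0⟩ (twoFormBilin η q) := by
    refine 𝔼.eq_coreVec fun x => ?_
    have hx := 𝔼.metric_ker_fiberQ (hker (hfQ q)) (hker (x := x) rfl)
    rw [map_sub, sub_eq_zero] at hx
    rw [hx, map_sub, sub_apply, 𝔼.metric_zeroVec, sub_zero, ← coreForm_of_eq_inB hf, hη]
  have hmk : (⟨⟨m, q⟩, χ q⟩ : TotalSpace FDQ DQ) = ⟨⟨m, q⟩, 𝔼.coreSection η q⟩ := by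
    rw [hf, mk_coreSection, ← hcore, add_sub_cancel]
  simpa using hmk

theorem coreSection_add (η η' : Q m [⋀^Fin 2]→L[ℝ] ℝ) :
    𝔼.coreSection (η + η') = 𝔼.coreSection η + 𝔼.coreSection η' := by
  have h := 𝔼.isIsotropicAt_coreSection η
  have h' := 𝔼.isIsotropicAt_coreSection η'
  have hadd := h.add h'
  rw [add_zero] at hadd
  refine (hadd.eq_coreSection fun q q' => ?_).symm
  simp [h.coreForm_add h']

theorem coreSection_smul (r : ℝ) (η : Q m [⋀^Fin 2]→L[ℝ] ℝ) :
    𝔼.coreSection (r • η) = r • 𝔼.coreSection η := by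
  have h := 𝔼.isIsotropicAt_coreSection η
  have hsmul := h.smul r
  rw [smul_zero] at hsmul
  refine (hsmul.eq_coreSection fun q q' => ?_).symm
  simp [h.coreForm_smul]

variable (𝔼) in
theorem coreSection_injective (m : M) :
    Function.Injective (𝔼.coreSection : (Q m [⋀^Fin 2]→L[ℝ] ℝ) → ∀ q : Q m, DQ ⟨m, q⟩) :=
  fun η η' h => twoFormBilin_injective <| LinearMap.ext₂ fun q q' => by
    rw [← coreForm_coreSection (𝔼 := 𝔼), h, coreForm_coreSection]

theorem IsIsotropicAt.exists_eq_coreSection (h : 𝔼.IsIsotropicAt m χ 0) :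
    ∃ η : Q m [⋀^Fin 2]→L[ℝ] ℝ, χ = 𝔼.coreSection η := by
  obtain ⟨f, hf, hfQ, hi⟩ := h.exists_linear
  let a : Q m →ₗ[ℝ] Q m →ₗ[ℝ] ℝ := (𝔼.bilin ⟨m, 0⟩).compl₁₂ f (𝔼.zeroVec m)
  have ha (q q' : Q m) : 𝔼.metric ⟨m, 0⟩ (f q) (𝔼.zeroVec m q') = a q q' := rfl
  have ha_alt : a.IsAlt := fun q => by
    have hker : 𝔼.fiberQ ⟨m, 0⟩ (f q - 𝔼.zeroVec m q) = 0 := by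
      rw [map_sub, hfQ, fiberQ_zeroVec, sub_self]
    have hzero := 𝔼.metric_ker_fiberQ hker hker
    simp only [map_sub, sub_apply, hi, 𝔼.metric_zeroVec, 𝔼.metric_symm _ (𝔼.zeroVec m q)] at hzero
    rw [← ha]
    linarith
  obtain ⟨η, hη⟩ :=
    exists_twoFormBilin_eq (VectorBundle.continuousLinearEquivAt ℝ FQ Q m) ha_alt
  exact ⟨η, h.eq_coreSection fun q q' => by rw [coreForm_of_eq_inB hf, ha, hη]⟩

theorem isCoreElement_coreVec (m : M) (τ : Q m →ₗ[ℝ] ℝ) :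
    𝔼.IsCoreElement m τ (𝔼.inB ⟨m, 0⟩ (𝔼.coreVec ⟨m, 0⟩ τ)) where
  projQ := 𝔼.fiberQ_eq_iff.1 (𝔼.fiberQ_coreVec ⟨m, 0⟩ τ)
  projB := 𝔼.projB_inB _ _
  pairing q e he := by
    have H := 𝔼.isDoubleVectorBundle
    have hcore := 𝔼.fiberQ_eq_iff.1 (𝔼.fiberQ_coreVec ⟨m, 0⟩ τ)
    obtain ⟨b, hb⟩ := exists_eq_mk_of_proj_eq
      ((H.proj_comm e).symm.trans (congrArg TotalSpace.proj he))
    obtain ⟨x, hx⟩ := 𝔼.exists_inB hb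
    have hadd := 𝔼.metric_addQ e (𝔼.zeroQ ⟨m, q⟩) (𝔼.zeroB ⟨m, b⟩)
      (𝔼.inB ⟨m, 0⟩ (𝔼.coreVec ⟨m, 0⟩ τ)) he ((H.projQ_zeroB m b).trans hcore.symm)
      (hb.trans (𝔼.projB_inB _ _).symm) ((H.projB_zeroQ m q).trans (𝔼.projB_inB _ _).symm)
    rw [𝔼.addQ_zeroQ he] at hadd
    rw [hb, hadd, hx, 𝔼.zeroB_eq_inB, 𝔼.pairing_inB, map_zero, ← inB_zeroVec, 𝔼.pairing_inB,
      𝔼.metric_symm, metric_coreVec_zeroVec, zero_add]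

section Smooth

variable (𝔼)
  {EN : Type*} [NormedAddCommGroup EN] [NormedSpace ℝ EN]
  {HN : Type*} [TopologicalSpace HN] {IN : ModelWithCorners ℝ EN HN}
  {N : Type*} [TopologicalSpace N] [ChartedSpace HN N] {x₀ : N} {p : N → M}

omit [FiniteDimensional ℝ FQ] [FiniteDimensional ℝ FDB] [VectorBundle ℝ FQ Q] in
theorem contMDiffAt_zeroVec [VectorBundle ℝ FDQ DQ] {s : ∀ y, Q (p y)}
    (hs : ContMDiffAt IN (𝓘(ℝ, E).prod 𝓘(ℝ, FQ)) ∞ (fun y => (⟨p y, s y⟩ : TotalSpace FQ Q)) x₀) :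
    ContMDiffAt IN ((𝓘(ℝ, E).prod 𝓘(ℝ, FB)).prod 𝓘(ℝ, FDB)) ∞
      (fun y => (⟨⟨p y, 0⟩, 𝔼.zeroVec (p y) (s y)⟩ : TotalSpace FDB DB)) x₀ := by
  refine 𝔼.contMDiffAt_inB_iff.1 ?_
  simp only [inB_zeroVec]
  exact contMDiffAt_zero_along hs

variable [VectorBundle ℝ FDQ DQ] [ContMDiffVectorBundle ∞ FQ Q 𝓘(ℝ, E)]
  {η : ∀ y, Q (p y) [⋀^Fin 2]→L[ℝ] Bundle.Trivial M ℝ (p y)}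

theorem contMDiffAt_coreSection [VectorBundle ℝ FB B]
    [ContMDiffVectorBundle ∞ FDB DB (𝓘(ℝ, E).prod 𝓘(ℝ, FB))] {s : ∀ y, Q (p y)}
    (hs : ContMDiffAt IN (𝓘(ℝ, E).prod 𝓘(ℝ, FQ)) ∞ (fun y => (⟨p y, s y⟩ : TotalSpace FQ Q)) x₀)
    (hη : ContMDiffAt IN (𝓘(ℝ, E).prod 𝓘(ℝ, FQ [⋀^Fin 2]→L[ℝ] ℝ)) ∞ (fun y => (⟨p y, η y⟩ :
      TotalSpace (FQ [⋀^Fin 2]→L[ℝ] ℝ) (fun m => Q m [⋀^Fin 2]→L[ℝ] Bundle.Trivial M ℝ m))) x₀) :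
    ContMDiffAt IN ((𝓘(ℝ, E).prod 𝓘(ℝ, FQ)).prod 𝓘(ℝ, FDQ)) ∞
      (fun y => (⟨⟨p y, s y⟩, 𝔼.coreSection (η y) (s y)⟩ : TotalSpace FDQ DQ)) x₀ := by
  simp only [mk_coreSection]
  have hβ : ContMDiffAt IN (𝓘(ℝ, E).prod 𝓘(ℝ, FB)) ∞
      (fun y => (⟨p y, 0⟩ : TotalSpace FB B)) x₀ :=
    contMDiffAt_zero_along (contMDiffAt_proj_along hs)
  refine 𝔼.contMDiffAt_inB_iff.2 (contMDiffAt_add_along (𝔼.contMDiffAt_zeroVec hs)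
    (𝔼.contMDiffAt_coreVec hβ (τ := fun y => twoFormBilin (η y) (s y)) fun t ht => ?_))
  simp only [twoFormBilin_apply]
  refine contMDiffAt_form_apply (v := fun y => ![s y, t y]) hη fun i => ?_
  fin_cases i
  exacts [hs, ht]

theorem contMDiffAt_of_coreSection (hp : ContMDiffAt IN 𝓘(ℝ, E) ∞ p x₀)
    (h : ∀ s : ∀ y, Q (p y), ContMDiffAt IN (𝓘(ℝ, E).prod 𝓘(ℝ, FQ)) ∞
        (fun y => (⟨p y, s y⟩ : TotalSpace FQ Q)) x₀ →
      ContMDiffAt IN ((𝓘(ℝ, E).prod 𝓘(ℝ, FQ)).prod 𝓘(ℝ, FDQ)) ∞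
        (fun y => (⟨⟨p y, s y⟩, 𝔼.coreSection (η y) (s y)⟩ : TotalSpace FDQ DQ)) x₀) :
    ContMDiffAt IN (𝓘(ℝ, E).prod 𝓘(ℝ, FQ [⋀^Fin 2]→L[ℝ] ℝ)) ∞ (fun y => (⟨p y, η y⟩ :
      TotalSpace (FQ [⋀^Fin 2]→L[ℝ] ℝ)
        (fun m => Q m [⋀^Fin 2]→L[ℝ] Bundle.Trivial M ℝ m))) x₀ := by
  let e := trivializationAt FQ Q (p x₀)
  have hframe (w : FQ) : ContMDiffAt IN (𝓘(ℝ, E).prod 𝓘(ℝ, FQ)) ∞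
      (fun y => (⟨p y, e.symm (p y) w⟩ : TotalSpace FQ Q)) x₀ :=
    contMDiffAt_symm_along _ hp contMDiffAt_const (mem_baseSet_trivializationAt FQ Q (p x₀))
  refine contMDiffAt_form_of_apply hp fun v => ?_
  have hcore := h _ (hframe (v 0))
  simp only [mk_coreSection] at hcore
  refine (𝔼.contMDiffAt_metric (𝔼.contMDiffAt_inB_iff.1 hcore)
    (𝔼.contMDiffAt_zeroVec (hframe (v 1)))).congr_of_eventuallyEq (.of_forall fun y => ?_)
  have hv : (fun i => e.symm (p y) (v i)) = ![e.symm (p y) (v 0), e.symm (p y) (v 1)] := by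
    ext i
    fin_cases i <;> rfl
  change η y (fun i => e.symm (p y) (v i)) = 𝔼.metric _ _ _
  rw [hv, ← coreForm_of_eq_inB (mk_coreSection (η y)), coreForm_coreSection, twoFormBilin_apply]

end Smooth

end MetricDoubleVectorBundle

end CoreSections

section SheafSequence

namespace MetricDoubleVectorBundle

variable [VectorBundle ℝ FQ Q] [VectorBundle ℝ FB B] [VectorBundle ℝ FDQ DQ]
  [VectorBundle ℝ FDB DB] (𝔼 : MetricDoubleVectorBundle E FQ Q FB B FDQ DQ FDB DB)

variable {𝔼} in
theorem isotropicBase_eq {U : Opens M} {χ : 𝔼.isotropicSections U}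
    {b : smoothSections 𝓘(ℝ, E) FB B U}
    (h : ∀ m : U, 𝔼.IsIsotropicAt m (fun q => χ.1 ⟨⟨m, q⟩, m.2⟩) (b.1 m)) :
    𝔼.isotropicBase U χ = b :=
  Subtype.ext <| funext fun m => by
    simpa using ((isIsotropicAt_section χ m).projB 0).symm.trans ((h m).projB 0)

theorem isotropicBase_res {U W : Opens M} (h : W ≤ U) (χ : 𝔼.isotropicSections U) :
    𝔼.isotropicBase W (𝔼.isotropicRes h χ) =
      smoothSections.res 𝓘(ℝ, E) FB h (𝔼.isotropicBase U χ) :=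
  isotropicBase_eq fun m => isIsotropicAt_section χ (Set.inclusion h m)

variable {𝔼} in
theorem mem_isotropicSections_of_locally {U : Opens M} {χ : ∀ q : TotalSpace FQ Q, DQ q}
    (h : ∀ m ∈ U, ∃ W : Opens M, m ∈ W ∧
      (fun q : opensOver (F := FQ) Q W => χ q) ∈ 𝔼.isotropicSections W) :
    (fun q : opensOver (F := FQ) Q U => χ q) ∈ 𝔼.isotropicSections U := by
  refine mem_isotropicSections_iff.2 ⟨mem_smoothSections_iff_contMDiffAt.2 fun q hq => ?_, ?_⟩
  · obtain ⟨W, hW, hχ⟩ := h q.proj hq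
    exact mem_smoothSections_iff_contMDiffAt.1 (mem_isotropicSections_iff.1 hχ).1 q hW
  · have hbase (m : U) : ∃ b : B m, 𝔼.IsIsotropicAt m (fun q => χ ⟨m, q⟩) b := by
      obtain ⟨W, hW, hχ⟩ := h m m.2
      exact ⟨_, isIsotropicAt_section ⟨_, hχ⟩ ⟨m, hW⟩⟩
    choose b hb using hbase
    exact ⟨b, hb⟩

theorem existsUnique_glue {κ : Type*} (𝒰 : κ → Opens M) (χ : ∀ i, 𝔼.isotropicSections (𝒰 i))
    (hχ : ∀ i j, 𝔼.isotropicRes (inf_le_left : 𝒰 i ⊓ 𝒰 j ≤ 𝒰 i) (χ i) =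
      𝔼.isotropicRes (inf_le_right : 𝒰 i ⊓ 𝒰 j ≤ 𝒰 j) (χ j)) :
    ∃! s : 𝔼.isotropicSections (⨆ i, 𝒰 i), ∀ i, 𝔼.isotropicRes (le_iSup 𝒰 i) s = χ i := by
  obtain ⟨t, ht⟩ := exists_eq_of_compatible (U := fun i => opensOver (F := FQ) Q (𝒰 i))
    (s := fun i => (χ i).1) fun i j q hi hj => congrFun (congrArg Subtype.val (hχ i j)) ⟨q, hi, hj⟩
  have hmem : (fun q : opensOver (F := FQ) Q (⨆ i, 𝒰 i) => t q) ∈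
      𝔼.isotropicSections (⨆ i, 𝒰 i) := by
    refine mem_isotropicSections_of_locally fun m hm => ?_
    obtain ⟨i, hi⟩ := Opens.mem_iSup.1 hm
    have hti : (fun q : opensOver (F := FQ) Q (𝒰 i) => t q) = (χ i).1 := funext (ht i)
    exact ⟨𝒰 i, hi, hti ▸ (χ i).2⟩
  refine ⟨⟨_, hmem⟩, fun i => Subtype.ext (funext (ht i)), fun s hs =>
    Subtype.ext (funext fun q => ?_)⟩
  obtain ⟨i, hi⟩ := Opens.mem_iSup.1 q.2
  exact (congrFun (congrArg Subtype.val (hs i)) ⟨q.1, hi⟩).trans (ht i ⟨q.1, hi⟩).symm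

section Split

variable {S : ∀ (m : M) (q : Q m), B m →ₗ[ℝ] DQ ⟨m, q⟩} (hS : ∀ m, 𝔼.IsLagrangianAt S m)
  (U : Opens M)

/-- The map `Γ(B) → 𝒞(𝔼)` over `U` given by a Lagrangian splitting. -/
def splitSection :
    smoothSections 𝓘(ℝ, E) FB B U →ₗ[SmoothFun 𝓘(ℝ, E) U] 𝔼.isotropicSections U where
  toFun b := ⟨fun q => S q.1.proj q.1.2 (b.1 ⟨q.1.proj, q.2⟩), mem_isotropicSections_iff.2
    ⟨fun q => ContMDiffAt.comp q ((hS q.1.proj).smooth q.1.2 (b.1 ⟨q.1.proj, q.2⟩))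
      (contMDiffAt_prod_along (p := fun q : opensOver (F := FQ) Q U => q.1.proj)
        (s := fun q => q.1.2) (t := fun q => b.1 ⟨q.1.proj, q.2⟩)
        contMDiff_subtype_val.contMDiffAt (b.2.comp (contMDiff_restrictProj U)).contMDiffAt),
      b.1, fun m => (hS m).isotropic (b.1 m)⟩⟩
  map_add' _ _ := Subtype.ext (funext fun q => (S q.1.proj q.1.2).map_add _ _)
  map_smul' _ _ := Subtype.ext (funext fun q => (S q.1.proj q.1.2).map_smul _ _)

theorem isotropicBase_splitSection (b : smoothSections 𝓘(ℝ, E) FB B U) :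
    𝔼.isotropicBase U (𝔼.splitSection hS U b) = b :=
  isotropicBase_eq fun m => (hS m).isotropic (b.1 m)

end Split

variable [FiniteDimensional ℝ FQ] [FiniteDimensional ℝ FDB] [ContMDiffVectorBundle ∞ FQ Q 𝓘(ℝ, E)]

theorem exists_eq_coreSection_of_isotropicBase_eq_zero {U : Opens M} {χ : 𝔼.isotropicSections U}
    (hχ : 𝔼.isotropicBase U χ = 0) :
    ∃ α : twoForms E FQ Q U, ∀ (m : U) (q : Q m), χ.1 ⟨⟨m, q⟩, m.2⟩ = 𝔼.coreSection (α.1 m) q := by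
  have hzero (m : U) : 𝔼.IsIsotropicAt m (fun q => χ.1 ⟨⟨m, q⟩, m.2⟩) 0 := by
    simpa [hχ] using isIsotropicAt_section χ m
  choose η hη using fun m => (hzero m).exists_eq_coreSection
  refine ⟨⟨η, fun m => 𝔼.contMDiffAt_of_coreSection (p := fun m : U => m.1)
    contMDiff_subtype_val.contMDiffAt fun s hs => ?_⟩, fun m => congrFun (hη m)⟩
  have hs' : ContMDiffAt 𝓘(ℝ, E) (𝓘(ℝ, E).prod 𝓘(ℝ, FQ)) ∞
      (fun x : U => (⟨⟨x, s x⟩, x.2⟩ : opensOver (F := FQ) Q U)) m := by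
    rwa [← ContMDiffAt.subtypeVal_comp_iff]
  have hsmooth := ContMDiffAt.comp m ((mem_isotropicSections_iff.1 χ.2).1 ⟨⟨m, s m⟩, m.2⟩) hs'
  exact hsmooth.congr_of_eventuallyEq <| .of_forall fun x =>
    congrArg (TotalSpace.mk (⟨x, s x⟩ : TotalSpace FQ Q)) (congrFun (hη x) (s x)).symm

variable [ContMDiffVectorBundle ∞ FDB DB (𝓘(ℝ, E).prod 𝓘(ℝ, FB))]

/-- The map `Ω²(Q) → 𝒞(𝔼)`, `ω ↦ ω̃`, over `U`. -/
def coreLinear (U : Opens M) :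
    twoForms E FQ Q U →ₗ[SmoothFun 𝓘(ℝ, E) U] 𝔼.isotropicSections U where
  toFun α := ⟨fun q => 𝔼.coreSection (α.1 ⟨q.1.proj, q.2⟩) q.1.2, mem_isotropicSections_iff.2
    ⟨fun _ => 𝔼.contMDiffAt_coreSection (p := fun q : opensOver (F := FQ) Q U => q.1.proj)
        (s := fun q => q.1.2) (η := fun q => α.1 ⟨q.1.proj, q.2⟩)
        contMDiff_subtype_val.contMDiffAt (α.2.comp (contMDiff_restrictProj U)).contMDiffAt,
      0, fun m => isIsotropicAt_coreSection (α.1 m)⟩⟩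
  map_add' _ _ := Subtype.ext (funext fun q => congrFun (coreSection_add _ _) q.1.2)
  map_smul' _ _ := Subtype.ext (funext fun q => congrFun (coreSection_smul _ _) q.1.2)

theorem isCoreLinear_coreLinear (U : Opens M) (α : twoForms E FQ Q U) :
    𝔼.IsCoreLinear α (𝔼.coreLinear U α).1 := by
  intro m q
  have hα : ⇑(twoFormBilin (α.1 m) q) = fun q' => α.1 m ![q, q'] :=
    funext (twoFormBilin_apply (α.1 m) q)
  refine ⟨_, hα ▸ 𝔼.isCoreElement_coreVec m (twoFormBilin (α.1 m) q), ?_⟩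
  exact (mk_coreSection (α.1 m) q).trans (by rw [← inB_zeroVec, 𝔼.addB_inB])

theorem coreLinear_injective (U : Opens M) : Function.Injective (𝔼.coreLinear U) :=
  fun _ _ h => Subtype.ext <| funext fun m => 𝔼.coreSection_injective m <| funext fun q =>
    congrFun (congrArg Subtype.val h) ⟨⟨m, q⟩, m.2⟩

theorem exact_coreLinear (U : Opens M) :
    Function.Exact (𝔼.coreLinear U) (𝔼.isotropicBase U) := by
  refine fun χ => ⟨fun hχ => ?_, ?_⟩
  · obtain ⟨α, hα⟩ := 𝔼.exists_eq_coreSection_of_isotropicBase_eq_zero hχ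
    exact ⟨α, Subtype.ext (funext fun q => (hα ⟨q.1.proj, q.2⟩ q.1.2).symm)⟩
  · rintro ⟨α, rfl⟩
    exact isotropicBase_eq fun m => isIsotropicAt_coreSection (α.1 m)

/-- A Lagrangian splitting identifies `Ω²(Q) ⊕ Γ(B)` with `𝒞(𝔼)`. -/
def splitEquiv {S : ∀ (m : M) (q : Q m), B m →ₗ[ℝ] DQ ⟨m, q⟩} (hS : ∀ m, 𝔼.IsLagrangianAt S m)
    (U : Opens M) : (twoForms E FQ Q U × smoothSections 𝓘(ℝ, E) FB B U)
      ≃ₗ[SmoothFun 𝓘(ℝ, E) U] 𝔼.isotropicSections U :=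
  equivOfExactOfSection (R := SmoothFun 𝓘(ℝ, E) U) (N := twoForms E FQ Q U)
    (L := 𝔼.isotropicSections U) (P := smoothSections 𝓘(ℝ, E) FB B U)
    (𝔼.exact_coreLinear U) (𝔼.coreLinear_injective U)
    (𝔼.splitSection hS U) (𝔼.isotropicBase_splitSection hS U)

theorem splitEquiv_apply {S : ∀ (m : M) (q : Q m), B m →ₗ[ℝ] DQ ⟨m, q⟩}
    (hS : ∀ m, 𝔼.IsLagrangianAt S m) (U : Opens M)
    (x : twoForms E FQ Q U × smoothSections 𝓘(ℝ, E) FB B U) :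
    𝔼.splitEquiv hS U x = 𝔼.coreLinear U x.1 + 𝔼.splitSection hS U x.2 :=
  equivOfExactOfSection_apply ..

theorem isotropicBase_splitEquiv {S : ∀ (m : M) (q : Q m), B m →ₗ[ℝ] DQ ⟨m, q⟩}
    (hS : ∀ m, 𝔼.IsLagrangianAt S m) (U : Opens M)
    (x : twoForms E FQ Q U × smoothSections 𝓘(ℝ, E) FB B U) :
    𝔼.isotropicBase U (𝔼.splitEquiv hS U x) = x.2 := by
  rw [splitEquiv_apply, map_add, (𝔼.exact_coreLinear U).apply_apply_eq_zero,
    isotropicBase_splitSection, zero_add]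

end MetricDoubleVectorBundle

end SheafSequence

/-! ### Splittings of the sequence -/

section Splittings

variable [VectorBundle ℝ FDB DB]

namespace MetricDoubleVectorBundle

variable {𝔼 : MetricDoubleVectorBundle E FQ Q FB B FDQ DQ FDB DB}

namespace LagrangianSplitting

theorem ext {σ σ' : 𝔼.LagrangianSplitting}
    (h : ∀ m q b, σ.1.toFun m q b = σ'.1.toFun m q b) : σ = σ' := by
  obtain ⟨⟨f, _, _, _, _, _, _, _⟩, _⟩ := σ
  obtain ⟨⟨f', _, _, _, _, _, _, _⟩, _⟩ := σ'
  obtain rfl : f = f' := funext fun m => funext fun q => funext fun b => h m q b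
  rfl

theorem mk_vectorAt_toFun (σ : 𝔼.LagrangianSplitting) (m : M) (q : Q m) (b : B m) :
    (⟨⟨m, q⟩, vectorAt ⟨m, q⟩ (σ.1.toFun m q b)⟩ : TotalSpace FDQ DQ) = σ.1.toFun m q b :=
  mk_vectorAt (σ.1.projQ m q b)

/-- The linear maps `Σ(q, ·)` of a Lagrangian splitting `Σ`, with values in the fibres of `DQ`. -/
def linear (σ : 𝔼.LagrangianSplitting) (m : M) (q : Q m) : B m →ₗ[ℝ] DQ ⟨m, q⟩ where
  toFun b := vectorAt ⟨m, q⟩ (σ.1.toFun m q b)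
  map_add' b b' := by
    have hadd := σ.1.add_right m q b b'
    rw [← mk_vectorAt_toFun, ← mk_vectorAt_toFun σ m q b, ← mk_vectorAt_toFun σ m q b',
      𝔼.addQ_mk] at hadd
    simpa using hadd
  map_smul' r b := by
    have hsmul := σ.1.smul_right m r q b
    rw [← mk_vectorAt_toFun, ← mk_vectorAt_toFun σ m q b, 𝔼.smulQ_mk] at hsmul
    simpa using hsmul

theorem mk_linear (σ : 𝔼.LagrangianSplitting) (m : M) (q : Q m) (b : B m) :
    (⟨⟨m, q⟩, σ.linear m q b⟩ : TotalSpace FDQ DQ) = σ.1.toFun m q b :=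
  mk_vectorAt_toFun σ m q b

theorem isLagrangianAt (σ : 𝔼.LagrangianSplitting) (m : M) : 𝔼.IsLagrangianAt σ.linear m where
  isotropic b :=
    { projB := fun q => by rw [mk_linear, ← σ.1.projB m q b]
      map_add := fun q q' => by rw [mk_linear, mk_linear, mk_linear, σ.1.add_left]
      map_smul := fun r q => by rw [mk_linear, mk_linear, σ.1.smul_left]
      isotropic := fun q q' => by rw [mk_linear, mk_linear, σ.2] }
  smooth q b := by
    simp only [mk_linear]
    exact σ.1.smooth _

variable [VectorBundle ℝ FQ Q] [VectorBundle ℝ FB B] [VectorBundle ℝ FDQ DQ]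

/-- The splitting of sheaves `b ↦ Σ(·, b)` given by a Lagrangian splitting `Σ`. -/
def toSheafSplitting (σ : 𝔼.LagrangianSplitting) : 𝔼.SheafSplitting where
  toFun := 𝔼.splitSection σ.isLagrangianAt
  res_toFun _ _ _ _ := rfl
  base_toFun := 𝔼.isotropicBase_splitSection σ.isLagrangianAt

end LagrangianSplitting

theorem IsLagrangianAt.linear_splitting {S : ∀ (m : M) (q : Q m), B m →ₗ[ℝ] DQ ⟨m, q⟩}
    (hS : ∀ m, 𝔼.IsLagrangianAt S m) : (IsLagrangianAt.splitting hS).linear = S := by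
  ext m q b
  have hmk : (⟨⟨m, q⟩, (splitting hS).linear m q b⟩ : TotalSpace FDQ DQ) = ⟨⟨m, q⟩, S m q b⟩ :=
    LagrangianSplitting.mk_linear (splitting hS) m q b
  simpa using hmk

variable [VectorBundle ℝ FQ Q] [VectorBundle ℝ FB B] [VectorBundle ℝ FDQ DQ]

namespace SheafSplitting

theorem ext {τ τ' : 𝔼.SheafSplitting} (h : ∀ U b, τ.toFun U b = τ'.toFun U b) : τ = τ' := by
  obtain ⟨f, _, _⟩ := τ
  obtain ⟨f', _, _⟩ := τ'
  obtain rfl : f = f' := funext fun U => LinearMap.ext (h U)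
  rfl

theorem toFun_res_apply (τ : 𝔼.SheafSplitting) {U W : Opens M} (h : W ≤ U)
    (b : smoothSections 𝓘(ℝ, E) FB B U) (q : opensOver (F := FQ) Q W) :
    (τ.toFun W (smoothSections.res 𝓘(ℝ, E) FB h b)).1 q = (τ.toFun U b).1 ⟨q.1, h q.2⟩ :=
  (congrFun (congrArg Subtype.val (τ.res_toFun U W h b)) q).symm

variable [ContMDiffVectorBundle ∞ FB B 𝓘(ℝ, E)]

theorem toFun_apply_eq_sum {κ : Type*} [Fintype κ] (τ : 𝔼.SheafSplitting)
    (v : Module.Basis κ ℝ FB) {e : Trivialization FB (π FB B)} [MemTrivializationAtlas e]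
    {U : Opens M} (hU : (U : Set M) ⊆ e.baseSet) (b : smoothSections 𝓘(ℝ, E) FB B U)
    (q : opensOver (F := FQ) Q U) :
    (τ.toFun U b).1 q = ∑ i, v.coord i (e.linearMapAt ℝ q.1.proj (b.1 ⟨q.1.proj, q.2⟩)) •
      (τ.toFun U (smoothSections.frame 𝓘(ℝ, E) v e hU i)).1 q := by
  conv_lhs => rw [← (smoothSections.frame 𝓘(ℝ, E) v e hU).sum_repr b, map_sum,
    AddSubmonoidClass.coe_finsetSum, Finset.sum_apply]
  refine Finset.sum_congr rfl fun i _ => ?_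
  rw [map_smul, e.coe_linearMapAt_of_mem (hU q.2)]
  rfl

variable [FiniteDimensional ℝ FB]

/-- The family of linear maps `B m → DQ q` given by a splitting `τ` of sheaves: at `m` it sends the
`i`-th member of the preferred local frame of `B` to the value of `τ` on that member. -/
def linear (τ : 𝔼.SheafSplitting) (m : M) (q : Q m) : B m →ₗ[ℝ] DQ ⟨m, q⟩ :=
  ∑ i, ((Module.finBasis ℝ FB).coord i ∘ₗ
    (trivializationAt FB B m).linearMapAt ℝ m).smulRight
      ((τ.toFun _ (smoothSections.frame 𝓘(ℝ, E) (Module.finBasis ℝ FB)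
        (trivializationAt FB B m) (U := preferredOpens FB B m) subset_rfl i)).1
        ⟨⟨m, q⟩, mem_preferredOpens FB B m⟩)

theorem toFun_apply (τ : 𝔼.SheafSplitting) {U : Opens M} (b : smoothSections 𝓘(ℝ, E) FB B U)
    (q : opensOver (F := FQ) Q U) :
    (τ.toFun U b).1 q = τ.linear q.1.proj q.1.2 (b.1 ⟨q.1.proj, q.2⟩) := by
  obtain ⟨⟨m, q⟩, hm⟩ := q
  have hmV := mem_preferredOpens FB B m
  rw [← τ.toFun_res_apply inf_le_left b ⟨⟨m, q⟩, hm, hmV⟩,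
    τ.toFun_apply_eq_sum (Module.finBasis ℝ FB) (e := trivializationAt FB B m) inf_le_right]
  simp only [linear, LinearMap.sum_apply, ← smoothSections.res_frame (Module.finBasis ℝ FB)
    (trivializationAt FB B m) subset_rfl (inf_le_right : U ⊓ preferredOpens FB B m ≤ _),
    τ.toFun_res_apply]
  rfl

theorem isLagrangianAt (τ : 𝔼.SheafSplitting) (m : M) : 𝔼.IsLagrangianAt τ.linear m := by
  let v := Module.finBasis ℝ FB
  let e := trivializationAt FB B m
  let U := preferredOpens FB B m
  have hm : m ∈ U := mem_preferredOpens FB B m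
  let χ i (q : TotalSpace FQ Q) := τ.linear q.proj q.2 (e.symmₗ ℝ q.proj (v i))
  let s i := smoothSections.frame 𝓘(ℝ, E) v e (U := U) subset_rfl i
  have hs i (x : U) : (s i).1 x = e.symmₗ ℝ x (v i) :=
    (smoothSections.frame_apply v e subset_rfl i x).trans (congrFun (e.coe_symmₗ x.2) _).symm
  have hχ i : (fun q : opensOver (F := FQ) Q U => χ i q) = (τ.toFun U (s i)).1 :=
    funext fun q => by rw [τ.toFun_apply, hs]
  have hframe : 𝔼.IsLagrangianAt (ofFrame e v χ) m := by
    refine .ofFrame hm (fun i => ?_) fun i q => ?_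
    · have hiso := isIsotropicAt_section (τ.toFun U (s i)) ⟨m, hm⟩
      rwa [τ.base_toFun, hs, ← hχ] at hiso
    · exact mem_smoothSections_iff_contMDiffAt.1
        ((hχ i).symm ▸ (mem_isotropicSections_iff.1 (τ.toFun U (s i)).2).1) ⟨m, q⟩ hm
  refine hframe.congr_of_eventuallyEq ?_
  filter_upwards [U.isOpen.mem_nhds hm] with m' hm'
  ext q b
  conv_lhs => rw [← sum_coord_smul_symmₗ v e hm' b, map_sum]
  simp [ofFrame, χ]

end SheafSplitting

variable [FiniteDimensional ℝ FB] [ContMDiffVectorBundle ∞ FB B 𝓘(ℝ, E)]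

theorem LagrangianSplitting.linear_toSheafSplitting (σ : 𝔼.LagrangianSplitting) :
    σ.toSheafSplitting.linear = σ.linear := by
  ext m q b
  have hm := mem_preferredOpens FB B m
  conv_rhs => rw [← sum_coord_smul_symmₗ (Module.finBasis ℝ FB) (trivializationAt FB B m) hm b]
  rw [map_sum, SheafSplitting.linear, LinearMap.sum_apply]
  refine Finset.sum_congr rfl fun i _ => ?_
  rw [map_smul, (trivializationAt FB B m).coe_symmₗ hm, ← smoothSections.frame_apply
    (IX := 𝓘(ℝ, E)) _ _ (U := preferredOpens FB B m) subset_rfl i ⟨m, hm⟩]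
  rfl

/-- Lagrangian splittings are the same as splittings of sheaves. -/
def splittingEquiv : 𝔼.LagrangianSplitting ≃ 𝔼.SheafSplitting where
  toFun σ := σ.toSheafSplitting
  invFun τ := IsLagrangianAt.splitting τ.isLagrangianAt
  left_inv σ := LagrangianSplitting.ext fun m q b => by
    rw [← σ.mk_linear, ← σ.linear_toSheafSplitting]
    rfl
  right_inv τ := SheafSplitting.ext fun U b => Subtype.ext <| funext fun q =>
    calc (IsLagrangianAt.splitting τ.isLagrangianAt).linear q.1.proj q.1.2 (b.1 ⟨q.1.proj, q.2⟩)
      _ = τ.linear q.1.proj q.1.2 (b.1 ⟨q.1.proj, q.2⟩) := by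
        rw [IsLagrangianAt.linear_splitting]
      _ = (τ.toFun U b).1 q := (τ.toFun_apply b q).symm

end MetricDoubleVectorBundle

end Splittings

/-! ### The bundle of isotropic sections -/

section BundleOfIsotropicSections

namespace MetricDoubleVectorBundle

variable [VectorBundle ℝ FQ Q] [VectorBundle ℝ FB B] [VectorBundle ℝ FDQ DQ] [VectorBundle ℝ FDB DB]
  [ContMDiffVectorBundle ∞ FQ Q 𝓘(ℝ, E)]
  [ContMDiffVectorBundle ∞ FDB DB (𝓘(ℝ, E).prod 𝓘(ℝ, FB))]
  [FiniteDimensional ℝ FQ] [FiniteDimensional ℝ FDB]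
  (𝔼 : MetricDoubleVectorBundle E FQ Q FB B FDQ DQ FDB DB)
  {S : ∀ (m : M) (q : Q m), B m →ₗ[ℝ] DQ ⟨m, q⟩} (hS : ∀ m, 𝔼.IsLagrangianAt S m)

/-- A Lagrangian splitting identifies the sections of `(Q^* ∧ Q^*) ⊕ B` with `𝒞(𝔼)`. -/
def sectionsEquiv (U : Opens M) :
    smoothSections 𝓘(ℝ, E) ((FQ [⋀^Fin 2]→L[ℝ] ℝ) × FB)
        ((fun m => Q m [⋀^Fin 2]→L[ℝ] Bundle.Trivial M ℝ m) ×ᵇ B) U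
      ≃ₗ[SmoothFun 𝓘(ℝ, E) U] 𝔼.isotropicSections U :=
  (smoothSectionsProdEquiv (F := FQ [⋀^Fin 2]→L[ℝ] ℝ)
    (V := fun m => Q m [⋀^Fin 2]→L[ℝ] Bundle.Trivial M ℝ m) (V' := B) U).trans
    (𝔼.splitEquiv hS U)

theorem isotropicRes_sectionsEquiv {U W : Opens M} (h : W ≤ U)
    (s : smoothSections 𝓘(ℝ, E) ((FQ [⋀^Fin 2]→L[ℝ] ℝ) × FB)
      ((fun m => Q m [⋀^Fin 2]→L[ℝ] Bundle.Trivial M ℝ m) ×ᵇ B) U) :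
    𝔼.isotropicRes h (𝔼.sectionsEquiv hS U s) =
      𝔼.sectionsEquiv hS W (smoothSections.res 𝓘(ℝ, E) ((FQ [⋀^Fin 2]→L[ℝ] ℝ) × FB)
        (V := (fun m => Q m [⋀^Fin 2]→L[ℝ] Bundle.Trivial M ℝ m) ×ᵇ B) h s) := rfl

include hS in
theorem exists_basis_isotropicSections [FiniteDimensional ℝ FB]
    [ContMDiffVectorBundle ∞ FB B 𝓘(ℝ, E)] (p : M) :
    ∃ (U : Opens M) (_ : p ∈ U) (n : ℕ) (χ : Fin n → 𝔼.isotropicSections U),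
      ∀ (W : Opens M) (h : W ≤ U),
        ∃ β : Module.Basis (Fin n) (SmoothFun 𝓘(ℝ, E) W) (𝔼.isotropicSections W),
          ∀ i, β i = 𝔼.isotropicRes h (χ i) := by
  obtain ⟨U, hp, n, s, hs⟩ := smoothSections.exists_basis 𝓘(ℝ, E) ((FQ [⋀^Fin 2]→L[ℝ] ℝ) × FB)
    ((fun m => Q m [⋀^Fin 2]→L[ℝ] Bundle.Trivial M ℝ m) ×ᵇ B) p
  refine ⟨U, hp, n, fun i => 𝔼.sectionsEquiv hS U (s i), fun W h => ?_⟩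
  obtain ⟨β, hβ⟩ := hs W h
  exact ⟨β.map (𝔼.sectionsEquiv hS W), fun i => by
    rw [Module.Basis.map_apply, hβ, isotropicRes_sectionsEquiv]⟩

variable {K : Type*} [NormedAddCommGroup K] [NormedSpace ℝ K]
  (L : ((FQ [⋀^Fin 2]→L[ℝ] ℝ) × FB) ≃L[ℝ] K)

/-- A Lagrangian splitting identifies the sections of the model of `(Q^* ∧ Q^*) ⊕ B` with
`𝒞(𝔼)`. -/
def modelSectionsEquiv (U : Opens M) :
    smoothSections 𝓘(ℝ, E) K (modelCore ((FQ [⋀^Fin 2]→L[ℝ] ℝ) × FB)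
        ((fun m => Q m [⋀^Fin 2]→L[ℝ] Bundle.Trivial M ℝ m) ×ᵇ B) L).Fiber U
      ≃ₗ[SmoothFun 𝓘(ℝ, E) U] 𝔼.isotropicSections U :=
  (smoothSectionsModelEquiv L U).symm.trans (𝔼.sectionsEquiv hS U)

theorem modelSectionsEquiv_symm_coreLinear (U : Opens M) (α : twoForms E FQ Q U) (m : U) :
    ((𝔼.modelSectionsEquiv hS L U).symm (𝔼.coreLinear U α)).1 m =
      modelInl (fun m => Q m [⋀^Fin 2]→L[ℝ] Bundle.Trivial M ℝ m) B L m (α.1 m) := by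
  have hα : 𝔼.coreLinear U α = 𝔼.splitEquiv hS U (α, 0) := by
    rw [splitEquiv_apply, map_zero, add_zero]
  rw [hα, modelSectionsEquiv, sectionsEquiv, LinearEquiv.trans_symm, LinearEquiv.trans_symm,
    LinearEquiv.trans_apply, LinearEquiv.trans_apply, LinearEquiv.symm_apply_apply]
  rfl

theorem isotropicBase_modelSectionsEquiv (U : Opens M)
    (s : smoothSections 𝓘(ℝ, E) K (modelCore ((FQ [⋀^Fin 2]→L[ℝ] ℝ) × FB)
      ((fun m => Q m [⋀^Fin 2]→L[ℝ] Bundle.Trivial M ℝ m) ×ᵇ B) L).Fiber U) (m : U) :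
    (𝔼.isotropicBase U (𝔼.modelSectionsEquiv hS L U s)).1 m =
      modelSnd (fun m => Q m [⋀^Fin 2]→L[ℝ] Bundle.Trivial M ℝ m) B L m (s.1 m) := by
  rw [modelSectionsEquiv, sectionsEquiv, LinearEquiv.trans_apply, LinearEquiv.trans_apply,
    isotropicBase_splitEquiv]
  rfl

end MetricDoubleVectorBundle

end BundleOfIsotropicSections

end

theorem proposition3p8
    {E : Type*} [NormedAddCommGroup E] [NormedSpace ℝ E] [FiniteDimensional ℝ E]
    {M : Type*} [TopologicalSpace M] [T2Space M] [SecondCountableTopology M]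
    [ChartedSpace E M] [IsManifold 𝓘(ℝ, E) ∞ M]
    {FQ : Type*} [NormedAddCommGroup FQ] [NormedSpace ℝ FQ] [FiniteDimensional ℝ FQ]
    {Q : M → Type*} [∀ m, AddCommGroup (Q m)] [∀ m, Module ℝ (Q m)]
    [TopologicalSpace (TotalSpace FQ Q)] [∀ m, TopologicalSpace (Q m)]
    [FiberBundle FQ Q] [VectorBundle ℝ FQ Q] [ContMDiffVectorBundle ∞ FQ Q 𝓘(ℝ, E)]
    {FB : Type*} [NormedAddCommGroup FB] [NormedSpace ℝ FB] [FiniteDimensional ℝ FB]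
    {B : M → Type*} [∀ m, AddCommGroup (B m)] [∀ m, Module ℝ (B m)]
    [TopologicalSpace (TotalSpace FB B)] [∀ m, TopologicalSpace (B m)]
    [FiberBundle FB B] [VectorBundle ℝ FB B] [ContMDiffVectorBundle ∞ FB B 𝓘(ℝ, E)]
    {FDQ : Type*} [NormedAddCommGroup FDQ] [NormedSpace ℝ FDQ] [FiniteDimensional ℝ FDQ]
    {DQ : TotalSpace FQ Q → Type*} [∀ q, AddCommGroup (DQ q)] [∀ q, Module ℝ (DQ q)]
    [TopologicalSpace (TotalSpace FDQ DQ)] [∀ q, TopologicalSpace (DQ q)]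
    [FiberBundle FDQ DQ] [VectorBundle ℝ FDQ DQ]
    [ContMDiffVectorBundle ∞ FDQ DQ (𝓘(ℝ, E).prod 𝓘(ℝ, FQ))]
    {FDB : Type*} [NormedAddCommGroup FDB] [NormedSpace ℝ FDB] [FiniteDimensional ℝ FDB]
    {DB : TotalSpace FB B → Type*} [∀ b, AddCommGroup (DB b)] [∀ b, Module ℝ (DB b)]
    [TopologicalSpace (TotalSpace FDB DB)] [∀ b, TopologicalSpace (DB b)]
    [FiberBundle FDB DB] [VectorBundle ℝ FDB DB]
    [ContMDiffVectorBundle ∞ FDB DB (𝓘(ℝ, E).prod 𝓘(ℝ, FB))]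
    (𝔼 : MetricDoubleVectorBundle E FQ Q FB B FDQ DQ FDB DB) :
    -- `𝒞(𝔼)` is a sheaf
    (∀ (κ : Type*) (𝒰 : κ → Opens M) (χ : ∀ i, 𝔼.isotropicSections (𝒰 i)),
      (∀ i j, 𝔼.isotropicRes (inf_le_left : 𝒰 i ⊓ 𝒰 j ≤ 𝒰 i) (χ i) =
        𝔼.isotropicRes (inf_le_right : 𝒰 i ⊓ 𝒰 j ≤ 𝒰 j) (χ j)) →
      ∃! s : 𝔼.isotropicSections (⨆ i, 𝒰 i), ∀ i, 𝔼.isotropicRes (le_iSup 𝒰 i) s = χ i) ∧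
    -- it is locally free and finitely generated
    (∀ p : M, ∃ (U : Opens M) (_ : p ∈ U) (n : ℕ) (χ : Fin n → 𝔼.isotropicSections U),
      ∀ (W : Opens M) (h : W ≤ U),
        ∃ β : Module.Basis (Fin n) (SmoothFun 𝓘(ℝ, E) W) (𝔼.isotropicSections W),
          ∀ i, β i = 𝔼.isotropicRes h (χ i)) ∧
    -- the short exact sequence of sheaves of modules
    ∃ ι : ∀ U : Opens M, twoForms E FQ Q U →ₗ[SmoothFun 𝓘(ℝ, E) U] 𝔼.isotropicSections U,
      (∀ U α, 𝔼.IsCoreLinear α (ι U α).1) ∧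
      (∀ (U W : Opens M) (h : W ≤ U) (α : twoForms E FQ Q U),
        𝔼.isotropicRes h (ι U α) = ι W (twoForms.res h α)) ∧
      (∀ (U W : Opens M) (h : W ≤ U) (χ : 𝔼.isotropicSections U),
        𝔼.isotropicBase W (𝔼.isotropicRes h χ) =
          smoothSections.res 𝓘(ℝ, E) FB h (𝔼.isotropicBase U χ)) ∧
      (∀ U, Function.Injective (ι U) ∧ Function.Exact (ι U) (𝔼.isotropicBase U) ∧
        Function.Surjective (𝔼.isotropicBase U)) ∧
      -- Lagrangian splittings are equivalent to splittings of the sequence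
      (∃ Θ : 𝔼.LagrangianSplitting ≃ 𝔼.SheafSplitting,
        ∀ (σ : 𝔼.LagrangianSplitting) (U : Opens M) (b : smoothSections 𝓘(ℝ, E) FB B U)
          (m : U) (q : Q m),
          sectionValue ((Θ σ).toFun U b).1 m q = σ.1.toFun m q (b.1 m)) ∧
      -- the vector bundle with sections `𝒞(𝔼)` and the short exact sequence of vector bundles
      ∃ (r : ℕ) (Bh : M → Type) (_ : ∀ m, AddCommGroup (Bh m)) (_ : ∀ m, Module ℝ (Bh m))
        (_ : TopologicalSpace (TotalSpace (EuclideanSpace ℝ (Fin r)) Bh))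
        (_ : ∀ m, TopologicalSpace (Bh m))
        (_ : FiberBundle (EuclideanSpace ℝ (Fin r)) Bh)
        (_ : VectorBundle ℝ (EuclideanSpace ℝ (Fin r)) Bh)
        (_ : ContMDiffVectorBundle ∞ (EuclideanSpace ℝ (Fin r)) Bh 𝓘(ℝ, E))
        (Ψ : ∀ U : Opens M, smoothSections 𝓘(ℝ, E) (EuclideanSpace ℝ (Fin r)) Bh U
          ≃ₗ[SmoothFun 𝓘(ℝ, E) U] 𝔼.isotropicSections U)
        (j : ∀ m, (Q m [⋀^Fin 2]→L[ℝ] Bundle.Trivial M ℝ m) →ₗ[ℝ] Bh m)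
        (p : ∀ m, Bh m →ₗ[ℝ] B m),
        (∀ (U W : Opens M) (h : W ≤ U)
          (s : smoothSections 𝓘(ℝ, E) (EuclideanSpace ℝ (Fin r)) Bh U),
          𝔼.isotropicRes h (Ψ U s) = Ψ W (smoothSections.res 𝓘(ℝ, E) (EuclideanSpace ℝ (Fin r)) h s)) ∧
        ContMDiff (𝓘(ℝ, E).prod 𝓘(ℝ, FQ [⋀^Fin 2]→L[ℝ] ℝ))
          (𝓘(ℝ, E).prod 𝓘(ℝ, EuclideanSpace ℝ (Fin r))) ∞
          (fun x : TotalSpace (FQ [⋀^Fin 2]→L[ℝ] ℝ)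
            (fun m => Q m [⋀^Fin 2]→L[ℝ] Bundle.Trivial M ℝ m) =>
              (⟨x.proj, j x.proj x.2⟩ : TotalSpace (EuclideanSpace ℝ (Fin r)) Bh)) ∧
        ContMDiff (𝓘(ℝ, E).prod 𝓘(ℝ, EuclideanSpace ℝ (Fin r))) (𝓘(ℝ, E).prod 𝓘(ℝ, FB)) ∞
          (fun x : TotalSpace (EuclideanSpace ℝ (Fin r)) Bh =>
            (⟨x.proj, p x.proj x.2⟩ : TotalSpace FB B)) ∧
        (∀ m, Function.Injective (j m) ∧ Function.Exact (j m) (p m) ∧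
          Function.Surjective (p m)) ∧
        (∀ (U : Opens M) (α : twoForms E FQ Q U) (m : U),
          ((Ψ U).symm (ι U α)).1 m = j m (α.1 m)) ∧
        (∀ (U : Opens M) (s : smoothSections 𝓘(ℝ, E) (EuclideanSpace ℝ (Fin r)) Bh U) (m : U),
          (𝔼.isotropicBase U (Ψ U s)).1 m = p m (s.1 m)) := by
  obtain ⟨S, hS⟩ := 𝔼.exists_isLagrangianAt
  let L : ((FQ [⋀^Fin 2]→L[ℝ] ℝ) × FB) ≃L[ℝ]
      EuclideanSpace ℝ (Fin (Module.finrank ℝ ((FQ [⋀^Fin 2]→L[ℝ] ℝ) × FB))) :=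
    .ofFinrankEq (by simp)
  exact ⟨fun κ 𝒰 χ hχ => 𝔼.existsUnique_glue 𝒰 χ hχ, 𝔼.exists_basis_isotropicSections hS,
    𝔼.coreLinear, 𝔼.isCoreLinear_coreLinear, fun U W h α => rfl,
    fun U W h χ => 𝔼.isotropicBase_res h χ,
    fun U => ⟨𝔼.coreLinear_injective U, 𝔼.exact_coreLinear U,
      fun b => ⟨_, 𝔼.isotropicBase_splitSection hS U b⟩⟩,
    ⟨MetricDoubleVectorBundle.splittingEquiv, fun σ U b m q => σ.mk_linear m q (b.1 m)⟩,
    _, (modelCore _ _ L).Fiber, inferInstance, inferInstance, inferInstance, inferInstance,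
    inferInstance, inferInstance, inferInstance, 𝔼.modelSectionsEquiv hS L,
    modelInl (fun m => Q m [⋀^Fin 2]→L[ℝ] Bundle.Trivial M ℝ m) B L,
    modelSnd (fun m => Q m [⋀^Fin 2]→L[ℝ] Bundle.Trivial M ℝ m) B L, fun U W h s => rfl,
    contMDiff_modelInl L, contMDiff_modelSnd L,
    fun m => ⟨modelInl_injective L m, exact_modelInl_modelSnd L m, modelSnd_surjective L m⟩,
    𝔼.modelSectionsEquiv_symm_coreLinear hS L, 𝔼.isotropicBase_modelSectionsEquiv hS L⟩
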